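/- Let $\mathbb F$ be a field of characteristic zero, let $n\ge 1$, $m=2n-1$, and let $\mathfrak g=\mathfrak{sl}(2)\ltimes\mathfrak h_n$, where $\mathfrak h_n$ is the Heisenberg Lie algebra of dimension $2n+1$ and $\mathfrak{sl}(2)$ acts by derivations so that $\mathfrak h_n\simeq V(m)\oplus V(0)$, $V(0)$ being the center of $\mathfrak h_n$; here $V(k)$ is the irreducible $\mathfrak{sl}(2)$-module of highest weight $k$. All modules are finite dimensional. A $\mathfrak g$-module $V$ is *uniserial* if its socle series $0=\mathrm{soc}^0(V)\subset\mathrm{soc}^1(V)\subset\cdots$ is a composition series of $V$. A *socle decomposition* $V=V(a_0)\oplus\cdots\oplus V(a_k)$ is a decomposition of $V$ into irreducible $\mathfrak{sl}(2)$-submodules such that $\mathrm{soc}^{i+1}(V)=V(a_0)\oplus\cdots\oplus V(a_i)$ for all $i$. For $\alpha,\ell\ge 0$, $Z(\alpha,\ell)$ is the $\mathfrak g$-module $V(\alpha)\oplus V(\alpha+m)\oplus\cdots\oplus V(\alpha+\ell m)$ on which the center of $\mathfrak h_n$ acts by $0$ and $V(m)\subset\mathfrak h_n$ maps $V(\alpha)$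 to $0$ and $V(\alpha+jm)$ to $V(\alpha+(j-1)m)$, $1\le j\le\ell$, through the non-zero $\mathfrak{sl}(2)$-equivariant map $V(m)\otimes V(\alpha+jm)\to V(\alpha+(j-1)m)$ (unique up to a scalar). The modules *of type $Z$* are those isomorphic to some $Z(\alpha,\ell)$ or to a dual $Z(\alpha,\ell)^*$. A *standard faithful uniserial* module is a faithful uniserial $\mathfrak g$-module that, if $n=2$, does not have a socle decomposition $V(4)\oplus V(3)\oplus V(4)$. We write $FU_{(a_0,a_1,a_2)}$ for the faithful uniserial module with socle decomposition $V(a_0)\oplus V(a_1)\oplus V(a_2)$ and, for $n=1$, $FU^{\pm}_{a}=FU_{(a,a\pm1,a)}$ (with $a\ge1$ for the sign $-$). **Theorem.** Let $V_1=V(a_0)\oplus V(a_1)\oplus V(a_2)$ and $V_2=V(b_0)\oplus\cdots\oplus V(b_\ell)$ be socle decompositions of two uniserial $\mathfrak g$-modules, where $V_1$ is standard faithful and $V_2$ is of type $Z$. For $t\ge 0$ put $S_t=\big(\bigoplus_{i+j=t}V(a_i)\otimes V(b_j)\big)^{\mathfrak h_n}$ (the subspace annihilated by $\mathfrak h_n$).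 Then $$\mathrm{soc}(V_1\otimes V_2)=S_0\oplus S_1,$$ where $$S_0=\mathrm{soc}(V_1)\otimes\mathrm{soc}(V_2)\simeq\bigoplus_{k=0}^{\min\{a_0,b_0\}}V(a_0+b_0-2k)$$ as $\mathfrak{sl}(2)$-modules. If $\ell=0$ then $S_1=0$. If $\ell\ge1$, then, as an $\mathfrak{sl}(2)$-module, $S_1$ is as follows. *Case $n=1$ ($m=1$).* - $V_1=FU^+_{a_0}$, $V_2=Z(b_0,\ell)$: $S_1\simeq V(a_0+b_0+m)$. - $V_1=FU^+_{a_0}$, $V_2=Z(b_\ell,\ell)^*$: $S_1\simeq V(b_1-a_0)$ if $b_1\ge a_0$, and $S_1=0$ otherwise. - $V_1=FU^-_{a_0}$ ($a_0\ge1$), $V_2=Z(b_0,\ell)$: $S_1\simeq V(a_0-b_1)$ if $a_0\ge b_1$, and $S_1=0$ otherwise. - $V_1=FU^-_{a_0}$ ($a_0\ge1$), $V_2=Z(b_\ell,\ell)^*$: $S_1=0$. *Case $n>1$ ($m\ge3$).* - $V_1=FU_{(a_0,a_0+m,a_0)}$ with $a_0\in\{0,1\}$, $V_2=Z(b_0,\ell)$: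 $S_1\simeq V(a_0+b_0+m)$. - $V_1=FU_{(a_0,a_0+m,a_0)}$ with $a_0\in\{0,1\}$, $V_2=Z(b_\ell,\ell)^*$: $S_1\simeq V(b_1-a_0)$ if $a_0\le b_1$, and $S_1=0$ if $a_0>b_1$. - $V_1=FU_{(1,m-1,1)}$, $V_2=Z(b_0,\ell)$: $S_1\simeq V(m-1)$ if $b_0=0$, and $S_1=0$ otherwise. - $V_1=FU_{(1,m-1,1)}$, $V_2=Z(b_\ell,\ell)^*$: $S_1=0$. -/

import Mathlib

open scoped TensorProduct DirectSum

namespace Galilean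

section

attribute [local instance 100] LieRing.ofAssociativeRing

/-- The Lie algebra `sl(2)` of traceless `2 × 2` matrices over `F`. -/
abbrev SL2 (F : Type*) [Field F] : Type _ := LieAlgebra.SpecialLinear.sl (Fin 2) F

end

/-! ### The irreducible `sl(2)`-modules -/

/-- The underlying space of the irreducible `sl(2)`-module `V(a)` of highest weight `a`: a function
`c` stands for the vector `∑ k, c k • v_k`, where `v_0, …, v_a` is a basis of weight vectors. -/
def Irr (F : Type*) (a : ℕ) : Type _ := Fin (a + 1) → F

section Irr

variable {F : Type*} [Field F] {a : ℕ}

instance : AddCommGroup (Irr F a) := inferInstanceAs (AddCommGroup (Fin (a + 1) → F))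

instance : Module F (Irr F a) := inferInstanceAs (Module F (Fin (a + 1) → F))

/-- The `k`-th coordinate, extended by zero to `k > a`. -/
def coef (c : Irr F a) (k : ℕ) : F := if h : k < a + 1 then c ⟨k, h⟩ else 0

theorem coef_of_le {c : Irr F a} {k : ℕ} (h : k ≤ a) : coef c k = c ⟨k, Nat.lt_succ_of_le h⟩ :=
  dif_pos _

theorem coef_of_lt {c : Irr F a} {k : ℕ} (h : a < k) : coef c k = 0 :=
  dif_neg (by omega)

theorem coef_add (c d : Irr F a) (k : ℕ) : coef (c + d) k = coef c k + coef d k := by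
  unfold coef; split_ifs
  · rfl
  · simp

theorem coef_smul (t : F) (c : Irr F a) (k : ℕ) : coef (t • c) k = t * coef c k := by
  unfold coef; split_ifs
  · rfl
  · simp

theorem Irr.ext_coef {c d : Irr F a} (h : ∀ k ≤ a, coef c k = coef d k) : c = d := by
  funext k
  have := h k.1 (by omega)
  rwa [coef_of_le (by omega), coef_of_le (by omega)] at this

/-- The action of `sl(2)` on `V(a)`: with `e`, `h`, `f` the standard basis of `sl(2)`,
`h v_k = (a - 2k) v_k`, `e v_k = (a - k + 1) v_{k-1}` and `f v_k = (k + 1) v_{k+1}`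
(where `v_{-1} = v_{a+1} = 0`). -/
instance : Bracket (SL2 F) (Irr F a) where
  bracket A c := fun k =>
    A.1 0 0 * ((a : F) - 2 * (k.1 : F)) * coef c k.1
      + A.1 0 1 * ((a : F) - (k.1 : F)) * coef c (k.1 + 1)
      + A.1 1 0 * (k.1 : F) * coef c (k.1 - 1)

theorem coef_lie (A : SL2 F) (c : Irr F a) {k : ℕ} (hk : k ≤ a) :
    coef ⁅A, c⁆ k = A.1 0 0 * ((a : F) - 2 * (k : F)) * coef c k
      + A.1 0 1 * ((a : F) - (k : F)) * coef c (k + 1)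
      + A.1 1 0 * (k : F) * coef c (k - 1) := by
  rw [coef_of_le hk]; rfl

theorem sl2_trace (A : SL2 F) : A.1 1 1 = - A.1 0 0 := by
  have h : Matrix.trace A.1 = 0 := A.2
  rw [Matrix.trace_fin_two] at h
  linear_combination h

theorem sl2_add (A B : SL2 F) (i j : Fin 2) : (A + B).1 i j = A.1 i j + B.1 i j := rfl

theorem sl2_smul (t : F) (A : SL2 F) (i j : Fin 2) : (t • A).1 i j = t * A.1 i j := rfl

theorem sl2_lie00 (A B : SL2 F) :
    (⁅A, B⁆ : SL2 F).1 0 0 = A.1 0 1 * B.1 1 0 - B.1 0 1 * A.1 1 0 := by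
  simp [LieSubalgebra.coe_bracket, Ring.lie_def, Matrix.mul_apply, Fin.sum_univ_two]; ring

theorem sl2_lie01 (A B : SL2 F) :
    (⁅A, B⁆ : SL2 F).1 0 1 = 2 * (A.1 0 0 * B.1 0 1 - B.1 0 0 * A.1 0 1) := by
  simp [LieSubalgebra.coe_bracket, Ring.lie_def, Matrix.mul_apply, Fin.sum_univ_two, sl2_trace]
  ring

theorem sl2_lie10 (A B : SL2 F) :
    (⁅A, B⁆ : SL2 F).1 1 0 = 2 * (A.1 1 0 * B.1 0 0 - B.1 1 0 * A.1 0 0) := by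
  simp [LieSubalgebra.coe_bracket, Ring.lie_def, Matrix.mul_apply, Fin.sum_univ_two, sl2_trace]
  ring

instance : LieRingModule (SL2 F) (Irr F a) where
  add_lie A B c := Irr.ext_coef fun k hk => by
    simp only [coef_add, coef_lie _ _ hk, sl2_add]; ring
  lie_add A c d := Irr.ext_coef fun k hk => by
    simp only [coef_add, coef_lie _ _ hk]; ring
  leibniz_lie A B c := Irr.ext_coef fun k hk => by
    rw [coef_add, coef_lie _ _ hk, coef_lie _ _ hk, coef_lie _ _ hk, sl2_lie00, sl2_lie01,
      sl2_lie10, coef_lie _ _ hk, coef_lie _ _ hk]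
    have h1 : ∀ A : SL2 F, ((a : F) - (k : F)) * coef ⁅A, c⁆ (k + 1) = ((a : F) - (k : F)) *
        (A.1 0 0 * ((a : F) - 2 * (k + 1 : F)) * coef c (k + 1)
          + A.1 0 1 * ((a : F) - (k + 1 : F)) * coef c (k + 2)
          + A.1 1 0 * (k + 1 : F) * coef c k) := by
      intro A
      rcases Nat.lt_or_ge k a with h | h
      · rw [coef_lie _ _ (by omega)]; push_cast; rfl
      · have : k = a := by omega
        subst this; simp
    have h2 : ∀ A : SL2 F, (k : F) * coef ⁅A, c⁆ (k - 1) = (k : F) *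
        (A.1 0 0 * ((a : F) - 2 * (k - 1 : F)) * coef c (k - 1)
          + A.1 0 1 * ((a : F) - (k - 1 : F)) * coef c k
          + A.1 1 0 * (k - 1 : F) * coef c (k - 2)) := by
      intro A
      rcases Nat.eq_zero_or_pos k with h | h
      · subst h; simp
      · obtain ⟨j, rfl⟩ : ∃ j, k = j + 1 := ⟨k - 1, by omega⟩
        rw [coef_lie _ _ (by omega)]
        have e2 : j + 1 - 2 = j - 1 := by omega
        simp only [Nat.add_sub_cancel, e2]; push_cast; ring
    linear_combination A.1 0 1 * h1 B - B.1 0 1 * h1 A + A.1 1 0 * h2 B - B.1 1 0 * h2 A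

instance : LieModule F (SL2 F) (Irr F a) where
  smul_lie t A c := Irr.ext_coef fun k hk => by
    simp only [coef_smul, coef_lie _ _ hk, sl2_smul]
    ring
  lie_smul t A c := Irr.ext_coef fun k hk => by
    simp only [coef_smul, coef_lie _ _ hk]; ring

end Irr

/-! ### The contraction `V(m) ⊗ V(b) → V(a)`, `b = a + m` -/

section contract

variable {F : Type*} [Field F] {m a b : ℕ}

/-- For `b = a + m`, this is the `sl(2)`-equivariant bilinear map `V(m) × V(b) → V(a)`, which is
unique up to a scalar: `(v_s, v_j) ↦ (-1)^s * (m choose s) • v_{j + s - m}`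
(which is `0` for `j + s < m`). -/
def contract (x : Irr F m) (c : Irr F b) : Irr F a := fun k =>
  ∑ s ∈ Finset.range (m + 1), (-1) ^ s * (m.choose s : F) * coef x s * coef c (k.1 + (m - s))

theorem coef_contract (x : Irr F m) (c : Irr F b) {k : ℕ} (hk : k ≤ a) :
    coef (contract x c : Irr F a) k =
      ∑ s ∈ Finset.range (m + 1), (-1) ^ s * (m.choose s : F) * coef x s * coef c (k + (m - s)) := by
  rw [coef_of_le hk]; rfl

theorem contract_add_left (x y : Irr F m) (c : Irr F b) :
    (contract (x + y) c : Irr F a) = contract x c + contract y c := Irr.ext_coef fun k hk => by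
  simp only [coef_add, coef_contract _ _ hk, ← Finset.sum_add_distrib]
  exact Finset.sum_congr rfl fun s _ => by ring

theorem contract_add_right (x : Irr F m) (c d : Irr F b) :
    (contract x (c + d) : Irr F a) = contract x c + contract x d := Irr.ext_coef fun k hk => by
  simp only [coef_add, coef_contract _ _ hk, ← Finset.sum_add_distrib]
  exact Finset.sum_congr rfl fun s _ => by ring

theorem contract_smul_left (t : F) (x : Irr F m) (c : Irr F b) :
    (contract (t • x) c : Irr F a) = t • contract x c := Irr.ext_coef fun k hk => by
  simp only [coef_smul, coef_contract _ _ hk, Finset.mul_sum]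
  exact Finset.sum_congr rfl fun s _ => by ring

theorem contract_smul_right (t : F) (x : Irr F m) (c : Irr F b) :
    (contract x (t • c) : Irr F a) = t • contract x c := Irr.ext_coef fun k hk => by
  simp only [coef_smul, coef_contract _ _ hk, Finset.mul_sum]
  exact Finset.sum_congr rfl fun s _ => by ring

theorem contract_aux (m : ℕ) (G : ℕ → F) :
    ∑ s ∈ Finset.range (m + 1), ((-1) ^ s * (m.choose s : F) * (s : F) * G s
      + (-1) ^ s * (m.choose s : F) * ((m : F) - s) * G (s + 1)) = 0 := by
  rw [Finset.sum_add_distrib, Finset.sum_range_succ', Finset.sum_range_succ _ m]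
  simp only [Nat.cast_zero, mul_zero, zero_mul, add_zero, sub_self]
  rw [← Finset.sum_add_distrib]
  refine Finset.sum_eq_zero fun s hs => ?_
  have hs : s < m := Finset.mem_range.1 hs
  have h : (m.choose (s + 1) : F) * ((s + 1 : ℕ) : F) = (m.choose s : F) * ((m : F) - s) := by
    have := congrArg (Nat.cast : ℕ → F) (Nat.choose_succ_right_eq m s)
    push_cast [Nat.cast_sub hs.le] at this ⊢
    exact this
  rw [pow_succ]
  linear_combination (-1) ^ s * (-1) * G (s + 1) * h

/-- The contraction is `sl(2)`-equivariant. -/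
theorem lie_contract (hb : b = a + m) (A : SL2 F) (x : Irr F m) (c : Irr F b) :
    ⁅A, (contract x c : Irr F a)⁆ = contract ⁅A, x⁆ c + contract x ⁅A, c⁆ :=
  Irr.ext_coef fun k hk => by
  have h1 : ((a : F) - k) * coef (contract x c : Irr F a) (k + 1) = ((a : F) - k) *
      ∑ s ∈ Finset.range (m + 1),
        (-1) ^ s * (m.choose s : F) * coef x s * coef c (k + 1 + (m - s)) := by
    rcases Nat.lt_or_ge k a with h | h
    · rw [coef_contract _ _ (by omega)]
    · have : k = a := by omega
      subst this; simp
  have h2 : coef (contract x c : Irr F a) (k - 1) =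
      ∑ s ∈ Finset.range (m + 1),
        (-1) ^ s * (m.choose s : F) * coef x s * coef c (k - 1 + (m - s)) :=
    coef_contract _ _ (by omega)
  have e1 := contract_aux m fun s => coef x s * coef c (k + 1 + (m - s))
  have e2 := contract_aux m fun s => coef x (s - 1) * coef c (k + (m - s))
  rw [coef_lie _ _ hk, coef_add, coef_contract _ _ hk, coef_contract _ _ hk, coef_contract _ _ hk,
    h2]
  rw [← sub_eq_zero]
  have e3 : ∀ {p q u v : F}, u = 0 → v = 0 → -(p * u + q * v) = 0 := by
    rintro p q u v rfl rfl; simp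
  refine Eq.trans ?_ (e3 (p := A.1 0 1) (q := A.1 1 0) e1 e2)
  rw [mul_assoc (A.1 0 1), h1]
  simp only [Finset.mul_sum, ← Finset.sum_add_distrib, ← Finset.sum_sub_distrib,
    ← Finset.sum_neg_distrib]
  refine Finset.sum_congr rfl fun s hs => ?_
  have hs : s ≤ m := by have := Finset.mem_range.1 hs; omega
  rw [coef_lie _ _ hs, coef_lie _ _ (by omega : k + (m - s) ≤ b)]
  subst hb
  rcases Nat.lt_or_ge s m with h | h
  · obtain ⟨r, rfl⟩ : ∃ r, m = s + r + 1 := ⟨m - s - 1, by omega⟩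
    have i1 : s + r + 1 - s = r + 1 := by omega
    have i2 : s + r + 1 - (s + 1) = r := by omega
    have i3 : k + (r + 1) - 1 = k + r := by omega
    have i4 : k + 1 + r = k + (r + 1) := by omega
    have i5 : k + (r + 1) + 1 = k + 1 + (r + 1) := by omega
    simp only [i1, i2, i3, i4, i5, Nat.add_sub_cancel]
    push_cast
    rcases Nat.eq_zero_or_pos k with h0 | h0
    · subst h0; push_cast; ring
    · obtain ⟨j, rfl⟩ : ∃ j, k = j + 1 := ⟨k - 1, by omega⟩
      have i6 : j + 1 - 1 + (r + 1) = j + 1 + r := by omega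
      simp only [i6]
      push_cast; ring
  · have : s = m := by omega
    subst this
    simp only [Nat.sub_self, add_zero]
    push_cast
    ring

/-- Contractions by two elements of `V(m)` commute. -/
theorem contract_comm {d : ℕ} (hb : b = a + m) (x y : Irr F m) (c : Irr F d) :
    (contract x (contract y c : Irr F b) : Irr F a) = contract y (contract x c : Irr F b) :=
  Irr.ext_coef fun k hk => by
  have key : ∀ x y : Irr F m, coef (contract x (contract y c : Irr F b) : Irr F a) k =
      ∑ s ∈ Finset.range (m + 1), ∑ t ∈ Finset.range (m + 1),
        (-1) ^ s * (m.choose s : F) * coef x s * ((-1) ^ t * (m.choose t : F) * coef y t) *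
          coef c (k + (m - s) + (m - t)) := by
    intro x y
    rw [coef_contract _ _ hk]
    refine Finset.sum_congr rfl fun s hs => ?_
    rw [coef_contract _ _ (by omega), Finset.mul_sum]
    exact Finset.sum_congr rfl fun t _ => by ring
  rw [key, key, Finset.sum_comm]
  refine Finset.sum_congr rfl fun s _ => Finset.sum_congr rfl fun t _ => ?_
  rw [show k + (m - t) + (m - s) = k + (m - s) + (m - t) by omega]
  ring

end contract

/-! ### The Lie algebra `sl(2) ⋉ h_n` -/

section algebra

variable {F : Type*} [Field F]

/-- The underlying space of the Heisenberg Lie algebra `h_n`: as an `sl(2)`-module, it is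
`V(m) ⊕ V(0)` with `m = 2n - 1`, the second summand being the center `F z`. -/
def Heis (F : Type*) (n : ℕ) : Type _ := Irr F (2 * n - 1) × F

instance (n : ℕ) : AddCommGroup (Heis F n) := inferInstanceAs (AddCommGroup (Irr F _ × F))

instance (n : ℕ) : Module F (Heis F n) := inferInstanceAs (Module F (Irr F _ × F))

/-- The alternating `sl(2)`-invariant form on `V(m)`, `m` odd: if `v_0, …, v_m` is the basis of
`V(m)`, then `ω(v_s, v_{m-s}) = 2 * (-1)^s * (m choose s)` and `ω(v_s, v_t) = 0` for `s + t ≠ m`.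
(For even `m` the form is zero.) -/
def omega {m : ℕ} (x y : Irr F m) : F :=
  coef (contract x y : Irr F 0) 0 - coef (contract y x : Irr F 0) 0

theorem omega_lie {m : ℕ} (A : SL2 F) (x y : Irr F m) : omega ⁅A, x⁆ y + omega x ⁅A, y⁆ = 0 := by
  have h : ∀ x y : Irr F m,
      coef (contract ⁅A, x⁆ y : Irr F 0) 0 + coef (contract x ⁅A, y⁆ : Irr F 0) 0 = 0 := by
    intro x y
    rw [← coef_add, ← lie_contract (Nat.zero_add m).symm, coef_lie _ _ le_rfl]
    simp
  unfold omega
  linear_combination h x y - h y x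

/-- The Heisenberg bracket `[x + s z, y + t z] = ω(x, y) z` for `x, y ∈ V(m)`. -/
instance (n : ℕ) : LieRing (Heis F n) where
  bracket x y := (0, omega x.1 y.1)
  add_lie x y w := Prod.ext (add_zero (0 : Irr F _)).symm <| by
    change omega (x.1 + y.1) w.1 = omega x.1 w.1 + omega y.1 w.1
    simp only [omega, contract_add_left, contract_add_right, coef_add]; ring
  lie_add x y w := Prod.ext (add_zero (0 : Irr F _)).symm <| by
    change omega x.1 (y.1 + w.1) = omega x.1 y.1 + omega x.1 w.1
    simp only [omega, contract_add_left, contract_add_right, coef_add]; ring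
  lie_self x := Prod.ext rfl (sub_self _)
  leibniz_lie x y w := by
    have hr : ∀ x : Irr F (2 * n - 1), omega x 0 = 0 := fun x => by
      have := contract_smul_left (a := 0) (0 : F) (0 : Irr F (2 * n - 1)) x
      have h' := contract_smul_right (a := 0) (0 : F) x (0 : Irr F (2 * n - 1))
      simp only [zero_smul] at this h'
      simp [omega, this, h']
    have hl : ∀ x : Irr F (2 * n - 1), omega 0 x = 0 := fun x => by
      rw [← neg_eq_zero, ← hr x]; simp [omega]
    refine Prod.ext (add_zero (0 : Irr F _)).symm ?_
    change omega x.1 0 = omega 0 w.1 + omega y.1 0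
    rw [hr, hr, hl, add_zero]

instance (n : ℕ) : LieAlgebra F (Heis F n) where
  lie_smul t x y := Prod.ext (smul_zero t).symm <| by
    change omega x.1 (t • y.1) = t * omega x.1 y.1
    simp only [omega, contract_smul_left, contract_smul_right, coef_smul]; ring

/-- The action of `sl(2)` on `h_n ≃ V(m) ⊕ V(0)` by derivations. -/
def heisAction (F : Type*) [Field F] (n : ℕ) :
    SL2 F →ₗ⁅F⁆ LieDerivation F (Heis F n) (Heis F n) where
  toFun A :=
    { toFun := fun x => (⁅A, x.1⁆, 0)
      map_add' := fun x y => Prod.ext (lie_add A x.1 y.1) (add_zero (0 : F)).symm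
      map_smul' := fun t x => Prod.ext (lie_smul t A x.1) (mul_zero t).symm
      leibniz' := fun x y => Prod.ext
        (by change ⁅A, (0 : Irr F (2 * n - 1))⁆ = 0 - 0; rw [lie_zero, sub_zero])
        (by
          change (0 : F) = omega x.1 ⁅A, y.1⁆ - omega y.1 ⁅A, x.1⁆
          have h := omega_lie A x.1 y.1
          have h' : omega ⁅A, x.1⁆ y.1 = - omega y.1 ⁅A, x.1⁆ := by unfold omega; ring
          rw [h'] at h
          linear_combination -h) }
  map_add' A B := LieDerivation.ext fun x =>
    Prod.ext (add_lie A B x.1) (add_zero (0 : F)).symm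
  map_smul' t A := LieDerivation.ext fun x =>
    Prod.ext (smul_lie t A x.1) (mul_zero t).symm
  map_lie' {A B} := LieDerivation.ext fun x => by
    rw [LieDerivation.lie_apply]
    exact Prod.ext (lie_lie A B x.1) (sub_zero (0 : F)).symm

/-- The Galilean Lie algebra `sl(2) ⋉ h_n`. -/
abbrev Gal (F : Type*) [Field F] (n : ℕ) : Type _ :=
  LieAlgebra.SemiDirectSum (Heis F n) (SL2 F) (heisAction F n)

/-- The inclusion `sl(2) → sl(2) ⋉ h_n`. -/
abbrev ofSL2 (F : Type*) [Field F] (n : ℕ) : SL2 F →ₗ⁅F⁆ Gal F n :=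
  LieAlgebra.SemiDirectSum.inr (heisAction F n)

/-- The inclusion `h_n → sl(2) ⋉ h_n`. -/
abbrev ofHeis (F : Type*) [Field F] (n : ℕ) : Heis F n →ₗ⁅F⁆ Gal F n :=
  LieAlgebra.SemiDirectSum.inl (heisAction F n)

end algebra

/-! ### The modules of type `Z` -/

section typeZ

variable {F : Type*} [Field F] {n α ℓ : ℕ}

/-- The underlying space of the module
`Z(α, ℓ) = V(α) ⊕ V(α + m) ⊕ ⋯ ⊕ V(α + ℓ m)` with `m = 2n - 1`. -/
def ModZ (F : Type*) (n α ℓ : ℕ) : Type _ :=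
  (j : Fin (ℓ + 1)) → Irr F (α + j.1 * (2 * n - 1))

instance : AddCommGroup (ModZ F n α ℓ) :=
  inferInstanceAs (AddCommGroup ((j : Fin (ℓ + 1)) → Irr F (α + j.1 * (2 * n - 1))))

instance : Module F (ModZ F n α ℓ) :=
  inferInstanceAs (Module F ((j : Fin (ℓ + 1)) → Irr F (α + j.1 * (2 * n - 1))))

/-- The operator on `Z(α, ℓ)` by which `x ∈ V(m) ⊆ h_n` acts: it maps `V(α + (j + 1) m)` to
`V(α + j m)` through the equivariant map `V(m) ⊗ V(α + (j + 1) m) → V(α + j m)`, and `V(α)`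
to `0`. -/
def shift (x : Irr F (2 * n - 1)) (c : ModZ F n α ℓ) : ModZ F n α ℓ := fun j =>
  if h : j.1 + 1 < ℓ + 1 then contract x (c ⟨j.1 + 1, h⟩) else 0

/-- `sl(2)` acts on `Z(α, ℓ)` componentwise, `V(m) ⊆ h_n` by `shift`, and the center of `h_n` by
zero. -/
instance : Bracket (Gal F n) (ModZ F n α ℓ) where
  bracket X c := fun j => ⁅X.right, c j⁆ + shift X.left.1 c j

theorem modZ_lie (X : Gal F n) (c : ModZ F n α ℓ) :
    ⁅X, c⁆ = (show ModZ F n α ℓ from fun j => ⁅X.right, c j⁆) + shift X.left.1 c := rfl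

theorem modZ_lie_apply (X : Gal F n) (c : ModZ F n α ℓ) (j : Fin (ℓ + 1)) :
    ⁅X, c⁆ j = ⁅X.right, c j⁆ + shift X.left.1 c j := rfl

theorem shift_add_left (x y : Irr F (2 * n - 1)) (c : ModZ F n α ℓ) :
    shift (x + y) c = shift x c + shift y c := by
  funext j
  change shift (x + y) c j = shift x c j + shift y c j
  unfold shift; split_ifs
  · exact contract_add_left _ _ _
  · exact (add_zero _).symm

theorem shift_add_right (x : Irr F (2 * n - 1)) (c d : ModZ F n α ℓ) :
    shift x (c + d) = shift x c + shift x d := by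
  funext j
  change shift x (c + d) j = shift x c j + shift x d j
  unfold shift; split_ifs
  · exact contract_add_right _ _ _
  · exact (add_zero _).symm

theorem shift_smul_left (t : F) (x : Irr F (2 * n - 1)) (c : ModZ F n α ℓ) :
    shift (t • x) c = t • shift x c := by
  funext j
  change shift (t • x) c j = t • shift x c j
  unfold shift; split_ifs
  · exact contract_smul_left _ _ _
  · exact (smul_zero _).symm

theorem shift_smul_right (t : F) (x : Irr F (2 * n - 1)) (c : ModZ F n α ℓ) :
    shift x (t • c) = t • shift x c := by
  funext j
  change shift x (t • c) j = t • shift x c j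
  unfold shift; split_ifs
  · exact contract_smul_right _ _ _
  · exact (smul_zero _).symm

theorem shift_comm (x y : Irr F (2 * n - 1)) (c : ModZ F n α ℓ) :
    shift x (shift y c) = shift y (shift x c) := by
  funext j
  by_cases h : j.1 + 1 < ℓ + 1
  · by_cases h' : j.1 + 1 + 1 < ℓ + 1
    · simp only [shift, dif_pos h, dif_pos h']
      exact contract_comm (by ring) _ _ _
    · have hz : ∀ x : Irr F (2 * n - 1), (contract x (0 : Irr F (α + (j.1 + 1) * (2 * n - 1))) :
          Irr F (α + j.1 * (2 * n - 1))) = 0 := fun x => by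
        have := contract_smul_right (a := α + j.1 * (2 * n - 1)) (0 : F) x
          (0 : Irr F (α + (j.1 + 1) * (2 * n - 1)))
        simpa using this
      simp only [shift, dif_pos h, dif_neg h']
      rw [hz, hz]
  · simp only [shift, dif_neg h]

theorem lie_shift (A : SL2 F) (x : Irr F (2 * n - 1)) (c : ModZ F n α ℓ) (j : Fin (ℓ + 1)) :
    ⁅A, shift x c j⁆ = shift ⁅A, x⁆ c j + shift x (fun i => ⁅A, c i⁆) j := by
  by_cases h : j.1 + 1 < ℓ + 1
  · simp only [shift, dif_pos h]
    exact lie_contract (by ring) _ _ _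
  · simp only [shift, dif_neg h, lie_zero, add_zero]

instance : LieRingModule (Gal F n) (ModZ F n α ℓ) where
  add_lie X Y c := by
    funext j
    change ⁅X + Y, c⁆ j = ⁅X, c⁆ j + ⁅Y, c⁆ j
    simp only [modZ_lie_apply]
    change ⁅X.right + Y.right, c j⁆ + shift (X.left.1 + Y.left.1) c j = _
    rw [add_lie, shift_add_left]
    change _ + (shift X.left.1 c j + shift Y.left.1 c j) = _
    abel
  lie_add X c d := by
    funext j
    change ⁅X, c + d⁆ j = ⁅X, c⁆ j + ⁅X, d⁆ j
    simp only [modZ_lie_apply]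
    rw [shift_add_right]
    change ⁅X.right, c j + d j⁆ + (shift X.left.1 c j + shift X.left.1 d j) = _
    rw [lie_add]
    abel
  leibniz_lie X Y c := by
    funext j
    change ⁅X, ⁅Y, c⁆⁆ j = ⁅⁅X, Y⁆, c⁆ j + ⁅Y, ⁅X, c⁆⁆ j
    have h1 : ∀ X Y : Gal F n, ⁅X, ⁅Y, c⁆⁆ j = ⁅X.right, ⁅Y.right, c j⁆⁆
        + (shift ⁅X.right, Y.left.1⁆ c j + shift Y.left.1 (fun i => ⁅X.right, c i⁆) j)
        + (shift X.left.1 (fun i => ⁅Y.right, c i⁆) j + shift X.left.1 (shift Y.left.1 c) j) := by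
      intro X Y
      rw [modZ_lie_apply, modZ_lie_apply, lie_add, lie_shift, modZ_lie Y c, shift_add_right]
      rfl
    have h2 : ⁅⁅X, Y⁆, c⁆ j = ⁅⁅X.right, Y.right⁆, c j⁆
        + (shift ⁅X.right, Y.left.1⁆ c j - shift ⁅Y.right, X.left.1⁆ c j) := by
      rw [modZ_lie_apply]
      have e : (⁅X, Y⁆ : Gal F n).left.1 = ⁅X.right, Y.left.1⁆ + (-1 : F) • ⁅Y.right, X.left.1⁆ := by
        change (0 : Irr F (2 * n - 1)) + ⁅X.right, Y.left.1⁆ - ⁅Y.right, X.left.1⁆ = _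
        rw [zero_add, neg_one_smul, sub_eq_add_neg]
      rw [e, shift_add_left, shift_smul_left]
      change _ + (shift ⁅X.right, Y.left.1⁆ c j + (-1 : F) • shift ⁅Y.right, X.left.1⁆ c j) = _
      rw [neg_one_smul, ← sub_eq_add_neg]
      rfl
    rw [h1, h1, h2, lie_lie, shift_comm]
    abel

instance : LieModule F (Gal F n) (ModZ F n α ℓ) where
  smul_lie t X c := by
    funext j
    change ⁅t • X, c⁆ j = t • ⁅X, c⁆ j
    simp only [modZ_lie_apply]
    change ⁅t • X.right, c j⁆ + shift (t • X.left.1) c j = _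
    rw [smul_lie, shift_smul_left, smul_add]
    rfl
  lie_smul t X c := by
    funext j
    change ⁅X, t • c⁆ j = t • ⁅X, c⁆ j
    simp only [modZ_lie_apply]
    rw [shift_smul_right]
    change ⁅X.right, t • c j⁆ + t • shift X.left.1 c j = _
    rw [lie_smul, smul_add]

end typeZ

/-! ### Socle series, uniserial modules, socle decompositions -/

section socle

variable (F : Type*) [Field F]

/-- The socle of a module over a Lie algebra: the sum of all its irreducible submodules. -/
def socle (L V : Type*) [LieRing L] [LieAlgebra F L] [AddCommGroup V] [Module F V]
    [LieRingModule L V] [LieModule F L V] : LieSubmodule F L V :=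
  sSup {N | LieModule.IsIrreducible F L N}

/-- The socle series: `soc^0(V) = 0`, and `soc^(i+1)(V) / soc^i(V)` is the socle of
`V / soc^i(V)`. -/
def socSeries (L V : Type*) [LieRing L] [LieAlgebra F L] [AddCommGroup V] [Module F V]
    [LieRingModule L V] [LieModule F L V] : ℕ → LieSubmodule F L V
  | 0 => ⊥
  | i + 1 => (socle F L (V ⧸ socSeries L V i)).comap (LieSubmodule.Quotient.mk' (socSeries L V i))

/-- A module is uniserial if its socle series is a composition series: it reaches the whole module
after finitely many steps, each of them with an irreducible factor. -/
def IsUniserial (L V : Type*) [LieRing L] [LieAlgebra F L] [AddCommGroup V] [Module F V]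
    [LieRingModule L V] [LieModule F L V] : Prop :=
  ∃ k : ℕ, socSeries F L V k = ⊤ ∧ ∀ i < k, socSeries F L V i ⋖ socSeries F L V (i + 1)

variable {F} (n : ℕ)

/-- The subspace `S` of the `(sl(2) ⋉ h_n)`-module `V` is an `sl(2)`-submodule isomorphic to the
`sl(2)`-module `W`: it is the image of an injective `sl(2)`-equivariant linear map `W → V`. -/
def Sl2Iso {V : Type*} [AddCommGroup V] [Module F V] [LieRingModule (Gal F n) V] (S : Submodule F V)
    (W : Type*) [AddCommGroup W] [Module F W] [LieRingModule (SL2 F) W] : Prop :=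
  ∃ φ : W →ₗ[F] V, Function.Injective φ ∧ LinearMap.range φ = S ∧
    ∀ (A : SL2 F) (w : W), φ ⁅A, w⁆ = ⁅ofSL2 F n A, φ w⁆

variable (F)

/-- A socle decomposition `V = V(a_0) ⊕ V(a_1) ⊕ ⋯` of a `(sl(2) ⋉ h_n)`-module: `V` is the direct
sum of `sl(2)`-submodules `part i ≃ V(a i)` such that the first `i + 1` of them add up to the
`(i + 1)`-st term of the socle series. In particular `part i ≃ soc^(i+1)(V) / soc^i(V)`. -/
structure SocleDecomposition (V : Type*) [AddCommGroup V] [Module F V]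
    [LieRingModule (Gal F n) V] [LieModule F (Gal F n) V] {k : ℕ} (a : Fin k → ℕ) where
  /-- The summands. -/
  part : Fin k → Submodule F V
  part_iso : ∀ i, Sl2Iso n (part i) (Irr F (a i))
  isInternal : DirectSum.IsInternal part
  socSeries_eq : ∀ i : Fin k,
    (socSeries F (Gal F n) V (i.1 + 1)).toSubmodule = ⨆ j : Fin k, ⨆ _ : j ≤ i, part j

/-- A standard faithful uniserial `(sl(2) ⋉ h_n)`-module: a faithful uniserial module that is not
the exceptional module `FU_(4,3,4)`. The latter occurs for `n = 2` only; it is, up to isomorphism,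
the only faithful uniserial module with socle decomposition `V(4) ⊕ V(3) ⊕ V(4)`. -/
def IsStandardFaithful (V : Type*) [AddCommGroup V] [Module F V]
    [LieRingModule (Gal F n) V] [LieModule F (Gal F n) V] : Prop :=
  LieModule.IsFaithful F (Gal F n) V ∧ IsUniserial F (Gal F n) V ∧
    ¬ (n = 2 ∧ Nonempty (SocleDecomposition F n V ![4, 3, 4]))

/-- `V` is isomorphic to `Z(α, ℓ)`. -/
def IsZ (V : Type*) [AddCommGroup V] [Module F V] [LieRingModule (Gal F n) V] (α ℓ : ℕ) : Prop :=
  Nonempty (V ≃ₗ⁅F, Gal F n⁆ ModZ F n α ℓ)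

/-- `V` is isomorphic to the dual module `Z(α, ℓ)^*`. -/
def IsZDual (V : Type*) [AddCommGroup V] [Module F V] [LieRingModule (Gal F n) V] (α ℓ : ℕ) :
    Prop :=
  Nonempty (V ≃ₗ⁅F, Gal F n⁆ (ModZ F n α ℓ →ₗ[F] F))

/-- The modules of type `Z`: all `Z(α, ℓ)` and their duals. -/
def IsTypeZ (V : Type*) [AddCommGroup V] [Module F V] [LieRingModule (Gal F n) V] : Prop :=
  ∃ α ℓ : ℕ, IsZ F n V α ℓ ∨ IsZDual F n V α ℓ

variable {F}

/-- The invariants of `h_n`. -/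
def heisInvariants (U : Type*) [AddCommGroup U] [Module F U]
    [LieRingModule (Gal F n) U] [LieModule F (Gal F n) U] : Submodule F U where
  carrier := {u | ∀ x : Heis F n, ⁅ofHeis F n x, u⁆ = 0}
  zero_mem' x := lie_zero _
  add_mem' hu hv x := by rw [lie_add, hu x, hv x, add_zero]
  smul_mem' t u hu x := by rw [lie_smul, hu x, smul_zero]

/-- The subspace `P ⊗ Q` of `V ⊗ W`, for subspaces `P` of `V` and `Q` of `W`. -/
abbrev tensorSub {V W : Type*} [AddCommGroup V] [Module F V] [AddCommGroup W] [Module F W]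
    (P : Submodule F V) (Q : Submodule F W) : Submodule F (V ⊗[F] W) :=
  Submodule.map₂ (TensorProduct.mk F V W) P Q

/-- `S_t(V, W)`: the `h_n`-invariants in `⨁_{i + j = t} V(a_i) ⊗ V(b_j)`, for two modules with
socle decompositions `V = V(a_0) ⊕ ⋯` and `W = V(b_0) ⊕ ⋯`. -/
def socPart {V W : Type*} [AddCommGroup V] [Module F V] [LieRingModule (Gal F n) V]
    [LieModule F (Gal F n) V] [AddCommGroup W] [Module F W] [LieRingModule (Gal F n) W]
    [LieModule F (Gal F n) W] {k l : ℕ} {a : Fin k → ℕ} {b : Fin l → ℕ}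
    (D : SocleDecomposition F n V a) (E : SocleDecomposition F n W b) (t : ℕ) :
    Submodule F (V ⊗[F] W) :=
  (⨆ i : Fin k, ⨆ j : Fin l, ⨆ _ : i.1 + j.1 = t, tensorSub (D.part i) (E.part j)) ⊓
    heisInvariants n (V ⊗[F] W)

end socle

end Galilean

/-! The socle consists of the `h_n`-invariants. In both factors `h_n` maps each summand of the socle
decomposition only into the preceding one, so V(m) lowers the degree i + j on the tensor product by
one. Hence every non-zero submodule contains invariants (`exists_invariant_mem`), and irreducible
submodules consist of them (`socle_le_heisInvariants`); conversely, a copy of V(μ) killed by `h_n`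
is an irreducible submodule (`range_le_socle`). Homogeneous components of invariants are again
invariant (`degProj_mem_socPart`), so the socle is the sum of the S_t and each S_t can be computed
separately.

As e is nilpotent, S_t is governed by its vectors killed by e, and on e-stable sets invariance need
only be tested on the lowest weight vector v_m of V(m) (`mem_heisInvariants_of_low`). By
`family_shape`, v_m acts between neighbouring summands through v_r ↦ t · C(r + κ, κ) v_{r+κ}, with κ
read off from the two highest weights. A vector of V(a) ⊗ V(d) killed by e is an array which on each
antidiagonal s + t = r is a multiple of an explicit signed product of factorials
(`IsHW.exists_coeff`). Invariance thus becomes, for each (i, j), one relation between the arrays of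
the components (i, j + 1) and (i + 1, j): the structure `IsPair`.

These relations are solved according to (κ, κ'). For (0, 0) only antidiagonal 0 survives; for (0, m)
a single antidiagonal survives, subject to an inequality of weights, and (m, 0) is its mirror image;
(m, m) and (1, m) have only the zero solution; (1, 0) has one precisely on antidiagonal 1 and for
trivial V(b). Taking i = j = 0 gives S_1. In degree at least two the component V(a_1) ⊗ V(b_{j+1})
is subject to two such relations, which together kill it (`tcf_middle_eq_zero`), and the other
components follow. S_0 carries no condition and is decomposed by explicit highest weight vectors and
a dimension count.

The admissible weights come from two sources. For V₁, faithfulness makes the center act by a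
non-zero map V(a_2) → V(a_0), and the Heisenberg relation turns into binomial identities with few
solutions (`weights_of_family`, `standardFaithful_shape`). For V₂, only the multiplicity-free list
of `sl(2)`-weights is used: it forces the weights to run monotonically in steps of m
(`HasWeights.shape`). -/

namespace Galilean

/-! ### Explicit `sl(2)`-theory of the modules V(a). -/

section basic

variable {F : Type*} [Field F]

/-! ### The standard basis of `sl(2)` and its action on `V(a)` -/

/-- The raising element `e` of `sl(2)`. -/
def sE : SL2 F := ⟨!![0, 1; 0, 0],
  show Matrix.trace (!![0, 1; 0, 0] : Matrix (Fin 2) (Fin 2) F) = 0 by simp [Matrix.trace_fin_two]⟩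

/-- The lowering element `f` of `sl(2)`. -/
def sF : SL2 F := ⟨!![0, 0; 1, 0],
  show Matrix.trace (!![0, 0; 1, 0] : Matrix (Fin 2) (Fin 2) F) = 0 by simp [Matrix.trace_fin_two]⟩

/-- The Cartan element `h` of `sl(2)`. -/
def sH : SL2 F := ⟨!![1, 0; 0, -1],
  show Matrix.trace (!![1, 0; 0, -1] : Matrix (Fin 2) (Fin 2) F) = 0 by simp [Matrix.trace_fin_two]⟩

@[simp] theorem sE_00 : (sE : SL2 F).1 0 0 = 0 := rfl
@[simp] theorem sE_01 : (sE : SL2 F).1 0 1 = 1 := rfl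
@[simp] theorem sE_10 : (sE : SL2 F).1 1 0 = 0 := rfl
@[simp] theorem sF_00 : (sF : SL2 F).1 0 0 = 0 := rfl
@[simp] theorem sF_01 : (sF : SL2 F).1 0 1 = 0 := rfl
@[simp] theorem sF_10 : (sF : SL2 F).1 1 0 = 1 := rfl
@[simp] theorem sH_00 : (sH : SL2 F).1 0 0 = 1 := rfl
@[simp] theorem sH_01 : (sH : SL2 F).1 0 1 = 0 := rfl
@[simp] theorem sH_10 : (sH : SL2 F).1 1 0 = 0 := rfl

theorem sl2_ext {A B : SL2 F} (h0 : A.1 0 0 = B.1 0 0) (h1 : A.1 0 1 = B.1 0 1)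
    (h2 : A.1 1 0 = B.1 1 0) : A = B := by
  apply Subtype.ext
  ext i j
  fin_cases i <;> fin_cases j
  · exact h0
  · exact h1
  · exact h2
  · exact (sl2_trace A).trans ((congrArg Neg.neg h0).trans (sl2_trace B).symm)

theorem sl2_eq (A : SL2 F) : A = A.1 0 0 • sH + A.1 0 1 • sE + A.1 1 0 • sF := by
  apply sl2_ext <;> simp only [sl2_add, sl2_smul] <;> simp

theorem lie_sE_sF : ⁅(sE : SL2 F), (sF : SL2 F)⁆ = sH := by
  apply sl2_ext <;> simp only [sl2_lie00, sl2_lie01, sl2_lie10] <;> simp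

theorem lie_sH_sE : ⁅(sH : SL2 F), (sE : SL2 F)⁆ = (2 : F) • sE := by
  apply sl2_ext <;> simp only [sl2_lie00, sl2_lie01, sl2_lie10, sl2_smul] <;> simp

theorem lie_sH_sF : ⁅(sH : SL2 F), (sF : SL2 F)⁆ = (-2 : F) • sF := by
  apply sl2_ext <;> simp only [sl2_lie00, sl2_lie01, sl2_lie10, sl2_smul] <;> simp

variable {a : ℕ}

@[simp] theorem coef_zero (k : ℕ) : coef (0 : Irr F a) k = 0 := by
  unfold coef; split_ifs <;> rfl

/-- The `k`-th coordinate as a linear map. -/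
def coefL (F : Type*) [Field F] (a k : ℕ) : Irr F a →ₗ[F] F where
  toFun c := coef c k
  map_add' c d := coef_add c d k
  map_smul' t c := coef_smul t c k

@[simp] theorem coefL_apply (c : Irr F a) (k : ℕ) : coefL F a k c = coef c k := rfl

theorem coef_sum {ι : Type*} (s : Finset ι) (c : ι → Irr F a) (k : ℕ) :
    coef (∑ i ∈ s, c i) k = ∑ i ∈ s, coef (c i) k := map_sum (coefL F a k) c s

theorem coef_sE (c : Irr F a) (k : ℕ) :
    coef ⁅(sE : SL2 F), c⁆ k = ((a : F) - k) * coef c (k + 1) := by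
  rcases Nat.lt_or_ge a k with h | h
  · rw [coef_of_lt h, coef_of_lt (by omega), mul_zero]
  · rw [coef_lie _ _ h]; simp

theorem coef_sH (c : Irr F a) (k : ℕ) :
    coef ⁅(sH : SL2 F), c⁆ k = ((a : F) - 2 * k) * coef c k := by
  rcases Nat.lt_or_ge a k with h | h
  · rw [coef_of_lt h, coef_of_lt (by omega), mul_zero]
  · rw [coef_lie _ _ h]; simp

theorem coef_sF (c : Irr F a) {k : ℕ} (h : k ≤ a) :
    coef ⁅(sF : SL2 F), c⁆ k = k * coef c (k - 1) := by
  rw [coef_lie _ _ h]; simp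

/-- The basis vector `v_k` of `V(a)` (zero for `k > a`). -/
def bv (F : Type*) [Field F] (a k : ℕ) : Irr F a := fun j => if j.1 = k then 1 else 0

theorem coef_bv {k j : ℕ} (h : j ≤ a) : coef (bv F a k) j = if j = k then 1 else 0 := by
  rw [coef_of_le h]; rfl

theorem coef_bv_self {k : ℕ} (h : k ≤ a) : coef (bv F a k) k = 1 := by simp [coef_bv h]

theorem coef_bv_ne {k j : ℕ} (h : j ≠ k) : coef (bv F a k) j = 0 := by
  rcases Nat.lt_or_ge a j with h' | h'
  · exact coef_of_lt h'
  · simp [coef_bv h', h]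

theorem bv_of_lt {k : ℕ} (h : a < k) : bv F a k = 0 :=
  Irr.ext_coef fun j hj => by rw [coef_bv_ne (by omega), coef_zero]

theorem eq_sum_bv (c : Irr F a) : c = ∑ k ∈ Finset.range (a + 1), coef c k • bv F a k := by
  refine Irr.ext_coef fun j hj => ?_
  rw [coef_sum]
  simp only [coef_smul, coef_bv hj]
  simp [Nat.lt_succ_of_le hj]

theorem sE_bv_succ {k : ℕ} (h : k ≤ a) :
    ⁅(sE : SL2 F), bv F a (k + 1)⁆ = ((a : F) - k) • bv F a k := by
  refine Irr.ext_coef fun j hj => ?_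
  rw [coef_sE, coef_smul, coef_bv hj]
  rcases Nat.lt_or_ge j a with h' | h'
  · rw [coef_bv (by omega)]
    by_cases h2 : j = k <;> simp [h2]
  · have : j = a := by omega
    subst this
    by_cases h2 : j = k <;> simp [h2]

theorem sE_bv_zero : ⁅(sE : SL2 F), bv F a 0⁆ = 0 := by
  refine Irr.ext_coef fun j hj => ?_
  rw [coef_sE, coef_bv_ne (by omega), mul_zero, coef_zero]

theorem sH_bv (k : ℕ) : ⁅(sH : SL2 F), bv F a k⁆ = ((a : F) - 2 * k) • bv F a k := by
  refine Irr.ext_coef fun j hj => ?_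
  rw [coef_sH, coef_smul, coef_bv hj]
  by_cases h2 : j = k <;> simp [h2]

theorem sF_bv (k : ℕ) : ⁅(sF : SL2 F), bv F a k⁆ = ((k : F) + 1) • bv F a (k + 1) := by
  refine Irr.ext_coef fun j hj => ?_
  rw [coef_sF _ hj, coef_smul, coef_bv hj]
  rcases Nat.eq_zero_or_pos j with h0 | h0
  · subst h0; simp
  · rw [coef_bv (by omega)]
    by_cases h2 : j = k + 1
    · subst h2; simp
    · rw [if_neg (by omega), if_neg h2]; simp

theorem sF_bv_last : ⁅(sF : SL2 F), bv F a a⁆ = 0 := by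
  rw [sF_bv, bv_of_lt (by omega), smul_zero]

theorem bv_ne_zero {k : ℕ} (h : k ≤ a) : bv F a k ≠ 0 := fun h0 => by
  have := coef_bv_self (F := F) h
  rw [h0, coef_zero] at this
  exact zero_ne_one this

theorem iterate_sE_eq_zero (c : Irr F a) {N : ℕ} (h : ∀ k, N ≤ k → coef c k = 0) :
    (fun d : Irr F a => ⁅(sE : SL2 F), d⁆)^[N] c = 0 := by
  induction N generalizing c with
  | zero => exact Irr.ext_coef fun j _ => by simpa using h j (Nat.zero_le _)
  | succ N ih =>
    rw [Function.iterate_succ_apply]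
    exact ih _ fun k hk => by rw [coef_sE, h _ (by omega), mul_zero]

/-- If some iterate of `T` kills `x ≠ 0`, then some `T^k x ≠ 0` is killed by `T`. -/
theorem exists_iterate_killed {M : Type*} [Zero M] (T : M → M) {x : M} (hx : x ≠ 0)
    {N : ℕ} (hN : T^[N] x = 0) : ∃ k, T^[k] x ≠ 0 ∧ T (T^[k] x) = 0 := by
  obtain ⟨n, h1, h2⟩ := Nat.exists_not_and_succ_of_not_zero_of_exists
    (p := fun k => T^[k] x = 0) (by simpa using hx) ⟨N, hN⟩
  exact ⟨n, h1, by rw [← Function.iterate_succ_apply' T]; exact h2⟩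

variable [CharZero F]

theorem natCast_sub_ne_zero {k : ℕ} (h : k < a) : (a : F) - k ≠ 0 := by
  rw [sub_ne_zero]; exact_mod_cast h.ne'

/-- A vector of `V(a)` killed by `e` is a multiple of the highest weight vector. -/
theorem eq_smul_bv_zero {c : Irr F a} (h : ⁅(sE : SL2 F), c⁆ = 0) : c = coef c 0 • bv F a 0 := by
  refine Irr.ext_coef fun j hj => ?_
  rw [coef_smul, coef_bv hj]
  rcases Nat.eq_zero_or_pos j with h0 | h0
  · subst h0; simp
  · obtain ⟨k, rfl⟩ : ∃ k, j = k + 1 := ⟨j - 1, by omega⟩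
    have := coef_sE c k
    rw [h, coef_zero, eq_comm, mul_eq_zero] at this
    rw [this.resolve_left (natCast_sub_ne_zero (by omega))]; simp

/-- A nonzero subspace of `V(a)` stable under `e` and `f` is everything. -/
theorem irr_stable_eq_top {P : Submodule F (Irr F a)} (hP : P ≠ ⊥)
    (hE : ∀ c ∈ P, ⁅(sE : SL2 F), c⁆ ∈ P) (hF : ∀ c ∈ P, ⁅(sF : SL2 F), c⁆ ∈ P) : P = ⊤ := by
  obtain ⟨c, hc, hc0⟩ := (Submodule.ne_bot_iff P).1 hP
  -- The last non-zero vector in the orbit under e is a multiple of v_0, from which f recovers the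
  -- whole basis.
  obtain ⟨k, h1, h2⟩ := exists_iterate_killed (fun d : Irr F a => ⁅(sE : SL2 F), d⁆) hc0
    (iterate_sE_eq_zero c (N := a + 1) fun k hk => coef_of_lt (by omega))
  have h3 : (fun d : Irr F a => ⁅(sE : SL2 F), d⁆)^[k] c ∈ P := by
    clear h1 h2
    induction k with
    | zero => exact hc
    | succ k ih => rw [Function.iterate_succ_apply']; exact hE _ ih
  set d := (fun d : Irr F a => ⁅(sE : SL2 F), d⁆)^[k] c
  have h4 := eq_smul_bv_zero h2
  have h5 : coef d 0 ≠ 0 := fun h => h1 (by rw [h4, h, zero_smul])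
  have h6 : bv F a 0 ∈ P := by
    rw [h4] at h3
    exact (P.smul_mem_iff h5).1 h3
  have h7 : ∀ k, bv F a k ∈ P := by
    intro k
    induction k with
    | zero => exact h6
    | succ k ih =>
      have := hF _ ih
      rw [sF_bv] at this
      exact (P.smul_mem_iff (by exact_mod_cast Nat.succ_ne_zero k)).1 this
  rw [eq_top_iff]
  intro x _
  rw [eq_sum_bv x]
  exact P.sum_mem fun i _ => P.smul_mem _ (h7 i)

/-- A linear map out of `V(a)` is injective if it is `e`-equivariant and nonzero on the highest
weight vector. -/
theorem injective_of_sE {M : Type*} [AddCommGroup M] [Module F M] (φ : Irr F a →ₗ[F] M)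
    (T : M →ₗ[F] M) (h : ∀ c, φ ⁅(sE : SL2 F), c⁆ = T (φ c)) (h0 : φ (bv F a 0) ≠ 0) :
    Function.Injective φ := by
  rw [injective_iff_map_eq_zero]
  intro c hc
  by_contra hc0
  obtain ⟨k, h1, h2⟩ := exists_iterate_killed (fun d : Irr F a => ⁅(sE : SL2 F), d⁆) hc0
    (iterate_sE_eq_zero c (N := a + 1) fun k hk => coef_of_lt (by omega))
  have h3 : φ ((fun d : Irr F a => ⁅(sE : SL2 F), d⁆)^[k] c) = 0 := by
    clear h1 h2
    induction k with
    | zero => exact hc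
    | succ k ih => rw [Function.iterate_succ_apply', h, ih, map_zero]
  set d := (fun d : Irr F a => ⁅(sE : SL2 F), d⁆)^[k] c
  have h4 := eq_smul_bv_zero h2
  have h5 : coef d 0 ≠ 0 := fun h => h1 (by rw [h4, h, zero_smul])
  rw [h4, map_smul, smul_eq_zero] at h3
  exact h3.elim h5 h0

/-! ### Equivariant families `V(m) → Hom(V(c), V(a))` -/

variable {m c : ℕ}

/-- The shape of an equivariant family: the lowest weight vector of `V(m)` acts by a multiple of
`v_r ↦ (r + κ choose κ) v_{r + κ}`, where `a + m = c + 2 κ`. -/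
theorem family_shape (U : Irr F m →ₗ[F] Irr F c →ₗ[F] Irr F a)
    (hU : ∀ (A : SL2 F) x w, ⁅A, U x w⁆ = U ⁅A, x⁆ w + U x ⁅A, w⁆) (h0 : U ≠ 0) :
    ∃ (κ : ℕ) (t : F), t ≠ 0 ∧ κ ≤ a ∧ κ ≤ m ∧ a + m = c + 2 * κ ∧ ∀ w, ∀ s ≤ a,
      coef (U (bv F m m) w) s = t * (s.choose κ : F) * coef w (s - κ) := by
  set M : ℕ → ℕ → F := fun r s => coef (U (bv F m m) (bv F c r)) s with hM
  -- Equivariance under h: an entry is non-zero only where the weights match.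
  have hwt : ∀ r s, M r s ≠ 0 → a + m + 2 * r = c + 2 * s := by
    intro r s h
    have := congrArg (fun d => coef d s) (hU sH (bv F m m) (bv F c r))
    simp only [coef_add, sH_bv, map_smul, LinearMap.smul_apply, coef_smul, coef_sH] at this
    have h' : (((a : F) - 2 * s) - ((m : F) - 2 * m + ((c : F) - 2 * r))) * M r s = 0 := by
      simp only [hM]; linear_combination this
    have h'' := (mul_eq_zero.1 h').resolve_right h
    have : ((a + m + 2 * r : ℕ) : F) = ((c + 2 * s : ℕ) : F) := by
      push_cast; linear_combination h''
    exact_mod_cast this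
  have hst : ∀ r s, s ≤ a → (s : F) * M r (s - 1) = ((r : F) + 1) * M (r + 1) s := by
    intro r s hs
    have := congrArg (fun d => coef d s) (hU sF (bv F m m) (bv F c r))
    simpa only [coef_add, sF_bv_last, map_zero, LinearMap.zero_apply, coef_zero, zero_add, sF_bv,
      map_smul, coef_smul, coef_sF _ hs] using this
  have hr1 : ∀ r : ℕ, (r : F) + 1 ≠ 0 := fun r => by exact_mod_cast Nat.succ_ne_zero r
  have hclosed : ∀ r s, s ≤ a → M r s = (s.choose r : F) * M 0 (s - r) := by
    intro r
    induction r with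
    | zero => intro s _; simp
    | succ r ih =>
      intro s hs
      have h1 := hst r s hs
      rcases Nat.eq_zero_or_pos s with h | h
      · subst h
        rw [Nat.cast_zero, zero_mul, eq_comm, mul_eq_zero] at h1
        rw [h1.resolve_left (hr1 r)]; simp
      · obtain ⟨u, rfl⟩ : ∃ u, s = u + 1 := ⟨s - 1, by omega⟩
        rw [Nat.add_sub_cancel, ih _ (by omega)] at h1
        rw [Nat.add_sub_add_right]
        have h2 := congrArg (Nat.cast : ℕ → F) (Nat.add_one_mul_choose_eq u r)
        push_cast at h1 h2
        apply mul_left_cancel₀ (hr1 r)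
        linear_combination -h1 + M 0 (u - r) * h2
  -- If the image of v_0 vanished, v_m would act by zero, and applying e repeatedly would spread
  -- this to every v_k.
  have hex : ∃ κ, κ ≤ a ∧ M 0 κ ≠ 0 := by
    by_contra hne
    push Not at hne
    have hm : U (bv F m m) = 0 := by
      refine LinearMap.ext fun w => ?_
      rw [eq_sum_bv w, map_sum, LinearMap.zero_apply]
      refine Finset.sum_eq_zero fun r _ => ?_
      rw [map_smul]
      have : U (bv F m m) (bv F c r) = 0 := Irr.ext_coef fun s hs => by
        have := hclosed r s hs
        rw [hne _ (by omega), mul_zero] at this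
        rw [coef_zero]; exact this
      rw [this, smul_zero]
    have hall : ∀ j ≤ m, U (bv F m (m - j)) = 0 := by
      intro j
      induction j with
      | zero => intro _; simpa using hm
      | succ j ih =>
        intro hj
        have ih := ih (by omega)
        obtain ⟨k, hk⟩ : ∃ k, m - j = k + 1 := ⟨m - j - 1, by omega⟩
        have hk' : m - (j + 1) = k := by omega
        rw [hk] at ih
        rw [hk']
        refine LinearMap.ext fun w => ?_
        have := hU sE (bv F m (k + 1)) w
        rw [ih, sE_bv_succ (by omega)] at this
        simp only [LinearMap.zero_apply, lie_zero, add_zero, map_smul, LinearMap.smul_apply] at this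
        exact (smul_eq_zero.1 this.symm).resolve_left (natCast_sub_ne_zero (by omega))
    refine h0 (LinearMap.ext fun x => ?_)
    rw [eq_sum_bv x, map_sum, LinearMap.zero_apply]
    refine Finset.sum_eq_zero fun r hr => ?_
    have hr := Finset.mem_range.1 hr
    have := hall (m - r) (by omega)
    rw [show m - (m - r) = r by omega] at this
    rw [map_smul, this, smul_zero]
  obtain ⟨κ, hκa, hκ⟩ := hex
  have hw := hwt 0 κ hκ
  have huniq : ∀ s, s ≠ κ → M 0 s = 0 := by
    intro s hs
    by_contra h
    have := hwt 0 s h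
    omega
  refine ⟨κ, M 0 κ, hκ, hκa, ?_, by omega, ?_⟩
  -- If κ exceeded m, then κ + c + 1 ≤ a, and the recursion would give v_{c+1} = 0 a non-zero image.
  · by_contra hlt
    have hs : κ + c + 1 ≤ a := by omega
    have h1 := hst c (κ + c + 1) hs
    have h2 : M (c + 1) (κ + c + 1) = 0 := by
      simp only [hM, bv_of_lt (Nat.lt_succ_self c), map_zero, coef_zero]
    rw [h2, mul_zero, Nat.add_sub_cancel, hclosed c _ (by omega), Nat.add_sub_cancel] at h1
    have h3 : ((κ + c).choose c : F) ≠ 0 := by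
      exact_mod_cast (Nat.choose_pos (Nat.le_add_left c κ)).ne'
    have h4 : ((κ + c + 1 : ℕ) : F) ≠ 0 := by exact_mod_cast Nat.succ_ne_zero (κ + c)
    exact mul_ne_zero h4 (mul_ne_zero h3 hκ) h1
  · intro w s hs
    have h1 : coef (U (bv F m m) w) s = ∑ r ∈ Finset.range (c + 1), coef w r * M r s := by
      conv_lhs => rw [eq_sum_bv w, map_sum, coef_sum]
      simp only [map_smul, coef_smul, hM]
    rw [h1]
    rcases Nat.lt_or_ge s κ with h | h
    · rw [Nat.choose_eq_zero_of_lt h, Nat.cast_zero, mul_zero, zero_mul]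
      refine Finset.sum_eq_zero fun r _ => ?_
      rw [hclosed _ _ hs, huniq _ (by omega), mul_zero, mul_zero]
    · rw [Finset.sum_eq_single (s - κ)]
      · rw [hclosed _ _ hs, show s - (s - κ) = κ by omega, Nat.choose_symm h]
        ring
      · intro r _ hr
        rw [hclosed _ _ hs]
        rcases Nat.lt_or_ge s r with h' | h'
        · rw [Nat.choose_eq_zero_of_lt h']; simp
        · rw [huniq _ (by omega)]; simp
      · intro hr
        rw [Finset.mem_range, not_lt] at hr
        rw [coef_of_lt (by omega), zero_mul]

end basic

/-! ### Modules over `sl(2) ⋉ h_n`: invariants of `h_n` and highest weight vectors. -/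

section galModules

set_option linter.unusedSectionVars false

variable {F : Type*} [Field F] {n : ℕ}

/-! ### Generators of `sl(2) ⋉ h_n` -/

/-- The element `x ∈ V(m)` of `h_n ≃ V(m) ⊕ V(0)`. -/
def heisV (n : ℕ) (x : Irr F (2 * n - 1)) : Heis F n := (x, 0)

/-- The central element `z` of `h_n`. -/
def heisZ (F : Type*) [Field F] (n : ℕ) : Heis F n := (0, 1)

/-- The element `x ∈ V(m)` of `sl(2) ⋉ h_n`. -/
abbrev galV (n : ℕ) (x : Irr F (2 * n - 1)) : Gal F n := ofHeis F n (heisV n x)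

theorem heis_eq (x : Heis F n) : x = heisV n x.1 + x.2 • heisZ F n :=
  Prod.ext (by change x.1 = x.1 + x.2 • 0; rw [smul_zero, add_zero])
    (by change x.2 = 0 + x.2 * 1; rw [zero_add, mul_one])

theorem lie_heisV (x y : Irr F (2 * n - 1)) :
    ⁅heisV n x, heisV n y⁆ = omega x y • heisZ F n :=
  Prod.ext (by change 0 = omega x y • (0 : Irr F _); rw [smul_zero])
    (by change omega x y = omega x y * 1; rw [mul_one])

theorem galV_add (x y : Irr F (2 * n - 1)) : galV n (x + y) = galV n x + galV n y := by
  rw [galV, galV, galV, ← map_add]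
  exact congrArg _ (Prod.ext rfl (add_zero (0 : F)).symm)

theorem galV_smul (t : F) (x : Irr F (2 * n - 1)) : galV n (t • x) = t • galV n x := by
  rw [galV, galV, ← map_smul]
  exact congrArg _ (Prod.ext rfl (mul_zero t).symm)

theorem lie_ofSL2_galV (A : SL2 F) (x : Irr F (2 * n - 1)) :
    ⁅ofSL2 F n A, galV n x⁆ = galV n ⁅A, x⁆ := by
  apply LieAlgebra.SemiDirectSum.ext
  · change ⁅(0 : Heis F n), heisV n x⁆ + heisAction F n A (heisV n x)
      - heisAction F n 0 (0 : Heis F n) = heisV n ⁅A, x⁆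
    rw [zero_lie, zero_add, map_zero]
    rw [sub_zero]
    rfl
  · change ⁅A, (0 : SL2 F)⁆ = 0
    rw [lie_zero]

theorem gal_eq (X : Gal F n) : X = ofHeis F n X.left + ofSL2 F n X.right := by
  apply LieAlgebra.SemiDirectSum.ext
  · change X.left = X.left + 0; rw [add_zero]
  · change X.right = 0 + X.right; rw [zero_add]

theorem lie_ofHeis_eq (x : Heis F n) (X : Gal F n) :
    ⁅ofHeis F n x, X⁆ = ofHeis F n (⁅ofHeis F n x, X⁆ : Gal F n).left := by
  apply LieAlgebra.SemiDirectSum.ext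
  · rfl
  · change ⁅(0 : SL2 F), X.right⁆ = 0
    rw [zero_lie]

theorem isSl2Triple (F : Type*) [Field F] (n : ℕ) :
    IsSl2Triple (ofSL2 F n sH) (ofSL2 F n sE) (ofSL2 F n sF) where
  h_ne_zero h := by
    have h1 : (ofSL2 F n sH).right = (0 : Gal F n).right := congrArg _ h
    have h2 : (sH : SL2 F).1 0 0 = (0 : SL2 F).1 0 0 := congrArg (fun A : SL2 F => A.1 0 0) h1
    exact one_ne_zero h2
  lie_e_f := by rw [← LieHom.map_lie, lie_sE_sF]
  lie_h_e_nsmul := by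
    rw [← LieHom.map_lie, lie_sH_sE, map_smul, ofNat_smul_eq_nsmul]
  lie_h_f_nsmul := by
    rw [← LieHom.map_lie, lie_sH_sF, map_smul, neg_smul, ofNat_smul_eq_nsmul]

theorem contract_bv {m a b : ℕ} {s : ℕ} (hs : s ≤ m) (c : Irr F b) {k : ℕ} (hk : k ≤ a) :
    coef (contract (bv F m s) c : Irr F a) k =
      (-1) ^ s * (m.choose s : F) * coef c (k + (m - s)) := by
  rw [coef_contract _ _ hk, Finset.sum_eq_single s]
  · rw [coef_bv_self hs, mul_one]
  · intro t _ ht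
    rw [coef_bv_ne ht, mul_zero, zero_mul]
  · intro h; exact absurd (Finset.mem_range.2 (by omega)) h

/-- Oddness of m makes the two contractions opposite, so their difference doubles instead of
cancelling. -/
theorem omega_bv {m s t : ℕ} (hm : Odd m) (hst : s + t = m) :
    omega (bv F m s) (bv F m t) = 2 * ((-1) ^ s * (m.choose s : F)) := by
  have h1 : m.choose t = m.choose s := by rw [← hst, Nat.choose_symm_add]
  have h2 : (-1 : F) ^ t = - (-1) ^ s := by
    have h3 : (-1 : F) ^ s * (-1) ^ t = -1 := by rw [← pow_add, hst]; exact hm.neg_one_pow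
    have h4 : (-1 : F) ^ s * (-1) ^ s = 1 := by rw [← pow_add]; exact (Even.add_self s).neg_one_pow
    linear_combination (-1) ^ s * h3 - (-1) ^ t * h4
  unfold omega
  rw [contract_bv (by omega) _ le_rfl, contract_bv (by omega) _ le_rfl,
    show 0 + (m - s) = t by omega, show 0 + (m - t) = s by omega, coef_bv_self (by omega),
    coef_bv_self (by omega), h1, h2]
  ring

/-! ### Modules over `sl(2) ⋉ h_n` -/

variable {M : Type*} [AddCommGroup M] [Module F M] [LieRingModule (Gal F n) M]
  [LieModule F (Gal F n) M]

theorem lie_galV_sum (x : Irr F (2 * n - 1)) (u : M) :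
    ⁅galV n x, u⁆ = ∑ k ∈ Finset.range (2 * n - 1 + 1), coef x k • ⁅galV n (bv F _ k), u⁆ := by
  let T : Irr F (2 * n - 1) →ₗ[F] M :=
    { toFun := fun x => ⁅galV n x, u⁆
      map_add' := fun x y => by rw [galV_add, add_lie]
      map_smul' := fun t x => by rw [galV_smul, smul_lie]; rfl }
  change T x = ∑ k ∈ Finset.range (2 * n - 1 + 1), coef x k • T (bv F _ k)
  conv_lhs => rw [eq_sum_bv x, map_sum]
  simp only [map_smul]

theorem lie_ofSL2_eq (A : SL2 F) (u : M) : ⁅ofSL2 F n A, u⁆ = A.1 0 0 • ⁅ofSL2 F n sH, u⁆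
    + A.1 0 1 • ⁅ofSL2 F n sE, u⁆ + A.1 1 0 • ⁅ofSL2 F n sF, u⁆ := by
  conv_lhs => rw [sl2_eq A]
  simp only [map_add, map_smul, add_lie, smul_lie]

/-- As h = [e, f], stability under e and f is enough. -/
theorem lie_ofSL2_mem {S : Submodule F M} (hE : ∀ u ∈ S, ⁅ofSL2 F n sE, u⁆ ∈ S)
    (hF : ∀ u ∈ S, ⁅ofSL2 F n sF, u⁆ ∈ S) (A : SL2 F) {u : M} (hu : u ∈ S) :
    ⁅ofSL2 F n A, u⁆ ∈ S := by
  have hH : ⁅ofSL2 F n sH, u⁆ ∈ S := by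
    rw [← (isSl2Triple F n).lie_e_f, lie_lie]
    exact S.sub_mem (hE _ (hF _ hu)) (hF _ (hE _ hu))
  rw [lie_ofSL2_eq]
  exact S.add_mem (S.add_mem (S.smul_mem _ hH) (S.smul_mem _ (hE _ hu))) (S.smul_mem _ (hF _ hu))

/-- The invariants of `h_n` form a submodule. -/
def heisInvariantsLie (F : Type*) [Field F] (n : ℕ) (M : Type*) [AddCommGroup M] [Module F M]
    [LieRingModule (Gal F n) M] [LieModule F (Gal F n) M] : LieSubmodule F (Gal F n) M :=
  { heisInvariants (F := F) n M with
    lie_mem := fun {X u} hu x => by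
      change ∀ y : Heis F n, ⁅ofHeis F n y, u⁆ = 0 at hu
      -- `h_n` is an ideal, so the remaining commutator again lies in `h_n`.
      rw [leibniz_lie, hu x, lie_zero, add_zero, lie_ofHeis_eq]
      exact hu _ }

theorem lie_galV_eq_zero {u : M} (hu : u ∈ heisInvariants (F := F) n M) (x : Irr F (2 * n - 1)) :
    ⁅galV n x, u⁆ = 0 := hu _

theorem heisInvariants_lie {u : M} (hu : u ∈ heisInvariants (F := F) n M) (X : Gal F n) :
    ⁅X, u⁆ ∈ heisInvariants (F := F) n M := (heisInvariantsLie F n M).lie_mem hu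

theorem map_lie_of_basis {a : ℕ} (φ : Irr F a →ₗ[F] M)
    (hE : ∀ k ≤ a, φ ⁅(sE : SL2 F), bv F a k⁆ = ⁅ofSL2 F n sE, φ (bv F a k)⁆)
    (hF : ∀ k ≤ a, φ ⁅(sF : SL2 F), bv F a k⁆ = ⁅ofSL2 F n sF, φ (bv F a k)⁆)
    (A : SL2 F) (c : Irr F a) : φ ⁅A, c⁆ = ⁅ofSL2 F n A, φ c⁆ := by
  have key : ∀ B : SL2 F, (∀ k ≤ a, φ ⁅B, bv F a k⁆ = ⁅ofSL2 F n B, φ (bv F a k)⁆) →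
      ∀ c, φ ⁅B, c⁆ = ⁅ofSL2 F n B, φ c⁆ := by
    intro B hB c
    rw [eq_sum_bv c, map_sum, lie_sum, lie_sum, map_sum]
    refine Finset.sum_congr rfl fun k hk => ?_
    rw [lie_smul, map_smul, map_smul, lie_smul, hB k (by have := Finset.mem_range.1 hk; omega)]
  have hE' := key sE hE
  have hF' := key sF hF
  have hH' : ∀ c, φ ⁅(sH : SL2 F), c⁆ = ⁅ofSL2 F n sH, φ c⁆ := by
    intro c
    rw [← lie_sE_sF, lie_lie, map_sub, hE', hF', hF', hE', LieHom.map_lie, lie_lie]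
  conv_lhs => rw [sl2_eq A]
  rw [lie_ofSL2_eq, add_lie, add_lie, smul_lie, smul_lie, smul_lie, map_add, map_add, map_smul,
    map_smul, map_smul, hE', hF', hH']

variable [CharZero F]

/-- The commutator [v_0, v_m] equals 2z, so the condition on products of two elements of V(m) takes
care of the center. -/
theorem mem_heisInvariants_of_galV (hn : 1 ≤ n) {u : M}
    (h : ∀ x y : Irr F (2 * n - 1), ⁅galV n x, ⁅galV n y, u⁆⁆ = 0)
    (h' : ∀ x : Irr F (2 * n - 1), ⁅galV n x, u⁆ = 0) :
    u ∈ heisInvariants (F := F) n M := by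
  intro x
  have hz : ⁅ofHeis F n (heisZ F n), u⁆ = 0 := by
    have h1 := congrArg (ofHeis F n) (lie_heisV (bv F (2 * n - 1) 0) (bv F (2 * n - 1) (2 * n - 1)))
    rw [LieHom.map_lie, omega_bv ⟨n - 1, by omega⟩ (by omega), map_smul] at h1
    have h2 := congrArg (fun X : Gal F n => ⁅X, u⁆) h1
    simp only [lie_lie, smul_lie] at h2
    rw [h, h, sub_zero, eq_comm, smul_eq_zero] at h2
    exact h2.resolve_left (by simp)
  rw [heis_eq x, map_add, map_smul, add_lie, smul_lie, hz, smul_zero, add_zero]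
  exact h' _

/-- A subset stable under `e` and killed by the lowest weight vector of `V(m)` is killed by
`h_n`. -/
theorem mem_heisInvariants_of_low (hn : 1 ≤ n) (W : Set M)
    (hE : ∀ u ∈ W, ⁅ofSL2 F n sE, u⁆ ∈ W)
    (hv : ∀ u ∈ W, ⁅galV n (bv F (2 * n - 1) (2 * n - 1)), u⁆ = 0) {u : M} (hu : u ∈ W) :
    u ∈ heisInvariants (F := F) n M := by
  have h1 : ∀ j ≤ 2 * n - 1, ∀ u ∈ W, ⁅galV n (bv F (2 * n - 1) (2 * n - 1 - j)), u⁆ = 0 := by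
    intro j
    induction j with
    | zero => intro _ u hu; exact hv u hu
    | succ j ih =>
      intro hj u hu
      have ih := ih (by omega)
      obtain ⟨k, hk⟩ : ∃ k, 2 * n - 1 - j = k + 1 := ⟨2 * n - 1 - j - 1, by omega⟩
      rw [hk] at ih
      rw [show 2 * n - 1 - (j + 1) = k by omega]
      -- In [e, v_{k+1}] = (m - k) v_k both terms of the commutator vanish on `W`, because `W` is
      -- stable under e; the factor m - k is non-zero.
      have h := congrArg (fun X : Gal F n => ⁅X, u⁆) (lie_ofSL2_galV sE (bv F (2 * n - 1) (k + 1)))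
      simp only [lie_lie] at h
      rw [ih _ hu, ih _ (hE _ hu), lie_zero, sub_zero, sE_bv_succ (by omega), galV_smul,
        smul_lie, eq_comm, smul_eq_zero] at h
      exact h.resolve_left (natCast_sub_ne_zero (by omega))
  have h2 : ∀ u ∈ W, ∀ x : Irr F (2 * n - 1), ⁅galV n x, u⁆ = 0 := by
    intro u hu x
    rw [lie_galV_sum]
    refine Finset.sum_eq_zero fun k hk => ?_
    have hk := Finset.mem_range.1 hk
    have := h1 (2 * n - 1 - k) (by omega) u hu
    rw [show 2 * n - 1 - (2 * n - 1 - k) = k by omega] at this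
    rw [this, smul_zero]
  exact mem_heisInvariants_of_galV hn (fun x y => by rw [h2 u hu y, lie_zero]) (h2 u hu)

/-! ### Irreducible submodules killed by `h_n` -/

theorem range_lie {a : ℕ} (φ : Irr F a →ₗ[F] M)
    (hφ : ∀ (A : SL2 F) c, φ ⁅A, c⁆ = ⁅ofSL2 F n A, φ c⁆)
    (h0 : ∀ c, φ c ∈ heisInvariants (F := F) n M) (X : Gal F n) {u : M} (hu : u ∈ LinearMap.range φ) :
    ⁅X, u⁆ ∈ LinearMap.range φ := by
  obtain ⟨c, rfl⟩ := hu
  rw [gal_eq X, add_lie, h0 c X.left, zero_add, ← hφ]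
  exact ⟨_, rfl⟩

/-- The image of `V(a)` in the `h_n`-invariants, as a submodule. -/
def rangeLie {a : ℕ} (φ : Irr F a →ₗ[F] M) (hφ : ∀ (A : SL2 F) c, φ ⁅A, c⁆ = ⁅ofSL2 F n A, φ c⁆)
    (h0 : ∀ c, φ c ∈ heisInvariants (F := F) n M) : LieSubmodule F (Gal F n) M :=
  { LinearMap.range φ with lie_mem := fun {X _} hu => range_lie φ hφ h0 X hu }

/-- Pulling a submodule back to V(a) reduces the claim to `irr_stable_eq_top`. -/
theorem isIrreducible_rangeLie {a : ℕ} (φ : Irr F a →ₗ[F] M)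
    (hφ : ∀ (A : SL2 F) c, φ ⁅A, c⁆ = ⁅ofSL2 F n A, φ c⁆)
    (h0 : ∀ c, φ c ∈ heisInvariants (F := F) n M) (hinj : Function.Injective φ) :
    LieModule.IsIrreducible F (Gal F n) (rangeLie φ hφ h0) := by
  have hnt : Nontrivial (rangeLie φ hφ h0) := by
    refine ⟨⟨⟨φ (bv F a 0), ⟨_, rfl⟩⟩, 0, fun h => ?_⟩⟩
    have h1 : φ (bv F a 0) = 0 := congrArg Subtype.val h
    exact bv_ne_zero (Nat.zero_le a) (hinj (h1.trans (map_zero φ).symm))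
  refine LieModule.IsIrreducible.mk fun N hN => ?_
  let ψ : Irr F a →ₗ[F] rangeLie φ hφ h0 := φ.codRestrict (LinearMap.range φ) fun c => ⟨c, rfl⟩
  have hψ : ∀ (A : SL2 F) c, ψ ⁅A, c⁆ = ⁅ofSL2 F n A, ψ c⁆ := fun A c => Subtype.ext (hφ A c)
  have hsurj : ∀ y, ∃ c, ψ c = y := by
    rintro ⟨_, c, rfl⟩; exact ⟨c, rfl⟩
  have hP : N.toSubmodule.comap ψ ≠ ⊥ := by
    obtain ⟨y, hy, hy0⟩ := (Submodule.ne_bot_iff _).1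
      (fun h => hN ((LieSubmodule.toSubmodule_eq_bot N).1 h))
    obtain ⟨c, rfl⟩ := hsurj y
    rw [Submodule.ne_bot_iff]
    exact ⟨c, hy, fun h => hy0 (by rw [h, map_zero])⟩
  have htop := irr_stable_eq_top hP
    (fun c hc => by
      change ψ _ ∈ N; rw [hψ]; exact N.lie_mem hc)
    (fun c hc => by
      change ψ _ ∈ N; rw [hψ]; exact N.lie_mem hc)
  refine top_le_iff.1 fun y _ => ?_
  obtain ⟨c, rfl⟩ := hsurj y
  have : c ∈ N.toSubmodule.comap ψ := by rw [htop]; trivial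
  exact this

/-- This is how subspaces are placed in the socle: where `h_n` acts by zero, irreducibility over
`sl(2)` is irreducibility over the whole algebra. -/
theorem range_le_socle {a : ℕ} (φ : Irr F a →ₗ[F] M)
    (hφ : ∀ (A : SL2 F) c, φ ⁅A, c⁆ = ⁅ofSL2 F n A, φ c⁆)
    (h0 : ∀ c, φ c ∈ heisInvariants (F := F) n M) (hinj : Function.Injective φ) :
    LinearMap.range φ ≤ (socle F (Gal F n) M).toSubmodule := by
  have : rangeLie φ hφ h0 ≤ socle F (Gal F n) M := le_sSup (isIrreducible_rangeLie φ hφ h0 hinj)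
  exact this

/-! ### Highest weight vectors -/

/-- The vectors `f^k p / k!`. -/
noncomputable def fdiv (F : Type*) [Field F] (n : ℕ) {M : Type*} [AddCommGroup M] [Module F M]
    [LieRingModule (Gal F n) M] [LieModule F (Gal F n) M] (p : M) (k : ℕ) : M :=
  ((k.factorial : F)⁻¹) • ((LieModule.toEnd F (Gal F n) M (ofSL2 F n sF)) ^ k) p

theorem lie_sF_fdiv (p : M) (k : ℕ) :
    ⁅ofSL2 F n sF, fdiv F n p k⁆ = ((k : F) + 1) • fdiv F n p (k + 1) := by
  unfold fdiv
  rw [lie_smul, pow_succ', Module.End.mul_apply, LieModule.toEnd_apply_apply, smul_smul,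
    Nat.factorial_succ]
  congr 1
  have h1 : ((k : F) + 1) ≠ 0 := by exact_mod_cast Nat.succ_ne_zero k
  have h2 : (k.factorial : F) ≠ 0 := by exact_mod_cast k.factorial_ne_zero
  push_cast
  field_simp

variable {p : M} {μ : ℕ}

theorem lie_sE_fdiv (hp : (isSl2Triple F n).HasPrimitiveVectorWith p (μ : F)) (k : ℕ) :
    ⁅ofSL2 F n sE, fdiv F n p (k + 1)⁆ = ((μ : F) - k) • fdiv F n p k := by
  unfold fdiv
  rw [lie_smul, hp.lie_e_pow_succ_toEnd_f, smul_smul, smul_smul, Nat.factorial_succ]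
  congr 1
  have h1 : ((k : F) + 1) ≠ 0 := by exact_mod_cast Nat.succ_ne_zero k
  have h2 : (k.factorial : F) ≠ 0 := by exact_mod_cast k.factorial_ne_zero
  push_cast
  field_simp

/-- The map `V(μ) → M` which sends the highest weight vector to the vector `p`. -/
noncomputable def stringMap (F : Type*) [Field F] (n : ℕ) {M : Type*} [AddCommGroup M] [Module F M]
    [LieRingModule (Gal F n) M] [LieModule F (Gal F n) M] (p : M) (μ : ℕ) : Irr F μ →ₗ[F] M where
  toFun c := ∑ k ∈ Finset.range (μ + 1), coef c k • fdiv F n p k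
  map_add' c d := by simp only [coef_add, add_smul, Finset.sum_add_distrib]
  map_smul' t c := by simp only [coef_smul, mul_smul, Finset.smul_sum, RingHom.id_apply]

theorem stringMap_bv {k : ℕ} (hk : k ≤ μ) : stringMap F n p μ (bv F μ k) = fdiv F n p k := by
  change ∑ j ∈ Finset.range (μ + 1), coef (bv F μ k) j • fdiv F n p j = _
  rw [Finset.sum_eq_single k]
  · rw [coef_bv_self hk, one_smul]
  · intro j _ hj; rw [coef_bv_ne hj, zero_smul]
  · intro h; exact absurd (Finset.mem_range.2 (by omega)) h

theorem stringMap_bv_zero : stringMap F n p μ (bv F μ 0) = p := by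
  rw [stringMap_bv (Nat.zero_le _)]
  simp [fdiv]

theorem stringMap_mem {S : Submodule F M} (hS : ∀ u ∈ S, ⁅ofSL2 F n sF, u⁆ ∈ S) (hp : p ∈ S)
    (c : Irr F μ) : stringMap F n p μ c ∈ S := by
  change ∑ k ∈ Finset.range (μ + 1), coef c k • fdiv F n p k ∈ S
  refine S.sum_mem fun k hk => S.smul_mem _ (S.smul_mem _ ?_)
  clear hk
  induction k with
  | zero => exact hp
  | succ k ih => rw [pow_succ']; exact hS _ ih

variable [FiniteDimensional F M]

theorem fdiv_succ_eq_zero (hp : (isSl2Triple F n).HasPrimitiveVectorWith p (μ : F)) :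
    fdiv F n p (μ + 1) = 0 := by
  unfold fdiv
  rw [hp.pow_toEnd_f_eq_zero_of_eq_nat rfl, smul_zero]

theorem stringMap_lie (hp : (isSl2Triple F n).HasPrimitiveVectorWith p (μ : F)) (A : SL2 F)
    (c : Irr F μ) : stringMap F n p μ ⁅A, c⁆ = ⁅ofSL2 F n A, stringMap F n p μ c⁆ := by
  refine map_lie_of_basis _ (fun k hk => ?_) (fun k hk => ?_) A c
  · rw [stringMap_bv hk]
    rcases Nat.eq_zero_or_pos k with h | h
    · subst h
      rw [sE_bv_zero, map_zero]
      simp only [fdiv, Nat.factorial_zero, Nat.cast_one, inv_one, pow_zero, one_smul,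
        Module.End.one_apply]
      exact hp.lie_e.symm
    · obtain ⟨j, rfl⟩ : ∃ j, k = j + 1 := ⟨k - 1, by omega⟩
      rw [sE_bv_succ (by omega), map_smul, stringMap_bv (by omega), lie_sE_fdiv hp]
  · rw [stringMap_bv hk, lie_sF_fdiv, sF_bv, map_smul]
    rcases Nat.lt_or_ge k μ with h | h
    · rw [stringMap_bv (by omega)]
    · have : k = μ := by omega
      subst this
      rw [bv_of_lt (by omega), map_zero, fdiv_succ_eq_zero hp]

theorem stringMap_injective (hp : (isSl2Triple F n).HasPrimitiveVectorWith p (μ : F)) :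
    Function.Injective (stringMap F n p μ) :=
  injective_of_sE _ (LieModule.toEnd F (Gal F n) M (ofSL2 F n sE)) (stringMap_lie hp sE)
    (by rw [stringMap_bv_zero]; exact hp.ne_zero)

/-- An `sl(2)`-submodule (killed by `h_n`) on which `e` acts nilpotently with one-dimensional
kernel, spanned by a vector of weight `μ`, is isomorphic to `V(μ)`. -/
theorem sl2Iso_of_primitive (hp : (isSl2Triple F n).HasPrimitiveVectorWith p (μ : F))
    {S : Submodule F M} (hS : ∀ (X : Gal F n), ∀ u ∈ S, ⁅X, u⁆ ∈ S) (hS0 : S ≤ heisInvariants (F := F) n M)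
    (hnil : ∀ u ∈ S, ∃ N, (fun v : M => ⁅ofSL2 F n sE, v⁆)^[N] u = 0)
    (hpS : p ∈ S) (hker : ∀ u ∈ S, ⁅ofSL2 F n sE, u⁆ = 0 → ∃ t : F, u = t • p) :
    Sl2Iso n S (Irr F μ) := by
  have hmem : ∀ c, stringMap F n p μ c ∈ S := stringMap_mem (hS _) hpS
  refine ⟨stringMap F n p μ, stringMap_injective hp, le_antisymm ?_ ?_, stringMap_lie hp⟩
  · rintro _ ⟨c, rfl⟩; exact hmem c
  intro q hq
  by_contra hqR
  set φ := stringMap F n p μ with hφ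
  set R := rangeLie φ (stringMap_lie hp) fun c => hS0 (hmem c) with hR
  have hmemR : ∀ c, φ c ∈ R := fun c => ⟨c, rfl⟩
  -- a vector outside the range which `e` maps into the range
  obtain ⟨q₁, hq₁S, hq₁R, hEq₁⟩ : ∃ q₁ ∈ S, q₁ ∉ R ∧ ⁅ofSL2 F n sE, q₁⁆ ∈ R := by
    obtain ⟨N, hN⟩ := hnil q hq
    obtain ⟨k, h1, h2⟩ := Nat.exists_not_and_succ_of_not_zero_of_exists
      (p := fun k => (fun v : M => ⁅ofSL2 F n sE, v⁆)^[k] q ∈ R) hqR ⟨N, by rw [hN]; exact R.zero_mem⟩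
    refine ⟨_, ?_, h1, by simpa only [Function.iterate_succ_apply'] using h2⟩
    clear h1 h2
    induction k with
    | zero => exact hq
    | succ k ih => rw [Function.iterate_succ_apply']; exact hS _ _ ih
  -- improve it so that `e` maps it to a multiple of the lowest weight vector
  obtain ⟨q₂, hq₂S, hq₂R, t, hEq₂⟩ : ∃ q₂ ∈ S, q₂ ∉ R ∧ ∃ t : F,
      ⁅ofSL2 F n sE, q₂⁆ = t • φ (bv F μ μ) := by
    obtain ⟨d, hd⟩ := hEq₁
    -- Solves e d' = d in all coordinates but the last, since the image of e on V(μ) is spanned by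
    -- v_0, …, v_{μ-1}.
    set d' : Irr F μ := ∑ k ∈ Finset.range μ, (coef d k * ((μ : F) - k)⁻¹) • bv F μ (k + 1)
    have hd' : d = ⁅(sE : SL2 F), d'⁆ + coef d μ • bv F μ μ := by
      conv_lhs => rw [eq_sum_bv d, Finset.sum_range_succ]
      rw [lie_sum]
      congr 1
      refine Finset.sum_congr rfl fun k hk => ?_
      have hk := Finset.mem_range.1 hk
      rw [lie_smul, sE_bv_succ hk.le, smul_smul, mul_assoc,
        inv_mul_cancel₀ (natCast_sub_ne_zero hk), mul_one]
    refine ⟨q₁ - φ d', S.sub_mem hq₁S (hmem _), fun h => hq₁R ?_, coef d μ, ?_⟩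
    · simpa using R.add_mem h (hmemR d')
    · have hd2 : φ d = ⁅ofSL2 F n sE, q₁⁆ := hd
      rw [lie_sub, ← hd2, ← stringMap_lie hp, ← hφ, ← map_sub, ← map_smul]
      congr 1
      rw [sub_eq_iff_eq_add, add_comm]
      exact hd'
  -- make it a weight vector
  have hlow : ⁅ofSL2 F n sH, φ (bv F μ μ)⁆ = -(μ : F) • φ (bv F μ μ) := by
    rw [hφ, ← stringMap_lie hp, sH_bv, map_smul]
    congr 1
    ring
  have hHE : ∀ u : M, ⁅ofSL2 F n sE, ⁅ofSL2 F n sH, u⁆⁆ =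
      ⁅ofSL2 F n sH, ⁅ofSL2 F n sE, u⁆⁆ - (2 : F) • ⁅ofSL2 F n sE, u⁆ := by
    intro u
    have := leibniz_lie (ofSL2 F n sH) (ofSL2 F n sE) u
    rw [(isSl2Triple F n).lie_h_e_smul (R := F), smul_lie] at this
    rw [this]; abel
  -- e kills (h + μ + 2) q₂, so this is a multiple of p. As h + μ + 2 acts on p by 2μ + 2 ≠ 0,
  -- subtracting c / (2μ + 2) times p from q₂ produces an eigenvector of h.
  obtain ⟨c, hc⟩ := hker (⁅ofSL2 F n sH, q₂⁆ + ((μ : F) + 2) • q₂)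
    (S.add_mem (hS _ _ hq₂S) (S.smul_mem _ hq₂S)) (by
      rw [lie_add, lie_smul, hHE, hEq₂, lie_smul, hlow]
      module)
  have hμ : (2 * (μ : F) + 2) ≠ 0 := by exact_mod_cast Nat.succ_ne_zero (2 * μ + 1)
  set q₃ := q₂ - (c / (2 * (μ : F) + 2)) • p with hq₃
  have hH₃ : ⁅ofSL2 F n sH, q₃⁆ = (-((μ : F) + 2)) • q₃ := by
    have hd : c = c / (2 * (μ : F) + 2) * (2 * (μ : F) + 2) := (div_mul_cancel₀ c hμ).symm
    rw [hq₃, lie_sub, lie_smul, hp.lie_h, eq_sub_of_add_eq hc]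
    generalize c / (2 * (μ : F) + 2) = d at hd
    rw [hd]
    module
  have hpR : p ∈ R := ⟨bv F μ 0, stringMap_bv_zero⟩
  have hq₃R : q₃ ∉ R := fun h => hq₂R (by
    have := R.add_mem h (R.smul_mem (c / (2 * (μ : F) + 2)) hpR)
    simpa [hq₃] using this)
  have hE₃ : ⁅ofSL2 F n sE, q₃⁆ ∈ R := by
    rw [hq₃, lie_sub, lie_smul, hp.lie_e, smul_zero, sub_zero, hEq₂]
    exact R.smul_mem _ (hmemR _)
  have hfin : IsNoetherian F (M ⧸ R) :=
    inferInstanceAs (IsNoetherian F (M ⧸ R.toSubmodule))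
  -- Modulo `R`, q₃ is a highest weight vector of negative weight -(μ + 2), impossible in finite
  -- dimension.
  have hprim : (isSl2Triple F n).HasPrimitiveVectorWith
      (LieSubmodule.Quotient.mk' R q₃) (-((μ : F) + 2)) :=
    { ne_zero := fun h => hq₃R ((LieSubmodule.Quotient.mk_eq_zero _).1 h)
      lie_h := by rw [← LieModuleHom.map_lie, hH₃, map_smul]
      lie_e := by
        rw [← LieModuleHom.map_lie]; exact (LieSubmodule.Quotient.mk_eq_zero _).2 hE₃ }
  obtain ⟨N, hN⟩ := hprim.exists_nat
  have : ((N + μ + 2 : ℕ) : F) = 0 := by push_cast; rw [← hN]; ring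
  exact absurd (Nat.cast_eq_zero.1 this) (by omega)

end galModules

/-! ### Socle decompositions: projections, matrix entries of the action, coordinates. -/

section decomposition

set_option linter.unusedSectionVars false

variable {F : Type*} [Field F] {n : ℕ}

theorem isIrreducible_of_bijective {L M M' : Type*} [LieRing L] [LieAlgebra F L] [AddCommGroup M]
    [Module F M] [LieRingModule L M] [LieModule F L M] [AddCommGroup M'] [Module F M']
    [LieRingModule L M'] [LieModule F L M'] (f : M →ₗ⁅F,L⁆ M') (hf : Function.Bijective f)
    (h : LieModule.IsIrreducible F L M) : LieModule.IsIrreducible F L M' := by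
  have hM : Nontrivial M := LieModule.nontrivial_of_isIrreducible F L M
  have hM' : Nontrivial M' := hf.1.nontrivial
  refine LieModule.IsIrreducible.mk fun N hN => ?_
  have h1 : N.comap f ≠ ⊥ := by
    obtain ⟨y, hy, hy0⟩ := (Submodule.ne_bot_iff _).1
      (fun h => hN ((LieSubmodule.toSubmodule_eq_bot N).1 h))
    obtain ⟨x, rfl⟩ := hf.2 y
    intro h0
    have : x ∈ N.comap f := hy
    rw [h0, LieSubmodule.mem_bot] at this
    exact hy0 (by rw [this, map_zero])
  have h2 := (h.eq_bot_or_eq_top (N.comap f)).resolve_left h1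
  refine top_le_iff.1 fun y _ => ?_
  obtain ⟨x, rfl⟩ := hf.2 y
  have : x ∈ N.comap f := by rw [h2]; trivial
  exact this

/-- The first term of the series is formed in the quotient by the zero submodule; the quotient map
is injective and carries irreducible submodules to irreducible ones. -/
theorem socle_le_socSeries_one (L M : Type*) [LieRing L] [LieAlgebra F L] [AddCommGroup M]
    [Module F M] [LieRingModule L M] [LieModule F L M] : socle F L M ≤ socSeries F L M 1 := by
  refine sSup_le fun N hN => ?_
  set q := LieSubmodule.Quotient.mk' (socSeries F L M 0) with hq
  have hinj : Function.Injective q := by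
    intro x y hxy
    rw [← sub_eq_zero, ← map_sub] at hxy
    have := (LieSubmodule.Quotient.mk_eq_zero _).1 hxy
    exact sub_eq_zero.1 ((LieSubmodule.mem_bot _).1 this)
  have h1 : N.map q ≤ socle F L (M ⧸ socSeries F L M 0) := by
    refine le_sSup ?_
    let g : N →ₗ⁅F,L⁆ N.map q :=
      { toFun := fun x => ⟨q x, LieSubmodule.mem_map_of_mem x.2⟩
        map_add' := fun x y => Subtype.ext (map_add q _ _)
        map_smul' := fun t x => Subtype.ext (map_smul q _ _)
        map_lie' := fun {X x} => Subtype.ext (LieModuleHom.map_lie q _ _) }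
    refine isIrreducible_of_bijective g ⟨fun x y h => ?_, ?_⟩ hN
    · exact Subtype.ext (hinj (congrArg Subtype.val h))
    · rintro ⟨y, hy⟩
      obtain ⟨x, hx, rfl⟩ := (LieSubmodule.mem_map _).1 hy
      exact ⟨⟨x, hx⟩, rfl⟩
  exact LieSubmodule.map_le_iff_le_comap.1 h1

/-- The basis `v_0, …, v_a` of `V(a)`. -/
noncomputable def irrBasis (F : Type*) [Field F] (a : ℕ) : Module.Basis (Fin (a + 1)) F (Irr F a) :=
  Pi.basisFun F (Fin (a + 1))

theorem irrBasis_apply {a : ℕ} (s : Fin (a + 1)) : irrBasis F a s = bv F a s.1 := by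
  funext j
  change (Pi.basisFun F (Fin (a + 1)) s) j = if j.1 = s.1 then 1 else 0
  rw [Pi.basisFun_apply, Pi.single_apply]
  simp [Fin.ext_iff]

variable {V : Type*} [AddCommGroup V] [Module F V] [LieRingModule (Gal F n) V]
  [LieModule F (Gal F n) V] {k : ℕ} {a : Fin k → ℕ}

namespace SocleDecomposition

variable (D : SocleDecomposition F n V a)

/-- The inclusion of the `i`-th summand. -/
noncomputable def emb (i : Fin k) : Irr F (a i) →ₗ[F] V := (D.part_iso i).choose

theorem emb_injective (i : Fin k) : Function.Injective (D.emb i) := (D.part_iso i).choose_spec.1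

theorem range_emb (i : Fin k) : LinearMap.range (D.emb i) = D.part i :=
  (D.part_iso i).choose_spec.2.1

theorem emb_lie (i : Fin k) (A : SL2 F) (w : Irr F (a i)) :
    D.emb i ⁅A, w⁆ = ⁅ofSL2 F n A, D.emb i w⁆ := (D.part_iso i).choose_spec.2.2 A w

theorem emb_mem (i : Fin k) (w : Irr F (a i)) : D.emb i w ∈ D.part i := by
  rw [← D.range_emb]; exact ⟨w, rfl⟩

/-- The basis of weight vectors attached to a socle decomposition. -/
noncomputable def basis : Module.Basis (Σ i : Fin k, Fin (a i + 1)) F V :=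
  D.isInternal.collectedBasis fun i => (irrBasis F (a i)).map
    ((LinearEquiv.ofInjective (D.emb i) (D.emb_injective i)).trans
      (LinearEquiv.ofEq _ _ (D.range_emb i)))

theorem basis_apply (p : Σ i : Fin k, Fin (a i + 1)) :
    D.basis p = D.emb p.1 (bv F (a p.1) p.2.1) := by
  rw [basis, DirectSum.IsInternal.collectedBasis_coe]
  simp only [Module.Basis.map_apply, irrBasis_apply]
  rfl

/-- The projection onto the `i`-th summand. -/
noncomputable def pr (i : Fin k) : V →ₗ[F] Irr F (a i) where
  toFun v := fun s => D.basis.repr v ⟨i, s⟩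
  map_add' v w := funext fun s => by rw [map_add]; rfl
  map_smul' t v := funext fun s => by rw [map_smul]; rfl

theorem coef_pr (i : Fin k) (v : V) {s : ℕ} (hs : s ≤ a i) :
    coef (D.pr i v) s = D.basis.repr v ⟨i, ⟨s, Nat.lt_succ_of_le hs⟩⟩ := coef_of_le hs

theorem emb_bv (i : Fin k) {s : ℕ} (hs : s ≤ a i) :
    D.emb i (bv F (a i) s) = D.basis ⟨i, ⟨s, Nat.lt_succ_of_le hs⟩⟩ :=
  (D.basis_apply ⟨i, ⟨s, Nat.lt_succ_of_le hs⟩⟩).symm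

theorem pr_emb (i : Fin k) (w : Irr F (a i)) : D.pr i (D.emb i w) = w := by
  have : (D.pr i).comp (D.emb i) = LinearMap.id := (irrBasis F (a i)).ext fun s => by
    have hs : s.1 ≤ a i := by omega
    rw [LinearMap.comp_apply, irrBasis_apply, D.emb_bv i hs, LinearMap.id_apply]
    refine Irr.ext_coef fun r hr => ?_
    rw [D.coef_pr i _ hr, Module.Basis.repr_self, coef_bv hr, Finsupp.single_apply]
    simp only [Sigma.mk.injEq, heq_eq_eq, true_and, Fin.mk.injEq]
    simp only [eq_comm]
  exact LinearMap.congr_fun this w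

theorem pr_emb_ne {i j : Fin k} (hij : i ≠ j) (w : Irr F (a j)) : D.pr i (D.emb j w) = 0 := by
  have : (D.pr i).comp (D.emb j) = 0 := (irrBasis F (a j)).ext fun s => by
    have hs : s.1 ≤ a j := by omega
    rw [LinearMap.comp_apply, irrBasis_apply, D.emb_bv j hs, LinearMap.zero_apply]
    refine Irr.ext_coef fun r hr => ?_
    rw [D.coef_pr i _ hr, Module.Basis.repr_self, coef_zero, Finsupp.single_apply, if_neg]
    intro h
    exact hij (congrArg Sigma.fst h).symm
  exact LinearMap.congr_fun this w

theorem sum_emb_pr (v : V) : ∑ i, D.emb i (D.pr i v) = v := by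
  have : ∑ i, (D.emb i).comp (D.pr i) = LinearMap.id := D.basis.ext fun p => by
    rw [LinearMap.sum_apply, Finset.sum_eq_single p.1, D.basis_apply, LinearMap.comp_apply, pr_emb]
    · rfl
    · intro j _ hj
      rw [D.basis_apply, LinearMap.comp_apply, pr_emb_ne _ hj, map_zero]
    · intro h; exact absurd (Finset.mem_univ _) h
  have h := LinearMap.congr_fun this v
  rwa [LinearMap.sum_apply] at h

theorem ext_pr {v w : V} (h : ∀ i, D.pr i v = D.pr i w) : v = w := by
  rw [← D.sum_emb_pr v, ← D.sum_emb_pr w]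
  simp only [h]

theorem pr_lie (i : Fin k) (A : SL2 F) (v : V) : D.pr i ⁅ofSL2 F n A, v⁆ = ⁅A, D.pr i v⁆ := by
  conv_lhs => rw [← D.sum_emb_pr v, lie_sum, map_sum]
  rw [Finset.sum_eq_single i]
  · rw [← emb_lie, pr_emb]
  · intro j _ hj
    rw [← emb_lie, pr_emb_ne _ hj.symm]
  · intro h; exact absurd (Finset.mem_univ _) h

theorem pr_eq_zero_of_mem {i j : Fin k} (hij : i ≠ j) {v : V} (hv : v ∈ D.part j) :
    D.pr i v = 0 := by
  rw [← D.range_emb] at hv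
  obtain ⟨w, rfl⟩ := hv
  exact D.pr_emb_ne hij w

theorem mem_iSup_part (P : Fin k → Prop) (v : V) :
    v ∈ (⨆ j : Fin k, ⨆ _ : P j, D.part j) ↔ ∀ j, ¬ P j → D.pr j v = 0 := by
  constructor
  · intro hv j hj
    have : (⨆ j : Fin k, ⨆ _ : P j, D.part j) ≤ LinearMap.ker (D.pr j) := by
      refine iSup_le fun i => iSup_le fun hi x hx => ?_
      exact D.pr_eq_zero_of_mem (by rintro rfl; exact hj hi) hx
    exact this hv
  · intro h
    rw [← D.sum_emb_pr v]
    refine Submodule.sum_mem _ fun j _ => ?_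
    by_cases hj : P j
    · exact Submodule.mem_iSup_of_mem j (Submodule.mem_iSup_of_mem hj (D.emb_mem _ _))
    · rw [h j hj, map_zero]; exact Submodule.zero_mem _

theorem mem_part (i : Fin k) (v : V) : v ∈ D.part i ↔ ∀ j, j ≠ i → D.pr j v = 0 := by
  rw [← D.mem_iSup_part (fun j => j = i), iSup_iSup_eq_left]

/-- Reads the socle series in coordinates, so that stability of its terms becomes triangularity of
the action. -/
theorem mem_socSeries {i : ℕ} (hi : i ≤ k) (v : V) :
    v ∈ socSeries F (Gal F n) V i ↔ ∀ j : Fin k, i ≤ j.1 → D.pr j v = 0 := by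
  rcases i with _ | i
  · constructor
    · intro h j _
      rw [(LieSubmodule.mem_bot v).1 h, map_zero]
    · intro h
      refine (LieSubmodule.mem_bot v).2 (D.ext_pr fun j => ?_)
      rw [h j (Nat.zero_le _), map_zero]
  · have h1 := D.socSeries_eq ⟨i, hi⟩
    rw [← LieSubmodule.mem_toSubmodule, h1, D.mem_iSup_part]
    refine forall_congr' fun j => ?_
    rw [not_le, Fin.lt_def, Nat.succ_le_iff]

/-! ### The matrix entries of the action of `V(m)` -/

/-- The component `V(m) ⊗ V(a_j) → V(a_i)` of the action of `h_n`. -/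
noncomputable def fam (i j : Fin k) :
    Irr F (2 * n - 1) →ₗ[F] Irr F (a j) →ₗ[F] Irr F (a i) :=
  LinearMap.mk₂ F (fun x w => D.pr i ⁅galV n x, D.emb j w⁆)
    (fun x y w => by rw [galV_add, add_lie, map_add])
    (fun t x w => by rw [galV_smul, smul_lie, map_smul])
    (fun x w w' => by rw [map_add, lie_add, map_add])
    (fun t x w => by rw [map_smul, lie_smul, map_smul])

theorem fam_apply (i j : Fin k) (x : Irr F (2 * n - 1)) (w : Irr F (a j)) :
    D.fam i j x w = D.pr i ⁅galV n x, D.emb j w⁆ := rfl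

theorem fam_lie (i j : Fin k) (A : SL2 F) (x : Irr F (2 * n - 1)) (w : Irr F (a j)) :
    ⁅A, D.fam i j x w⁆ = D.fam i j ⁅A, x⁆ w + D.fam i j x ⁅A, w⁆ := by
  rw [fam_apply, fam_apply, fam_apply, ← pr_lie, leibniz_lie, lie_ofSL2_galV, map_add, emb_lie]

theorem pr_lie_galV (x : Irr F (2 * n - 1)) (i : Fin k) (v : V) :
    D.pr i ⁅galV n x, v⁆ = ∑ j, D.fam i j x (D.pr j v) := by
  conv_lhs => rw [← D.sum_emb_pr v, lie_sum, map_sum]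
  rfl

variable [CharZero F]

/-- m = 2n - 1 is odd, whereas a non-zero entry requires a_i + m ≡ a_j modulo 2 by `family_shape`.
-/
theorem fam_eq_zero_of_parity (hn : 1 ≤ n) {i j : Fin k} (h : a i = a j) : D.fam i j = 0 := by
  by_contra h0
  obtain ⟨κ, -, -, -, -, h1, -⟩ := family_shape (D.fam i j) (D.fam_lie i j) h0
  omega

/-- Terms of the socle series are submodules, so the action never leads to a later summand; diagonal
entries vanish by parity. -/
theorem fam_eq_zero_of_le (hn : 1 ≤ n) {i j : Fin k} (hij : j ≤ i) : D.fam i j = 0 := by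
  rcases eq_or_lt_of_le hij with h | h
  · subst h; exact D.fam_eq_zero_of_parity hn rfl
  · refine LinearMap.ext fun x => LinearMap.ext fun w => ?_
    have h1 : D.emb j w ∈ socSeries F (Gal F n) V (j.1 + 1) := by
      rw [D.mem_socSeries j.2]
      intro i' hi'
      exact D.pr_emb_ne (fun h => by rw [h] at hi'; omega) w
    have h2 : ⁅galV n x, D.emb j w⁆ ∈ socSeries F (Gal F n) V (j.1 + 1) :=
      LieSubmodule.lie_mem _ h1
    rw [D.mem_socSeries j.2] at h2
    exact h2 i h

/-- Successive factors of the socle series are linked by the action of `h_n`. -/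
theorem fam_succ_ne_zero (hn : 1 ≤ n) {i : ℕ} (hi : i + 1 < k) :
    D.fam ⟨i, by omega⟩ ⟨i + 1, hi⟩ ≠ 0 := by
  -- Otherwise V(a_{i+1}) gives a copy in the quotient by soc^i killed by `h_n`, hence inside its
  -- socle. It would then lie in soc^{i+1}, which is the sum of the summands with index at most i.
  intro h0
  set j : Fin k := ⟨i + 1, hi⟩
  set S := socSeries F (Gal F n) V i with hS
  set q := LieSubmodule.Quotient.mk' S with hq
  have hmem : ∀ (x : Irr F (2 * n - 1)) w, ⁅galV n x, D.emb j w⁆ ∈ S := by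
    intro x w
    rw [hS, D.mem_socSeries (by omega)]
    intro i' hi'
    rw [← fam_apply]
    rcases Nat.lt_or_ge i i'.1 with h | h
    · rw [D.fam_eq_zero_of_le hn (show j ≤ i' from h)]; rfl
    · have : i' = ⟨i, by omega⟩ := Fin.ext (le_antisymm h hi')
      rw [this, h0]; rfl
  let φ : Irr F (a j) →ₗ[F] V ⧸ S := (q : V →ₗ[F] V ⧸ S).comp (D.emb j)
  have hφ : ∀ w, φ w = q (D.emb j w) := fun _ => rfl
  have hlie : ∀ (A : SL2 F) w, φ ⁅A, w⁆ = ⁅ofSL2 F n A, φ w⁆ := by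
    intro A w
    rw [hφ, hφ, D.emb_lie, LieModuleHom.map_lie]
  have hkill : ∀ (x : Irr F (2 * n - 1)) w, ⁅galV n x, φ w⁆ = 0 := by
    intro x w
    rw [hφ, ← LieModuleHom.map_lie]
    exact (LieSubmodule.Quotient.mk_eq_zero _).2 (hmem x w)
  have hinv : ∀ w, φ w ∈ heisInvariants (F := F) n (V ⧸ S) := fun w =>
    mem_heisInvariants_of_galV hn (fun x y => by rw [hkill y w, lie_zero]) (fun x => hkill x w)
  have hnot : ∀ {l : ℕ}, l ≤ i + 1 → D.emb j (bv F (a j) 0) ∉ socSeries F (Gal F n) V l := by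
    intro l hl h
    rw [D.mem_socSeries (by omega)] at h
    have := h j hl
    rw [D.pr_emb] at this
    exact bv_ne_zero (Nat.zero_le _) this
  have hinj : Function.Injective φ :=
    injective_of_sE φ (LieModule.toEnd F (Gal F n) (V ⧸ S) (ofSL2 F n sE)) (hlie sE) fun h =>
      hnot (Nat.le_succ i) ((LieSubmodule.Quotient.mk_eq_zero _).1 h)
  have h1 := range_le_socle φ hlie hinv hinj
  have h2 : D.emb j (bv F (a j) 0) ∈ socSeries F (Gal F n) V (i + 1) := h1 ⟨bv F (a j) 0, rfl⟩
  exact hnot le_rfl h2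

theorem socle_eq (hn : 1 ≤ n) (hk : 0 < k) :
    (socle F (Gal F n) V).toSubmodule = D.part ⟨0, hk⟩ := by
  apply le_antisymm
  · intro v hv
    have h1 : v ∈ socSeries F (Gal F n) V 1 := socle_le_socSeries_one _ _ hv
    rw [D.mem_socSeries hk] at h1
    rw [D.mem_part]
    intro j hj
    refine h1 j (Nat.one_le_iff_ne_zero.2 fun h => hj (Fin.ext h))
  · rw [← D.range_emb]
    have h0 : ∀ (x : Irr F (2 * n - 1)) w, ⁅galV n x, D.emb ⟨0, hk⟩ w⁆ = 0 := by
      intro x w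
      refine D.ext_pr fun i => ?_
      rw [← fam_apply, D.fam_eq_zero_of_le hn (Fin.mk_le_of_le_val (Nat.zero_le _)), map_zero]
      rfl
    exact range_le_socle _ (D.emb_lie _) (fun w => mem_heisInvariants_of_galV hn
      (fun x y => by rw [h0, lie_zero]) (fun x => h0 x w)) (D.emb_injective _)

end SocleDecomposition

/-! ### Coordinates -/

/-- Extension of a finite sequence by zero. -/
def extSeq (a : Fin k → ℕ) (i : ℕ) : ℕ := if h : i < k then a ⟨i, h⟩ else 0

theorem extSeq_of_lt (a : Fin k → ℕ) {i : ℕ} (h : i < k) : extSeq a i = a ⟨i, h⟩ := dif_pos h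

theorem extSeq_coe (a : Fin k → ℕ) (i : Fin k) : extSeq a i.1 = a i := dif_pos i.2

namespace SocleDecomposition

variable (D : SocleDecomposition F n V a)

/-- The coordinate with respect to the `s`-th basis vector of the `i`-th summand, extended by
zero. -/
noncomputable def cf (i s : ℕ) : V →ₗ[F] F :=
  if h : i < k then (coefL F (a ⟨i, h⟩) s).comp (D.pr ⟨i, h⟩) else 0

theorem cf_of_lt {i : ℕ} (h : i < k) (s : ℕ) (v : V) : D.cf i s v = coef (D.pr ⟨i, h⟩ v) s := by
  unfold cf; rw [dif_pos h]; rfl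

theorem cf_of_ge {i : ℕ} (h : k ≤ i) (s : ℕ) : D.cf i s = 0 := dif_neg (by omega)

theorem cf_of_extSeq_lt {i s : ℕ} (h : extSeq a i < s) : D.cf i s = 0 := by
  rcases Nat.lt_or_ge i k with hi | hi
  · refine LinearMap.ext fun v => ?_
    rw [extSeq_of_lt a hi] at h
    rw [D.cf_of_lt hi, coef_of_lt h]; rfl
  · exact D.cf_of_ge hi s

theorem cf_sE (i s : ℕ) (v : V) :
    D.cf i s ⁅ofSL2 F n sE, v⁆ = ((extSeq a i : F) - s) * D.cf i (s + 1) v := by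
  rcases Nat.lt_or_ge i k with hi | hi
  · rw [D.cf_of_lt hi, D.cf_of_lt hi, extSeq_of_lt a hi, pr_lie, coef_sE]
  · simp [D.cf_of_ge hi]

theorem cf_sH (i s : ℕ) (v : V) :
    D.cf i s ⁅ofSL2 F n sH, v⁆ = ((extSeq a i : F) - 2 * s) * D.cf i s v := by
  rcases Nat.lt_or_ge i k with hi | hi
  · rw [D.cf_of_lt hi, D.cf_of_lt hi, extSeq_of_lt a hi, pr_lie, coef_sH]
  · simp [D.cf_of_ge hi]

theorem cf_basis (i : Fin k) (s : Fin (a i + 1)) (v : V) :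
    D.cf i.1 s.1 v = D.basis.repr v ⟨i, s⟩ := by
  rw [D.cf_of_lt i.2, D.coef_pr i v (by omega)]

/-- The module is a chain: `h_n` maps each summand into the previous one. -/
def IsChain : Prop := ∀ i j : Fin k, j.1 ≠ i.1 + 1 → D.fam i j = 0

/-- The data of a chain: `t i` and `κ i` describe the map from the `(i+1)`-st summand to the
`i`-th one by which the lowest weight vector of `V(m)` acts. -/
structure ChainData (t : ℕ → F) (κ : ℕ → ℕ) : Prop where
  ne_zero : ∀ i, i + 1 < k → t i ≠ 0
  le_left : ∀ i, i + 1 < k → κ i ≤ extSeq a i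
  weight : ∀ i, i + 1 < k → extSeq a i + (2 * n - 1) = extSeq a (i + 1) + 2 * κ i
  low : ∀ i s v, s ≤ extSeq a i → D.cf i s ⁅galV n (bv F (2 * n - 1) (2 * n - 1)), v⁆ =
    t i * (s.choose (κ i) : F) * D.cf (i + 1) (s - κ i) v

variable [CharZero F]

/-- `family_shape` describes each consecutive link, and in a chain no other entry contributes. -/
theorem IsChain.exists_data (hn : 1 ≤ n) {D : SocleDecomposition F n V a} (hD : D.IsChain) :
    ∃ t κ, D.ChainData t κ := by
  have h : ∀ i : ℕ, ∃ (t : F) (κ : ℕ), (i + 1 < k → t ≠ 0 ∧ κ ≤ extSeq a i ∧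
      extSeq a i + (2 * n - 1) = extSeq a (i + 1) + 2 * κ) ∧ ∀ s v, s ≤ extSeq a i →
      D.cf i s ⁅galV n (bv F (2 * n - 1) (2 * n - 1)), v⁆ =
      t * (s.choose κ : F) * D.cf (i + 1) (s - κ) v := by
    intro i
    rcases Nat.lt_or_ge (i + 1) k with hi | hi
    · obtain ⟨κ, t, ht, h1, -, h3, h4⟩ := family_shape _ (D.fam_lie ⟨i, by omega⟩ ⟨i + 1, hi⟩)
        (D.fam_succ_ne_zero hn hi)
      refine ⟨t, κ, fun _ => ⟨ht, ?_, ?_⟩, fun s v hs => ?_⟩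
      · rw [extSeq_of_lt a (by omega)]; exact h1
      · rw [extSeq_of_lt a (by omega), extSeq_of_lt a hi]; exact h3
      · rw [extSeq_of_lt a (by omega)] at hs
        rw [D.cf_of_lt (by omega), D.cf_of_lt hi, pr_lie_galV,
          Finset.sum_eq_single (⟨i + 1, hi⟩ : Fin k)]
        · exact h4 _ s hs
        · intro j _ hj
          rw [hD _ j (fun h => hj (Fin.ext h))]; rfl
        · intro h; exact absurd (Finset.mem_univ _) h
    -- Past the last link the default t = κ = 0 keeps the formula for v_m valid at every index, both
    -- sides being zero.
    · refine ⟨0, 0, fun h => by omega, fun s v _ => ?_⟩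
      rw [D.cf_of_ge hi, LinearMap.zero_apply, mul_zero]
      rcases Nat.lt_or_ge i k with hi' | hi'
      · rw [D.cf_of_lt hi', pr_lie_galV, Finset.sum_eq_zero, coef_zero]
        intro j _
        rw [hD _ j (by have := j.2; change j.1 ≠ i + 1; omega)]; rfl
      · rw [D.cf_of_ge hi']; rfl
  choose t κ h1 h2 using h
  exact ⟨t, κ, fun i hi => (h1 i hi).1, fun i hi => (h1 i hi).2.1,
    fun i hi => (h1 i hi).2.2, h2⟩

end SocleDecomposition

end decomposition

/-! ### The possible weights of a standard faithful uniserial module -/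

section classification

/-- Rules out b = x + 2 when κ = 0, where b would have to equal a binomial coefficient at least this
large. -/
theorem lt_choose_three (x : ℕ) : x + 2 < (x + 4).choose 3 := by
  induction x with
  | zero => decide
  | succ x ih =>
    have h1 : (x + 1 + 4).choose 3 = (x + 4).choose 2 + (x + 4).choose 3 := rfl
    have h2 : 0 < (x + 4).choose 2 := Nat.choose_pos (by omega)
    omega

theorem two_mul_choose_two (n : ℕ) : 2 * (n + 1).choose 2 = (n + 1) * n := by
  have := Nat.add_one_mul_choose_eq n 1
  rw [Nat.choose_one_right] at this
  change _ = (n + 1).choose 2 * 2 at this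
  omega

/-- The combinatorial identities satisfied by the weights of a faithful uniserial module of
length 3 determine these weights. -/
theorem weights_of_choose {m κ q b : ℕ} (hm : Odd m) (hm3 : 3 ≤ m) (hq : q + κ = m)
    (h : ∀ s ≤ m, q.choose s * (b + s).choose s + q.choose (m - s) * (b + (m - s)).choose (m - s) =
      (1 + q.choose m * (b + m).choose m) * m.choose s) :
    (κ = 0 ∧ b ≤ 1) ∨ (κ = 1 ∧ b = 0) ∨ (κ = 2 ∧ m = 3 ∧ b = 2) := by
  -- The equations for s = 1 and s = 2 suffice.
  have h1 := h 1 (by omega)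
  have h2 := h 2 (by omega)
  obtain ⟨m', rfl⟩ : ∃ m', m = m' + 3 := ⟨m - 3, by omega⟩
  rw [Nat.choose_one_right, Nat.choose_one_right, Nat.choose_one_right,
    show m' + 3 - 1 = m' + 2 by omega] at h1
  rw [show m' + 3 - 2 = m' + 1 by omega] at h2
  -- κ = 0: dividing the equation for s = 1 by m and applying Pascal's rule leaves b = C(b + m - 1,
  -- m), whose right side is too large for b ≥ 2.
  rcases Nat.lt_or_ge κ 1 with hκ | hκ
  · left
    refine ⟨by omega, ?_⟩
    by_contra hb
    obtain ⟨x, rfl⟩ : ∃ x, b = x + 2 := ⟨b - 2, by omega⟩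
    have hq' : q = m' + 3 := by omega
    subst hq'
    rw [Nat.choose_self, one_mul, show (m' + 3).choose (m' + 2) = m' + 3 from
      Nat.choose_succ_self_right (m' + 2), mul_comm (1 + _), ← mul_add] at h1
    have h3 := Nat.eq_of_mul_eq_mul_left (by omega) h1
    have h4 : (x + 2 + (m' + 3)).choose (m' + 3) =
        (x + 2 + (m' + 2)).choose (m' + 2) + (x + 2 + (m' + 2)).choose (m' + 3) := rfl
    have h5 : (x + 2 + (m' + 2)).choose (m' + 3) = (x + 2 + (m' + 2)).choose (x + 1) :=
      Nat.choose_symm_of_eq_add (by omega)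
    have h6 : (x + 4).choose 3 = (x + 4).choose (x + 1) := Nat.choose_symm_of_eq_add (by omega)
    have h7 : (x + 4).choose (x + 1) ≤ (x + 2 + (m' + 2)).choose (x + 1) :=
      Nat.choose_le_choose _ (by omega)
    have h8 := lt_choose_three x
    omega
  right
  -- κ = 1: now C(q, m) = 0, so (m - 1)(b + 1) plus a positive binomial coefficient equals m, whence
  -- b = 0.
  rcases Nat.lt_or_ge κ 2 with hκ2 | hκ2
  · left
    refine ⟨by omega, ?_⟩
    have hq' : q = m' + 2 := by omega
    subst hq'
    rw [Nat.choose_self, Nat.choose_eq_zero_of_lt (by omega : m' + 2 < m' + 3)] at h1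
    have h3 : 0 < (b + (m' + 2)).choose (m' + 2) := Nat.choose_pos (by omega)
    by_contra hb
    have h4 : (m' + 2) * 2 ≤ (m' + 2) * (b + 1) := Nat.mul_le_mul_left _ (by omega)
    omega
  right
  rw [Nat.choose_eq_zero_of_lt (by omega : q < m' + 2),
    Nat.choose_eq_zero_of_lt (by omega : q < m' + 3)] at h1
  simp only [zero_mul, add_zero, one_mul] at h1
  -- κ ≥ 2 leaves q(b + 1) = m. For κ = 2 this reads (m - 2) b = 2, and m is odd.
  rcases Nat.lt_or_ge κ 3 with hκ3 | hκ3
  · have hq' : q = m' + 1 := by omega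
    subst hq'
    have h3 : (m' + 1) * b = 2 := by nlinarith
    have h4 : m' + 1 ∣ 2 := ⟨b, h3.symm⟩
    have h5 : m' + 1 ≤ 2 := Nat.le_of_dvd (by norm_num) h4
    rcases Nat.eq_zero_or_pos m' with h6 | h6
    · subst h6; refine ⟨by omega, rfl, by omega⟩
    · have : m' = 1 := by omega
      subst this
      exact absurd hm (by decide)
  -- κ ≥ 3: the equation for s = 2 becomes C(q, 2) C(b + 2, 2) = C(m, 2). With q = p + 1 and m = (p
  -- + 1)(b + 1) it forces b = 0, hence q = m, a contradiction.
  · exfalso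
    rw [Nat.choose_eq_zero_of_lt (by omega : q < m' + 1),
      Nat.choose_eq_zero_of_lt (by omega : q < m' + 3)] at h2
    simp only [zero_mul, add_zero, one_mul] at h2
    obtain ⟨p, rfl⟩ : ∃ p, q = p + 1 := by
      rcases q with _ | p
      · omega
      · exact ⟨p, rfl⟩
    have e1 := two_mul_choose_two p
    have e2 := two_mul_choose_two (b + 1)
    have e3 := two_mul_choose_two (m' + 2)
    have h3 : (p + 1) * p * ((b + 1 + 1) * (b + 1)) = 2 * ((m' + 2 + 1) * (m' + 2)) := by
      rw [← e1, ← e2, ← e3]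
      have : (p + 1).choose 2 * (b + 2).choose 2 = (m' + 3).choose 2 := h2
      nlinarith
    have h4 : m' + 2 + 1 = (p + 1) * (b + 1) := h1.symm
    rw [h4] at h3
    have h5 : ((p + 1) * (b + 1)) * (p * (b + 2)) = ((p + 1) * (b + 1)) * (2 * (m' + 2)) := by
      linarith
    have h6 := Nat.eq_of_mul_eq_mul_left (by positivity) h5
    have h7 : m' + 2 + 1 = p * b + p + b + 1 := by rw [h4]; ring
    have h8 : p * (b + 2) = p * b + 2 * p := by ring
    have h9 : b = 0 := by
      by_contra hb
      omega
    subst h9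
    omega

variable {F : Type*} [Field F] [CharZero F] {m a a' c κ : ℕ}

/-- The matrix coefficient between highest weight vectors of the composite of two equivariant
families. -/
theorem family_comp_coef (U : Irr F m →ₗ[F] Irr F c →ₗ[F] Irr F a)
    (hU : ∀ (A : SL2 F) x w, ⁅A, U x w⁆ = U ⁅A, x⁆ w + U x ⁅A, w⁆)
    (T : Irr F m →ₗ[F] Irr F a' →ₗ[F] Irr F c)
    (hT : ∀ (A : SL2 F) x w, ⁅A, T x w⁆ = T ⁅A, x⁆ w + T x ⁅A, w⁆)
    (ha : a' = a) (hκ : a + m = c + 2 * κ) (hκa : κ ≤ a) (hκm : κ ≤ m) {s : ℕ} (hs : s ≤ m) :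
    coef (U (bv F m s) (T (bv F m (m - s)) (bv F a' 0))) 0 =
      (-1) ^ s * ((m - κ).choose s * (a - κ + s).choose s : ℕ) *
        coef (U (bv F m 0) (T (bv F m m) (bv F a' 0))) 0 := by
  subst ha
  have hκF : (a' : F) + m = c + 2 * κ := by exact_mod_cast hκ
  have hτ0 : ∀ t r, t ≠ r + κ → coef (T (bv F m t) (bv F a' 0)) r = 0 := by
    intro t r h
    have := congrArg (fun d => coef d r) (hT sH (bv F m t) (bv F a' 0))
    simp only [coef_add, sH_bv, map_smul, LinearMap.smul_apply, coef_smul, coef_sH] at this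
    have h' : ((r : F) + κ - t) * coef (T (bv F m t) (bv F a' 0)) r = 0 := by
      push_cast at this
      linear_combination (-1 / 2 : F) * this - (1 / 2 : F) *
        coef (T (bv F m t) (bv F a' 0)) r * hκF
    refine (mul_eq_zero.1 h').resolve_left fun h0 => h ?_
    have : ((r + κ : ℕ) : F) = t := by push_cast; linear_combination h0
    exact_mod_cast this.symm
  -- Weights allow a single r for each s, so the sum over the intermediate V(c) collapses to one
  -- term.
  have hδ0 : ∀ s r, s + r + κ ≠ m → coef (U (bv F m s) (bv F c r)) 0 = 0 := by
    intro s r h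
    have := congrArg (fun d => coef d 0) (hU sH (bv F m s) (bv F c r))
    simp only [coef_add, sH_bv, map_smul, LinearMap.smul_apply, coef_smul, coef_sH] at this
    have h' : ((s : F) + r + κ - m) * coef (U (bv F m s) (bv F c r)) 0 = 0 := by
      push_cast at this
      linear_combination (1 / 2 : F) * this - (1 / 2 : F) *
        coef (U (bv F m s) (bv F c r)) 0 * hκF
    refine (mul_eq_zero.1 h').resolve_left fun h0 => h ?_
    have : ((s + r + κ : ℕ) : F) = m := by push_cast; linear_combination h0
    exact_mod_cast this
  have hg : ∀ s, coef (U (bv F m s) (T (bv F m (m - s)) (bv F a' 0))) 0 =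
      ∑ r ∈ Finset.range (c + 1), coef (T (bv F m (m - s)) (bv F a' 0)) r *
        coef (U (bv F m s) (bv F c r)) 0 := by
    intro s
    conv_lhs => rw [eq_sum_bv (T (bv F m (m - s)) (bv F a' 0)), map_sum, coef_sum]
    simp only [map_smul, coef_smul]
  have hg1 : ∀ s, m < s + κ → coef (U (bv F m s) (T (bv F m (m - s)) (bv F a' 0))) 0 = 0 := by
    intro s h
    rw [hg]
    exact Finset.sum_eq_zero fun r _ => by rw [hδ0 s r (by omega), mul_zero]
  have hg2 : ∀ s r, s + r + κ = m → coef (U (bv F m s) (T (bv F m (m - s)) (bv F a' 0))) 0 =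
      coef (T (bv F m (m - s)) (bv F a' 0)) r * coef (U (bv F m s) (bv F c r)) 0 := by
    intro s r h
    rw [hg, Finset.sum_eq_single r]
    · intro r' _ hr'
      rw [hδ0 s r' (by omega), mul_zero]
    · intro hr
      rw [Finset.mem_range] at hr
      omega
  -- Equivariance of T under e and of U under f link the values at s and s + 1. The factor m - κ - s
  -- vanishes at the boundary s + κ = m, beyond which all values are zero.
  have hrec : ∀ s, s < m →
      ((s : F) + 1) ^ 2 * coef (U (bv F m (s + 1)) (T (bv F m (m - (s + 1))) (bv F a' 0))) 0 =
      -(((m : F) - κ - s) * ((a' : F) - κ + s + 1)) *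
        coef (U (bv F m s) (T (bv F m (m - s)) (bv F a' 0))) 0 := by
    intro s hs
    rcases lt_trichotomy (s + κ) m with h | h | h
    · obtain ⟨r, hr⟩ : ∃ r, s + (r + 1) + κ = m := ⟨m - κ - s - 1, by omega⟩
      rw [hg2 s (r + 1) hr, hg2 (s + 1) r (by omega)]
      obtain ⟨t, ht⟩ : ∃ t, m - s = t + 1 := ⟨m - s - 1, by omega⟩
      rw [ht, show m - (s + 1) = t by omega]
      have e1 := congrArg (fun d => coef d r) (hT sE (bv F m (t + 1)) (bv F a' 0))
      rw [sE_bv_succ (by omega), sE_bv_zero] at e1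
      simp only [map_smul, map_zero, add_zero, LinearMap.smul_apply, coef_smul, coef_sE] at e1
      have e2 := congrArg (fun d => coef d 0) (hU sF (bv F m s) (bv F c r))
      simp only [sF_bv, map_smul, LinearMap.smul_apply, coef_smul, coef_add,
        coef_sF _ (Nat.zero_le a')] at e2
      rw [Nat.cast_zero, zero_mul] at e2
      have c1 : (s : F) + (r + 1) + κ = m := by exact_mod_cast hr
      have c2 : (s : F) + (t + 1) = m := by
        have : s + (t + 1) = m := by omega
        exact_mod_cast this
      have f1 : ((s : F) + 1) * coef (T (bv F m t) (bv F a' 0)) r =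
          ((a' : F) - κ + s + 1) * coef (T (bv F m (t + 1)) (bv F a' 0)) (r + 1) := by
        linear_combination -e1 + coef (T (bv F m t) (bv F a' 0)) r * c2 -
          coef (T (bv F m (t + 1)) (bv F a' 0)) (r + 1) * (hκF + c1)
      linear_combination -((s : F) + 1) * coef (T (bv F m t) (bv F a' 0)) r * e2 -
        ((r : F) + 1) * coef (U (bv F m s) (bv F c (r + 1))) 0 * f1 -
        ((a' : F) - κ + s + 1) * coef (T (bv F m (t + 1)) (bv F a' 0)) (r + 1) *
          coef (U (bv F m s) (bv F c (r + 1))) 0 * c1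
    · have c1 : (s : F) + κ = m := by exact_mod_cast h
      rw [hg1 (s + 1) (by omega)]
      linear_combination -(((a' : F) - κ + s + 1)) *
        coef (U (bv F m s) (T (bv F m (m - s)) (bv F a' 0))) 0 * c1
    · rw [hg1 (s + 1) (by omega), hg1 s h]; ring
  induction s with
  | zero => simp
  | succ s ih =>
    have ih := ih (by omega)
    have hr := hrec s (by omega)
    rw [ih] at hr
    have h1 : (s : F) + 1 ≠ 0 := by exact_mod_cast Nat.succ_ne_zero s
    apply mul_left_cancel₀ (pow_ne_zero 2 h1)
    rw [hr]
    have e1 : ((m - κ).choose (s + 1) : F) * (s + 1) =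
        ((m - κ).choose s : F) * ((m : F) - κ - s) := by
      rcases Nat.lt_or_ge (m - κ) s with h | h
      · rw [Nat.choose_eq_zero_of_lt h, Nat.choose_eq_zero_of_lt (by omega : m - κ < s + 1)]; simp
      · have := congrArg (Nat.cast : ℕ → F) (Nat.choose_succ_right_eq (m - κ) s)
        push_cast [Nat.cast_sub h, Nat.cast_sub hκm] at this
        exact this
    have e2 : ((a' : F) - κ + s + 1) * ((a' - κ + s).choose s : F) =
        ((a' - κ + (s + 1)).choose (s + 1) : F) * (s + 1) := by
      have := congrArg (Nat.cast : ℕ → F) (Nat.add_one_mul_choose_eq (a' - κ + s) s)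
      push_cast [Nat.cast_sub hκa] at this
      exact this
    push_cast
    rw [pow_succ]
    generalize coef (U (bv F m 0) (T (bv F m m) (bv F a' 0))) 0 = g
    linear_combination (-1) ^ s * g * ((a' - κ + (s + 1)).choose (s + 1) : F) * ((s : F) + 1) * e1 -
      (-1) ^ s * g * ((m - κ).choose s : F) * ((m : F) - κ - s) * e2

/-- At x = v_s, y = v_{m-s} the commutation relation and `family_comp_coef` make G(s) + G(m - s)
proportional to C(m, s), where G(s) = C(m - κ, s) C(a - κ + s, s). The case s = 0 fixes the constant
as 1 + G(m), and `weights_of_choose` solves the resulting system. -/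
theorem weights_of_family (hm : Odd m) (U : Irr F m →ₗ[F] Irr F c →ₗ[F] Irr F a)
    (hU : ∀ (A : SL2 F) x w, ⁅A, U x w⁆ = U ⁅A, x⁆ w + U x ⁅A, w⁆)
    (T : Irr F m →ₗ[F] Irr F a' →ₗ[F] Irr F c)
    (hT : ∀ (A : SL2 F) x w, ⁅A, T x w⁆ = T ⁅A, x⁆ w + T x ⁅A, w⁆)
    (ha : a' = a) (hκ : a + m = c + 2 * κ) (hκa : κ ≤ a) (hκm : κ ≤ m) {ζ : F} (hζ : ζ ≠ 0)
    (hcomm : ∀ x y, coef (U x (T y (bv F a' 0))) 0 - coef (U y (T x (bv F a' 0))) 0 =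
      omega x y * ζ) :
    m = 1 ∨ (κ = 0 ∧ a ≤ 1) ∨ (κ = 1 ∧ a = 1) ∨ (κ = 2 ∧ m = 3 ∧ a = 4) := by
  rcases Nat.lt_or_ge m 3 with hm3 | hm3
  · left
    obtain ⟨j, hj⟩ := hm
    omega
  right
  set g₀ := coef (U (bv F m 0) (T (bv F m m) (bv F a' 0))) 0 with hg₀
  set G : ℕ → ℕ := fun s => (m - κ).choose s * (a - κ + s).choose s with hG
  have key : ∀ s ≤ m, ((G s + G (m - s) : ℕ) : F) * g₀ = 2 * (m.choose s : F) * ζ := by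
    intro s hs
    have h1 := hcomm (bv F m s) (bv F m (m - s))
    rw [omega_bv hm (by omega)] at h1
    have h2 := family_comp_coef U hU T hT ha hκ hκa hκm hs
    have h3 := family_comp_coef U hU T hT ha hκ hκa hκm (Nat.sub_le m s)
    rw [show m - (m - s) = s by omega] at h3
    rw [h2, h3] at h1
    have h4 : (-1 : F) ^ s * (-1) ^ (m - s) = -1 := by
      rw [← pow_add, show s + (m - s) = m by omega]; exact hm.neg_one_pow
    have h5 : (-1 : F) ^ s * (-1) ^ s = 1 := by
      rw [← pow_add]; exact (Even.add_self s).neg_one_pow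
    simp only [hG]
    push_cast at h1 ⊢
    linear_combination (-1) ^ s * h1
      + (((m - κ).choose (m - s) : F) * ((a - κ + (m - s)).choose (m - s) : F)) * g₀ * h4
      + (2 * (m.choose s : F) * ζ - ((m - κ).choose s : F) * ((a - κ + s).choose s : F) * g₀) * h5
  -- Otherwise s = 0 would give 2ζ = 0.
  have hg : g₀ ≠ 0 := by
    intro h
    have := key 0 (Nat.zero_le _)
    rw [h, mul_zero, Nat.choose_zero_right, Nat.cast_one, mul_one, eq_comm, mul_eq_zero] at this
    exact this.elim (by norm_num) hζ
  have h := weights_of_choose (κ := κ) (q := m - κ) (b := a - κ) hm hm3 (by omega) (fun s hs => by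
    have h0 := key 0 (Nat.zero_le _)
    have hs' := key s hs
    have : ((G s + G (m - s) : ℕ) : F) = (((G 0 + G m) * m.choose s : ℕ) : F) := by
      apply mul_right_cancel₀ hg
      rw [hs']
      rw [Nat.sub_zero, Nat.choose_zero_right] at h0
      push_cast at h0 ⊢
      linear_combination -(m.choose s : F) * h0
    have h2 : G s + G (m - s) = (G 0 + G m) * m.choose s := by exact_mod_cast this
    simpa [hG] using h2)
  omega

end classification

/-! ### Weights and chain structure of the two tensor factors. -/

section shapes

set_option linter.unusedSectionVars false

variable {F : Type*} [Field F] [CharZero F] {n : ℕ}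
  {V : Type*} [AddCommGroup V] [Module F V] [LieRingModule (Gal F n) V] [LieModule F (Gal F n) V]

/-! ### Standard faithful uniserial modules -/

theorem lie_ofSL2_heisZ (A : SL2 F) : ⁅ofSL2 F n A, ofHeis F n (heisZ F n)⁆ = 0 := by
  apply LieAlgebra.SemiDirectSum.ext
  · change ⁅(0 : Heis F n), heisZ F n⁆ + heisAction F n A (heisZ F n)
      - heisAction F n 0 (0 : Heis F n) = 0
    rw [zero_lie, zero_add, map_zero]
    change ((⁅A, (0 : Irr F (2 * n - 1))⁆, 0) : Heis F n) - 0 = 0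
    rw [lie_zero, sub_zero]
    rfl
  · change ⁅A, (0 : SL2 F)⁆ = 0
    rw [lie_zero]

theorem omega_smul_lie_heisZ (x y : Irr F (2 * n - 1)) (v : V) :
    omega x y • ⁅ofHeis F n (heisZ F n), v⁆ =
      ⁅galV n x, ⁅galV n y, v⁆⁆ - ⁅galV n y, ⁅galV n x, v⁆⁆ := by
  rw [← lie_lie, ← LieHom.map_lie, lie_heisV, map_smul, smul_lie]

namespace SocleDecomposition

variable {a : Fin 3 → ℕ} (D : SocleDecomposition F n V a)

/-- V(m) acts by strictly triangular 3 × 3 block matrices, so a product of two operators has only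
the path 2 → 1 → 0. -/
theorem pr_zero_lie_lie (hn : 1 ≤ n) (x y : Irr F (2 * n - 1)) (v : V) :
    D.pr 0 ⁅galV n x, ⁅galV n y, v⁆⁆ = D.fam 0 1 x (D.fam 1 2 y (D.pr 2 v)) := by
  have h : ∀ i j : Fin 3, j ≤ i → ∀ z w, D.fam i j z w = 0 := fun i j hij z w => by
    rw [D.fam_eq_zero_of_le hn hij]; rfl
  rw [pr_lie_galV, Fin.sum_univ_three, pr_lie_galV, pr_lie_galV, pr_lie_galV]
  simp only [Fin.sum_univ_three]
  rw [h 0 0 le_rfl, h 1 0 (by decide), h 1 1 le_rfl, h 2 0 (by decide), h 2 1 (by decide),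
    h 2 2 le_rfl]
  simp only [zero_add, add_zero, map_zero]

theorem pr_lie_lie_of_ne (hn : 1 ≤ n) {i : Fin 3} (hi : i ≠ 0) (x y : Irr F (2 * n - 1)) (v : V) :
    D.pr i ⁅galV n x, ⁅galV n y, v⁆⁆ = 0 := by
  have h : ∀ i j : Fin 3, j ≤ i → ∀ z w, D.fam i j z w = 0 := fun i j hij z w => by
    rw [D.fam_eq_zero_of_le hn hij]; rfl
  rw [pr_lie_galV, Fin.sum_univ_three, pr_lie_galV, pr_lie_galV, pr_lie_galV]
  simp only [Fin.sum_univ_three]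
  rw [h 2 0 (by decide), h 2 1 (by decide), h 2 2 le_rfl]
  have h' : i = 1 ∨ i = 2 := by omega
  rcases h' with rfl | rfl
  · rw [h 1 0 (by decide), h 1 1 le_rfl]; simp
  · rw [h 2 0 (by decide), h 2 1 (by decide)]; simp

end SocleDecomposition

/-- Faithfulness enters through z, which acts by commutators of strictly triangular operators, hence
only as an `sl(2)`-map V(a_2) → V(a_0). This map is non-zero, so a_2 = a_0, and parity then removes
the entry of V(m) from V(a_2) to V(a_0). The relation [x, y] = ω(x, y) z feeds `weights_of_family`,
whose solution 4, 3, 4 is excluded by standardness. -/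
theorem standardFaithful_shape (hn : 1 ≤ n) (hV : IsStandardFaithful F n V) {a : Fin 3 → ℕ}
    (D : SocleDecomposition F n V a) :
    D.IsChain ∧ a 2 = a 0 ∧ (a 1 = a 0 + (2 * n - 1) ∨ (n = 1 ∧ a 0 = a 1 + 1) ∨
      (1 < n ∧ a 0 = 1 ∧ a 1 + 1 = 2 * n - 1)) := by
  obtain ⟨hf, -, hex⟩ := hV
  set z : Gal F n := ofHeis F n (heisZ F n) with hz
  have hz0 : z ≠ 0 := by
    intro h
    have h1 : z.left = (0 : Gal F n).left := congrArg _ h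
    have h2 : (heisZ F n).2 = (0 : F) := congrArg Prod.snd h1
    exact one_ne_zero h2
  let Z : Irr F (a 2) →ₗ[F] Irr F (a 0) :=
    (D.pr 0).comp ((LieModule.toEnd F (Gal F n) V z).comp (D.emb 2))
  have hZ : ∀ w, Z w = D.pr 0 ⁅z, D.emb 2 w⁆ := fun _ => rfl
  have hZlie : ∀ (A : SL2 F) w, Z ⁅A, w⁆ = ⁅A, Z w⁆ := by
    intro A w
    rw [hZ, hZ, ← D.pr_lie, leibniz_lie, lie_ofSL2_heisZ, zero_lie, zero_add, D.emb_lie]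
  -- ω(v_0, v_m) = 2.
  have hm2 : ∀ v : V, (2 : F) • ⁅z, v⁆ = ⁅galV n (bv F (2 * n - 1) 0),
      ⁅galV n (bv F (2 * n - 1) (2 * n - 1)), v⁆⁆ - ⁅galV n (bv F (2 * n - 1) (2 * n - 1)),
      ⁅galV n (bv F (2 * n - 1) 0), v⁆⁆ := by
    intro v
    rw [← omega_smul_lie_heisZ, omega_bv ⟨n - 1, by omega⟩ (by omega)]
    simp
    rfl
  have h2 : (2 : F) ≠ 0 := two_ne_zero
  -- If Z killed the highest weight vector it would be zero by irreducibility, and z would act by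
  -- zero on all of V.
  have hZ0 : Z (bv F (a 2) 0) ≠ 0 := by
    intro h0
    have htop : LinearMap.ker Z = ⊤ := irr_stable_eq_top
      ((Submodule.ne_bot_iff _).2 ⟨_, h0, bv_ne_zero (Nat.zero_le _)⟩)
      (fun c hc => by
        rw [LinearMap.mem_ker] at hc ⊢
        rw [hZlie, hc, lie_zero])
      (fun c hc => by
        rw [LinearMap.mem_ker] at hc ⊢
        rw [hZlie, hc, lie_zero])
    refine hz0 (LieModule.ext_of_isFaithful (R := F) V fun v => ?_)
    rw [zero_lie]
    apply smul_right_injective V h2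
    change (2 : F) • ⁅z, v⁆ = (2 : F) • (0 : V)
    rw [smul_zero]
    refine D.ext_pr fun i => ?_
    rw [map_zero]
    by_cases hi : i = 0
    · subst hi
      have h3 : (2 : F) • ⁅z, v⁆ = (2 : F) • ⁅z, D.emb 2 (D.pr 2 v)⁆ := by
        rw [hm2, hm2]
        refine D.ext_pr fun i => ?_
        by_cases hi : i = 0
        · subst hi
          rw [map_sub, map_sub, D.pr_zero_lie_lie hn, D.pr_zero_lie_lie hn, D.pr_zero_lie_lie hn,
            D.pr_zero_lie_lie hn, D.pr_emb]
        · rw [map_sub, map_sub, D.pr_lie_lie_of_ne hn hi, D.pr_lie_lie_of_ne hn hi,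
            D.pr_lie_lie_of_ne hn hi, D.pr_lie_lie_of_ne hn hi]
      rw [h3, map_smul, ← hZ]
      have : D.pr 2 v ∈ LinearMap.ker Z := by rw [htop]; trivial
      rw [LinearMap.mem_ker.1 this, smul_zero]
    · rw [hm2, map_sub, D.pr_lie_lie_of_ne hn hi, D.pr_lie_lie_of_ne hn hi, sub_zero]
  have hZE := hZlie sE (bv F (a 2) 0)
  rw [sE_bv_zero, map_zero] at hZE
  have hZeq := eq_smul_bv_zero hZE.symm
  have hζ : coef (Z (bv F (a 2) 0)) 0 ≠ 0 := fun h => hZ0 (by rw [hZeq, h, zero_smul])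
  have ha : a 2 = a 0 := by
    have h := congrArg (fun d => coef d 0) (hZlie sH (bv F (a 2) 0))
    simp only [sH_bv, map_smul, coef_smul, coef_sH] at h
    have := mul_right_cancel₀ hζ h
    simpa using this
  have h02 : D.fam 0 2 = 0 := D.fam_eq_zero_of_parity hn ha.symm
  refine ⟨fun i j hij => ?_, ha, ?_⟩
  · rcases le_or_gt j i with h | h
    · exact D.fam_eq_zero_of_le hn h
    · have hi : i = 0 := by omega
      have hj : j = 2 := by subst hi; rw [Fin.val_zero] at hij; omega
      subst hi hj
      exact h02
  · obtain ⟨κ, -, -, hκa, hκm, hw, -⟩ := family_shape (D.fam 0 1) (D.fam_lie 0 1)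
      (D.fam_succ_ne_zero hn (i := 0) (by omega))
    have hcl := weights_of_family (κ := κ) (m := 2 * n - 1) ⟨n - 1, by omega⟩ (D.fam 0 1)
      (D.fam_lie 0 1)
      (D.fam 1 2) (D.fam_lie 1 2) ha hw hκa hκm hζ (fun x y => by
        have := congrArg (fun v => coef (D.pr 0 v) 0)
          (omega_smul_lie_heisZ x y (D.emb 2 (bv F (a 2) 0)))
        simp only [map_smul, map_sub, D.pr_zero_lie_lie hn, D.pr_emb] at this
        rw [coef_smul] at this
        rw [hZ, this]
        exact (map_sub (coefL F (a 0) 0) _ _).symm)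
    rcases hcl with h | ⟨h, -⟩ | ⟨h, h'⟩ | ⟨h, h', h''⟩
    · have : n = 1 := by omega
      subst this
      rcases Nat.lt_or_ge κ 1 with h0 | h0
      · left; omega
      · right; left; exact ⟨rfl, by omega⟩
    · left; omega
    · rcases Nat.lt_or_ge 1 n with h1 | h1
      · right; right; exact ⟨h1, h', by omega⟩
      · right; left; exact ⟨by omega, by omega⟩
    · exfalso
      have hn2 : n = 2 := by omega
      have h1 : a 1 = 3 := by omega
      have : a = ![4, 3, 4] := by
        funext i
        fin_cases i
        · exact h''
        · exact h1
        · exact ha.trans h''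
      subst this
      exact hex ⟨hn2, ⟨D⟩⟩

/-! ### Modules of type `Z` -/

/-- The highest weights of the `sl(2)`-module `V` lie in `α + ℕ m` and have multiplicity one. -/
def HasWeights (F : Type*) [Field F] (n : ℕ) (V : Type*) [AddCommGroup V] [Module F V]
    [LieRingModule (Gal F n) V] (α : ℕ) : Prop :=
  ∀ (μ : ℕ) (p : V), p ≠ 0 → ⁅ofSL2 F n sE, p⁆ = 0 → ⁅ofSL2 F n sH, p⁆ = (μ : F) • p →
    (∃ j, μ = α + j * (2 * n - 1)) ∧ ∀ p' : V, ⁅ofSL2 F n sE, p'⁆ = 0 →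
      ⁅ofSL2 F n sH, p'⁆ = (μ : F) • p' → ∃ t : F, p' = t • p

theorem HasWeights.of_equiv {W : Type*} [AddCommGroup W] [Module F W] [LieRingModule (Gal F n) W]
    {α : ℕ} (h : HasWeights F n W α) (e : V ≃ₗ⁅F, Gal F n⁆ W) : HasWeights F n V α := by
  intro μ p hp0 hpE hpH
  have he : ∀ (X : Gal F n) (q : V), e ⁅X, q⁆ = ⁅X, e q⁆ := e.toLieModuleHom.map_lie
  have hE : ∀ q : V, ⁅ofSL2 F n sE, q⁆ = 0 → ⁅ofSL2 F n sE, e q⁆ = 0 := fun q hq => by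
    rw [← he, hq, map_zero]
  have hH : ∀ q : V, ⁅ofSL2 F n sH, q⁆ = (μ : F) • q → ⁅ofSL2 F n sH, e q⁆ = (μ : F) • e q :=
    fun q hq => by rw [← he, hq, map_smul]
  obtain ⟨h1, h2⟩ := h μ (e p) (fun h => hp0 (e.injective (h.trans (map_zero e).symm)))
    (hE p hpE) (hH p hpH)
  refine ⟨h1, fun p' hE' hH' => ?_⟩
  obtain ⟨t, ht⟩ := h2 (e p') (hE p' hE') (hH p' hH')
  exact ⟨t, e.injective (by rw [ht, map_smul])⟩

theorem modZ_lie_ofSL2 {α ℓ : ℕ} (A : SL2 F) (c : ModZ F n α ℓ) (j : Fin (ℓ + 1)) :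
    ⁅ofSL2 F n A, c⁆ j = ⁅A, c j⁆ := by
  rw [modZ_lie_apply]
  have h : shift (0 : Irr F (2 * n - 1)) c = 0 := by
    have := shift_smul_left (0 : F) (0 : Irr F (2 * n - 1)) c
    rwa [zero_smul, zero_smul] at this
  change ⁅A, c j⁆ + shift (0 : Irr F (2 * n - 1)) c j = _
  rw [h]
  exact add_zero _

theorem step_injective (hn : 1 ≤ n) {α i j : ℕ}
    (h : α + i * (2 * n - 1) = α + j * (2 * n - 1)) : i = j :=
  Nat.eq_of_mul_eq_mul_right (by omega) (Nat.add_left_cancel h)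

/-- In each summand e kills only multiples of v_0, and the weights α + jm are pairwise distinct. -/
theorem hasWeights_modZ (hn : 1 ≤ n) (α ℓ : ℕ) : HasWeights F n (ModZ F n α ℓ) α := by
  have key : ∀ (μ : ℕ) (p : ModZ F n α ℓ), ⁅ofSL2 F n sE, p⁆ = 0 →
      ⁅ofSL2 F n sH, p⁆ = (μ : F) • p → ∀ j : Fin (ℓ + 1), p j = coef (p j) 0 • bv F _ 0 ∧
        (coef (p j) 0 ≠ 0 → μ = α + j.1 * (2 * n - 1)) := by
    intro μ p hE hH j
    refine ⟨eq_smul_bv_zero ?_, fun h0 => ?_⟩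
    · rw [← modZ_lie_ofSL2, hE]; rfl
    · have h1 : ⁅(sH : SL2 F), p j⁆ = (μ : F) • p j := by rw [← modZ_lie_ofSL2, hH]; rfl
      have h2 := congrArg (fun d => coef d 0) h1
      simp only [coef_sH, coef_smul] at h2
      have h3 := mul_right_cancel₀ h0 h2
      rw [Nat.cast_zero, mul_zero, sub_zero] at h3
      exact_mod_cast h3.symm
  intro μ p hp0 hE hH
  obtain ⟨j, hj⟩ : ∃ j, coef (p j) 0 ≠ 0 := by
    by_contra hne
    push Not at hne
    refine hp0 (funext fun j => ?_)
    rw [(key μ p hE hH j).1, hne j, zero_smul]; rfl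
  have hμ := (key μ p hE hH j).2 hj
  refine ⟨⟨j.1, hμ⟩, fun p' hE' hH' => ⟨coef (p' j) 0 / coef (p j) 0, funext fun i => ?_⟩⟩
  change p' i = (coef (p' j) 0 / coef (p j) 0) • p i
  by_cases hij : i = j
  · subst hij
    rw [(key μ p hE hH i).1, (key μ p' hE' hH' i).1, smul_smul, coef_smul, coef_smul,
      coef_bv_self (Nat.zero_le _), mul_one, mul_one, div_mul_cancel₀ _ hj]
  · have hi : ∀ q : ModZ F n α ℓ, ⁅ofSL2 F n sE, q⁆ = 0 → ⁅ofSL2 F n sH, q⁆ = (μ : F) • q →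
        q i = 0 := fun q h1 h2 => by
      have : coef (q i) 0 = 0 := by
        by_contra h0
        exact hij (Fin.ext (step_injective hn (((key μ q h1 h2 i).2 h0).symm.trans hμ)))
      rw [(key μ q h1 h2 i).1, this, zero_smul]
    rw [hi p' hE' hH', hi p hE hH, smul_zero]

/-- The inclusion of a summand of `Z(α, ℓ)`. -/
def singleZ (F : Type*) [Field F] (n α ℓ : ℕ) (j : Fin (ℓ + 1)) :
    Irr F (α + j.1 * (2 * n - 1)) →ₗ[F] ModZ F n α ℓ :=
  LinearMap.single F (fun j : Fin (ℓ + 1) => Irr F (α + j.1 * (2 * n - 1))) j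

theorem singleZ_lie {α ℓ : ℕ} (A : SL2 F) (j : Fin (ℓ + 1))
    (c : Irr F (α + j.1 * (2 * n - 1))) :
    ⁅ofSL2 F n A, singleZ F n α ℓ j c⁆ = singleZ F n α ℓ j ⁅A, c⁆ := by
  funext i
  rw [modZ_lie_ofSL2]
  change ⁅A, (Pi.single j c : (j : Fin (ℓ + 1)) → Irr F (α + j.1 * (2 * n - 1))) i⁆ =
    (Pi.single j ⁅A, c⁆ : (j : Fin (ℓ + 1)) → Irr F (α + j.1 * (2 * n - 1))) i
  by_cases h : i = j
  · subst h; rw [Pi.single_eq_same, Pi.single_eq_same]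
  · rw [Pi.single_eq_of_ne h, Pi.single_eq_of_ne h, lie_zero]

theorem dualZ_ext {α ℓ : ℕ} {ξ ξ' : ModZ F n α ℓ →ₗ[F] F}
    (h : ∀ j, ∀ s ≤ α + j.1 * (2 * n - 1),
      ξ (singleZ F n α ℓ j (bv F _ s)) = ξ' (singleZ F n α ℓ j (bv F _ s))) : ξ = ξ' := by
  refine LinearMap.pi_ext' (R := F) (φ := fun j : Fin (ℓ + 1) => Irr F (α + j.1 * (2 * n - 1)))
    fun j => (irrBasis F _).ext fun s => ?_
  rw [irrBasis_apply]
  exact h j s.1 (by omega)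

/-- A functional killed by e vanishes on all weight basis vectors except the lowest one of each V(α
+ jm). That vector has weight -(α + jm), so the dual has the same highest weights. -/
theorem hasWeights_dualZ (hn : 1 ≤ n) (α ℓ : ℕ) :
    HasWeights F n (ModZ F n α ℓ →ₗ[F] F) α := by
  have key1 : ∀ ξ : ModZ F n α ℓ →ₗ[F] F, ⁅ofSL2 F n sE, ξ⁆ = 0 → ∀ j, ∀ s,
      s < α + j.1 * (2 * n - 1) → ξ (singleZ F n α ℓ j (bv F _ s)) = 0 := by
    intro ξ hE j s hs
    have h := LinearMap.congr_fun hE (singleZ F n α ℓ j (bv F _ (s + 1)))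
    rw [Module.Dual.lie_apply, singleZ_lie, sE_bv_succ hs.le, map_smul, map_smul,
      LinearMap.zero_apply, neg_eq_zero, smul_eq_zero] at h
    exact h.resolve_left (natCast_sub_ne_zero hs)
  have key2 : ∀ (μ : ℕ) (ξ : ModZ F n α ℓ →ₗ[F] F), ⁅ofSL2 F n sH, ξ⁆ = (μ : F) • ξ → ∀ j,
      ξ (singleZ F n α ℓ j (bv F _ (α + j.1 * (2 * n - 1)))) ≠ 0 →
        μ = α + j.1 * (2 * n - 1) := by
    intro μ ξ hH j h0
    have h := LinearMap.congr_fun hH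
      (singleZ F n α ℓ j (bv F _ (α + j.1 * (2 * n - 1))))
    rw [Module.Dual.lie_apply, singleZ_lie, sH_bv, map_smul, map_smul, LinearMap.smul_apply,
      smul_eq_mul, smul_eq_mul, ← neg_mul] at h
    have h1 := mul_right_cancel₀ h0 h
    have h2 : ((α + j.1 * (2 * n - 1) : ℕ) : F) = μ := by linear_combination h1
    exact_mod_cast h2.symm
  intro μ ξ hξ hE hH
  obtain ⟨j, hj⟩ : ∃ j, ξ (singleZ F n α ℓ j (bv F _ (α + j.1 * (2 * n - 1)))) ≠ 0 := by
    by_contra hne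
    push Not at hne
    refine hξ (dualZ_ext fun j s hs => ?_)
    rcases hs.lt_or_eq with h | h
    · rw [key1 ξ hE j s h]; rfl
    · subst h; rw [hne j]; rfl
  have hμ := key2 μ ξ hH j hj
  refine ⟨⟨j.1, hμ⟩, fun ξ' hE' hH' =>
    ⟨ξ' (singleZ F n α ℓ j (bv F _ (α + j.1 * (2 * n - 1)))) /
      ξ (singleZ F n α ℓ j (bv F _ (α + j.1 * (2 * n - 1)))), dualZ_ext fun i s hs => ?_⟩⟩
  rw [LinearMap.smul_apply, smul_eq_mul]
  rcases hs.lt_or_eq with h | h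
  · rw [key1 ξ hE i s h, key1 ξ' hE' i s h, mul_zero]
  · subst h
    by_cases hij : i = j
    · subst hij; rw [div_mul_cancel₀ _ hj]
    · have hi : ∀ ξ : ModZ F n α ℓ →ₗ[F] F, ⁅ofSL2 F n sH, ξ⁆ = (μ : F) • ξ →
          ξ (singleZ F n α ℓ i (bv F _ (α + i.1 * (2 * n - 1)))) = 0 := fun ξ h => by
        by_contra h0
        exact hij (Fin.ext (step_injective hn ((key2 μ ξ h i h0).symm.trans hμ)))
      rw [hi ξ hH, hi ξ' hH', mul_zero]

theorem hasWeights_of_isZ (hn : 1 ≤ n) {α ℓ : ℕ} (h : IsZ F n V α ℓ) : HasWeights F n V α :=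
  h.elim fun e => (hasWeights_modZ hn α ℓ).of_equiv e

theorem hasWeights_of_isZDual (hn : 1 ≤ n) {α ℓ : ℕ} (h : IsZDual F n V α ℓ) :
    HasWeights F n V α :=
  h.elim fun e => (hasWeights_dualZ hn α ℓ).of_equiv e

/-- A walk with steps ±1 that never revisits a point cannot turn round. -/
theorem monotone_of_steps {N : ℕ} (σ : ℕ → ℕ) (hinj : ∀ i j, i ≤ N → j ≤ N → σ i = σ j → i = j)
    (hstep : ∀ i < N, σ (i + 1) = σ i + 1 ∨ σ i = σ (i + 1) + 1) :
    (∀ i ≤ N, σ i = σ 0 + i) ∨ ∀ i ≤ N, σ i + i = σ 0 := by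
  rcases Nat.eq_zero_or_pos N with h | h
  · subst h
    left; intro i hi
    have : i = 0 := by omega
    subst this; rfl
  rcases hstep 0 h with h0 | h0
  · left
    have : ∀ i, i + 1 ≤ N → σ i = σ 0 + i ∧ σ (i + 1) = σ 0 + (i + 1) := by
      intro i
      induction i with
      | zero => intro _; exact ⟨rfl, h0⟩
      | succ i ih =>
        intro hi
        obtain ⟨h1, h2⟩ := ih (by omega)
        refine ⟨h2, ?_⟩
        rcases hstep (i + 1) (by omega) with h3 | h3
        · omega
        · have := hinj i (i + 1 + 1) (by omega) hi (by omega)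
          omega
    intro i hi
    rcases Nat.eq_zero_or_pos i with h' | h'
    · subst h'; rfl
    · obtain ⟨j, rfl⟩ : ∃ j, i = j + 1 := ⟨i - 1, by omega⟩
      exact (this j hi).2
  · right
    have : ∀ i, i + 1 ≤ N → σ i + i = σ 0 ∧ σ (i + 1) + (i + 1) = σ 0 := by
      intro i
      induction i with
      | zero => intro _; exact ⟨rfl, by omega⟩
      | succ i ih =>
        intro hi
        obtain ⟨h1, h2⟩ := ih (by omega)
        refine ⟨h2, ?_⟩
        rcases hstep (i + 1) (by omega) with h3 | h3
        · have := hinj i (i + 1 + 1) (by omega) hi (by omega)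
          omega
        · omega
    intro i hi
    rcases Nat.eq_zero_or_pos i with h' | h'
    · subst h'; rfl
    · obtain ⟨j, rfl⟩ : ∃ j, i = j + 1 := ⟨i - 1, by omega⟩
      exact (this j hi).2

/-- The weights of a uniserial module whose `sl(2)`-structure is that of a module of type `Z`
increase or decrease by `m` in each step. -/
theorem HasWeights.shape (hn : 1 ≤ n) {α N : ℕ} (h : HasWeights F n V α) {b : Fin (N + 1) → ℕ}
    (D : SocleDecomposition F n V b) :
    D.IsChain ∧ (∀ i, i < N + 1 → α ≤ extSeq b i) ∧
      ((∀ i, i < N + 1 → extSeq b i = extSeq b 0 + i * (2 * n - 1)) ∨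
        ∀ i, i < N + 1 → extSeq b i + i * (2 * n - 1) = extSeq b 0) := by
  have hE : ∀ i, ⁅ofSL2 F n sE, D.emb i (bv F (b i) 0)⁆ = 0 := fun i => by
    rw [← D.emb_lie, sE_bv_zero, map_zero]
  have hH : ∀ i, ⁅ofSL2 F n sH, D.emb i (bv F (b i) 0)⁆ =
      ((b i : ℕ) : F) • D.emb i (bv F (b i) 0) := fun i => by
    rw [← D.emb_lie, sH_bv, map_smul]; simp
  have h0 : ∀ i, D.emb i (bv F (b i) 0) ≠ 0 := fun i h => bv_ne_zero (F := F) (Nat.zero_le (b i))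
    (D.emb_injective i (h.trans (map_zero _).symm))
  -- σ i is the position of the i-th weight in α + ℕ m; it is injective because highest weights have
  -- multiplicity one.
  choose σ hσ using fun i => (h (b i) _ (h0 i) (hE i) (hH i)).1
  have hσinj : ∀ i j, σ i = σ j → i = j := by
    intro i j hij
    by_contra hne
    have hb : b j = b i := by rw [hσ i, hσ j, hij]
    obtain ⟨t, ht⟩ := (h (b i) _ (h0 i) (hE i) (hH i)).2 _ (hE j)
      ((hH j).trans (congrArg (fun k : ℕ => (k : F) • D.emb j (bv F (b j) 0)) hb))
    have := congrArg (D.pr j) ht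
    rw [D.pr_emb, map_smul, D.pr_emb_ne (Ne.symm hne), smul_zero] at this
    exact bv_ne_zero (Nat.zero_le _) this
  have hpos : 0 < 2 * n - 1 := by omega
  -- A non-zero entry gives b_i + m = b_j + 2κ with 0 ≤ κ ≤ m, so the positions differ by at most
  -- one; they cannot agree since m is odd.
  have hlink : ∀ i j, D.fam i j ≠ 0 → σ j = σ i + 1 ∨ σ i = σ j + 1 := by
    intro i j hij
    obtain ⟨κ, -, -, -, h1, h2, -⟩ := family_shape _ (D.fam_lie i j) hij
    rw [hσ i, hσ j] at h2
    have h3 : σ j * (2 * n - 1) ≤ (σ i + 1) * (2 * n - 1) := by rw [Nat.add_mul]; omega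
    have h4 : (σ i + 1) * (2 * n - 1) ≤ (σ j + 2) * (2 * n - 1) := by
      rw [Nat.add_mul, Nat.add_mul]; omega
    have h5 := Nat.le_of_mul_le_mul_right h3 hpos
    have h6 := Nat.le_of_mul_le_mul_right h4 hpos
    have h7 : σ i ≠ σ j := fun h => by rw [h] at h2; omega
    omega
  let s : ℕ → ℕ := fun i => if hi : i < N + 1 then σ ⟨i, hi⟩ else 0
  have hs : ∀ i (hi : i < N + 1), s i = σ ⟨i, hi⟩ := fun i hi => dif_pos hi
  have hs' : ∀ i : Fin (N + 1), σ i = s i.1 := fun i => (hs i.1 i.2).symm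
  have hb : ∀ i, i < N + 1 → extSeq b i = α + s i * (2 * n - 1) := fun i hi => by
    rw [extSeq_of_lt b hi, hσ, hs i hi]
  have hmono := monotone_of_steps (N := N) s
    (fun i j hi hj hij => by
      rw [hs i (by omega), hs j (by omega)] at hij
      exact congrArg Fin.val (hσinj _ _ hij))
    (fun i hi => by
      rw [hs i (by omega), hs (i + 1) (by omega)]
      exact hlink _ _ (D.fam_succ_ne_zero hn (by omega)))
  refine ⟨fun i j hij => ?_, fun i hi => by rw [hb i hi]; omega, ?_⟩
  · by_contra hne
    have h1 : ¬ j ≤ i := fun h => hne (D.fam_eq_zero_of_le hn h)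
    rw [Fin.le_def] at h1
    have h2 := hlink i j hne
    rw [hs' i, hs' j] at h2
    have hi := i.2
    have hj := j.2
    rcases hmono with h3 | h3
    · rw [h3 i.1 (by omega), h3 j.1 (by omega)] at h2; omega
    · have h4 := h3 i.1 (by omega)
      have h5 := h3 j.1 (by omega)
      omega
  · rcases hmono with h3 | h3
    · left
      intro i hi
      rw [hb i hi, hb 0 (by omega), h3 i (by omega), Nat.add_mul]; omega
    · right
      intro i hi
      rw [hb i hi, hb 0 (by omega), ← h3 i (by omega), Nat.add_mul]; omega

theorem typeZ_shape (hn : 1 ≤ n) (hV : IsTypeZ F n V) {N : ℕ} {b : Fin (N + 1) → ℕ}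
    (D : SocleDecomposition F n V b) :
    D.IsChain ∧ ((∀ i, i < N + 1 → extSeq b i = extSeq b 0 + i * (2 * n - 1)) ∨
        ∀ i, i < N + 1 → extSeq b i + i * (2 * n - 1) = extSeq b 0) := by
  obtain ⟨α, ℓ, h | h⟩ := hV
  · have := (hasWeights_of_isZ hn h).shape hn D
    exact ⟨this.1, this.2.2⟩
  · have := (hasWeights_of_isZDual hn h).shape hn D
    exact ⟨this.1, this.2.2⟩

/-- The socle weight b_0 is the least highest weight available, so the weights cannot decrease. -/
theorem isZ_weight (hn : 1 ≤ n) {N : ℕ} {b : Fin (N + 1) → ℕ} (D : SocleDecomposition F n V b)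
    (hV : IsZ F n V (b 0) N) (hN : 1 ≤ N) : extSeq b 1 = extSeq b 0 + (2 * n - 1) := by
  obtain ⟨-, h1, h2 | h2⟩ := (hasWeights_of_isZ hn hV).shape hn D
  · rw [h2 1 (by omega), one_mul]
  · have h3 := h1 1 (by omega)
    have h4 := h2 1 (by omega)
    have h5 : extSeq b 0 = b 0 := extSeq_of_lt b (by omega)
    omega

/-- The least weight sits in the last layer of the socle series, so the weights cannot increase. -/
theorem isZDual_weight (hn : 1 ≤ n) {N : ℕ} {b : Fin (N + 1) → ℕ} (D : SocleDecomposition F n V b)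
    (hV : IsZDual F n V (b (Fin.last N)) N) (hN : 1 ≤ N) :
    extSeq b 1 + (2 * n - 1) = extSeq b 0 := by
  obtain ⟨-, h1, h2 | h2⟩ := (hasWeights_of_isZDual hn hV).shape hn D
  · have h3 := h1 0 (by omega)
    have h4 := h2 N (by omega)
    have h5 : extSeq b N = b (Fin.last N) := extSeq_of_lt b (by omega)
    have h6 : 1 * (2 * n - 1) ≤ N * (2 * n - 1) := Nat.mul_le_mul_right _ hN
    omega
  · have := h2 1 (by omega)
    omega

end shapes

/-! ### Highest weight vectors in `V(a) ⊗ V(d)`, in coordinates -/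

section pairs

set_option linter.unusedSectionVars false

variable {F : Type*} [Field F]

/-- The array `α` of coordinates describes a vector of `V(a) ⊗ V(d)` killed by `e`. -/
structure IsHW (a d : ℕ) (α : ℕ → ℕ → F) : Prop where
  left : ∀ s t, a < s → α s t = 0
  right : ∀ s t, d < t → α s t = 0
  lie : ∀ s t, ((a : F) - s) * α (s + 1) t + ((d : F) - t) * α s (t + 1) = 0

/-- The highest weight vector of weight `a + d - 2 r` in `V(a) ⊗ V(d)`. -/
def hwv (F : Type*) [Field F] (a d r : ℕ) (s t : ℕ) : F :=
  if s + t = r then (-1) ^ s * ((a - s).factorial * (d - t).factorial : ℕ) else 0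

theorem hwv_of_ne {a d r s t : ℕ} (h : s + t ≠ r) : hwv F a d r s t = 0 := if_neg h

theorem hwv_of_eq {a d r s t : ℕ} (h : s + t = r) :
    hwv F a d r s t = (-1) ^ s * ((a - s).factorial * (d - t).factorial : ℕ) := if_pos h

theorem hwv_ne_zero [CharZero F] {a d r s t : ℕ} (h : s + t = r) : hwv F a d r s t ≠ 0 := by
  rw [hwv_of_eq h]
  refine mul_ne_zero (pow_ne_zero _ (neg_ne_zero.2 one_ne_zero)) ?_
  exact_mod_cast (Nat.mul_pos (Nat.factorial_pos _) (Nat.factorial_pos _)).ne'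

theorem cast_factorial_sub {a s : ℕ} (h : s < a) :
    ((a - s).factorial : F) = ((a : F) - s) * ((a - (s + 1)).factorial : F) := by
  obtain ⟨j, rfl⟩ : ∃ j, a = s + 1 + j := ⟨a - (s + 1), by omega⟩
  rw [show s + 1 + j - s = j + 1 by omega, show s + 1 + j - (s + 1) = j by omega,
    Nat.factorial_succ]
  push_cast
  ring

theorem isHW_hwv {a d r : ℕ} (ha : r ≤ a) (hd : r ≤ d) : IsHW a d (hwv F a d r) where
  left s t h := hwv_of_ne (by omega)
  right s t h := hwv_of_ne (by omega)
  lie s t := by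
    by_cases h : s + t + 1 = r
    · rw [hwv_of_eq (by omega : s + 1 + t = r), hwv_of_eq (by omega : s + (t + 1) = r)]
      have h1 := cast_factorial_sub (F := F) (by omega : s < a)
      have h2 := cast_factorial_sub (F := F) (by omega : t < d)
      push_cast
      rw [h1, h2, pow_succ]
      ring
    · rw [hwv_of_ne (by omega), hwv_of_ne (by omega)]; ring

theorem IsHW.smul {a d : ℕ} {α : ℕ → ℕ → F} (h : IsHW a d α) (k : F) :
    IsHW a d fun s t => k * α s t where
  left s t hs := by rw [h.left s t hs, mul_zero]
  right s t hs := by rw [h.right s t hs, mul_zero]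
  lie s t := by linear_combination k * h.lie s t

theorem IsHW.swap {a d : ℕ} {α : ℕ → ℕ → F} (h : IsHW a d α) : IsHW d a fun s t => α t s where
  left s t hs := h.right t s hs
  right s t hs := h.left t s hs
  lie s t := by linear_combination h.lie t s

variable [CharZero F]

/-- Every vector killed by `e` is a combination of the vectors `hwv`. -/
theorem IsHW.exists_coeff {a d : ℕ} {α : ℕ → ℕ → F} (h : IsHW a d α) :
    ∃ k : ℕ → F, (∀ r, a < r ∨ d < r → k r = 0) ∧
      ∀ s t, α s t = k (s + t) * hwv F a d (s + t) s t := by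
  -- An antidiagonal too long for V(a) or V(d) starts at a zero outside the array, and the relation
  -- carries this zero along.
  have hbig : ∀ r, (a < r ∨ d < r) → ∀ s t, s + t = r → α s t = 0 := by
    intro r hr
    rcases Nat.lt_or_ge d r with hd | hd
    · intro s
      induction s with
      | zero => intro t ht; exact h.right _ _ (by omega)
      | succ s ih =>
        intro t ht
        rcases Nat.lt_or_ge s a with hs | hs
        · have h1 := h.lie s t
          rw [ih (t + 1) (by omega), mul_zero, add_zero, mul_eq_zero] at h1
          exact h1.resolve_left (natCast_sub_ne_zero hs)
        · exact h.left _ _ (by omega)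
    · intro s t
      induction t generalizing s with
      | zero => intro ht; exact h.left _ _ (by omega)
      | succ t ih =>
        intro ht
        have h1 := h.lie s t
        rw [ih (s + 1) (by omega), mul_zero, zero_add, mul_eq_zero] at h1
        exact h1.resolve_left (natCast_sub_ne_zero (by omega))
  refine ⟨fun r => if a < r ∨ d < r then 0 else α 0 r / hwv F a d r 0 r,
    fun r hr => if_pos hr, ?_⟩
  -- On the other antidiagonals the relation is a one-step recursion in s which `hwv` also
  -- satisfies, so the entry at s = 0 fixes the scalar.
  have hr : ∀ r, ¬ (a < r ∨ d < r) → ∀ s t, s + t = r →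
      α s t = α 0 r / hwv F a d r 0 r * hwv F a d r s t := by
    intro r hr s
    push Not at hr
    have hw := isHW_hwv (F := F) hr.1 hr.2
    induction s with
    | zero =>
      intro t ht
      rw [zero_add] at ht
      subst ht
      rw [div_mul_cancel₀ _ (hwv_ne_zero (zero_add t))]
    | succ s ih =>
      intro t ht
      have h1 := h.lie s t
      have h2 := hw.lie s t
      rw [ih (t + 1) (by omega)] at h1
      apply mul_left_cancel₀ (natCast_sub_ne_zero (F := F) (by omega : s < a))
      linear_combination h1 - α 0 r / hwv F a d r 0 r * h2
  intro s t
  change α s t =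
    (if a < s + t ∨ d < s + t then 0 else α 0 (s + t) / hwv F a d (s + t) 0 (s + t)) * _
  by_cases hst : a < s + t ∨ d < s + t
  · rw [if_pos hst, zero_mul]; exact hbig _ hst s t rfl
  · rw [if_neg hst]; exact hr _ hst s t rfl

/-- A vector killed by `e` is determined by its coordinates in the first row. -/
theorem IsHW.eq_zero_of_row {a d : ℕ} {α : ℕ → ℕ → F} (h : IsHW a d α) {r : ℕ}
    (h0 : r ≤ d → α 0 r = 0) : ∀ s t, s + t = r → α s t = 0 := by
  obtain ⟨k, hk, hα⟩ := h.exists_coeff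
  intro s t hst
  rw [hα s t, hst]
  rcases Nat.lt_or_ge d r with hd | hd
  · rw [hk r (Or.inr hd), zero_mul]
  · have := h0 hd
    rw [hα 0 r, zero_add, mul_eq_zero] at this
    rw [this.resolve_right (hwv_ne_zero (zero_add r)), zero_mul]

/-- If one coordinate on the `r`-th antidiagonal vanishes, all of them do. -/
theorem IsHW.eq_zero_of_antidiagonal {a d : ℕ} {α : ℕ → ℕ → F} (h : IsHW a d α) {s' t' : ℕ}
    (h0 : α s' t' = 0) : ∀ s t, s + t = s' + t' → α s t = 0 := by
  obtain ⟨k, hk, hα⟩ := h.exists_coeff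
  intro s t hst
  rw [hα s' t', mul_eq_zero] at h0
  rw [hα s t, hst, h0.resolve_right (hwv_ne_zero rfl), zero_mul]

/-- The coordinates `α` of a vector of `V(a) ⊗ V(d)` and `β` of a vector of `V(c) ⊗ V(b)`, both
killed by `e`, such that the sum of the two vectors is killed by the lowest weight vector of
`V(m)`. -/
structure IsPair (a c b d κ κ' : ℕ) (x y : F) (α β : ℕ → ℕ → F) : Prop where
  hw_left : IsHW a d α
  hw_right : IsHW c b β
  low : ∀ s t, s ≤ a → t ≤ b →
    x * (s.choose κ : F) * β (s - κ) t + y * (t.choose κ' : F) * α s (t - κ') = 0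

variable {a c b d κ κ' m : ℕ} {x y : F} {α β : ℕ → ℕ → F}

/-- Exchanging the tensor factors reduces (κ, κ') = (m, 0) to (0, m). -/
theorem IsPair.swap (h : IsPair a c b d κ κ' x y α β) :
    IsPair b d a c κ' κ y x (fun s t => β t s) (fun s t => α t s) where
  hw_left := h.hw_right.swap
  hw_right := h.hw_left.swap
  low s t hs ht := by linear_combination h.low t s ht hs

/-- At s = κ the relation isolates the first row of β, which determines β. -/
theorem IsPair.right_eq_zero (h : IsPair a c b d κ κ' x y α β) (hx : x ≠ 0) (hκ : κ ≤ a)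
    (hα : ∀ s t, α s t = 0) : ∀ s t, β s t = 0 := by
  intro s t
  refine h.hw_right.eq_zero_of_row (r := s + t) (fun hr => ?_) s t rfl
  have := h.low κ (s + t) hκ hr
  rw [hα, mul_zero, add_zero, Nat.choose_self, Nat.cast_one, mul_one, Nat.sub_self] at this
  exact (mul_eq_zero.1 this).resolve_left hx

theorem IsPair.left_eq_zero (h : IsPair a c b d κ κ' x y α β) (hy : y ≠ 0) (hκ : κ' ≤ b)
    (hβ : ∀ s t, β s t = 0) : ∀ s t, α s t = 0 := fun s t =>
  h.swap.right_eq_zero hy hκ (fun s t => hβ t s) t s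

theorem choose_ne_zero' {n k : ℕ} (h : k ≤ n) : (n.choose k : F) ≠ 0 := by
  exact_mod_cast (Nat.choose_pos h).ne'

/-! Both factors are lowered (`κ = κ' = 0`). -/

/-- For s ≤ a, t ≤ b the relation makes β a constant multiple of α. But the factorials in the two
arrays belong to different highest weights, and on an antidiagonal of positive index their ratio is
not constant. -/
theorem IsPair.support_zero_zero (h : IsPair a c b d 0 0 x y α β) (hx : x ≠ 0) (hy : y ≠ 0)
    (hm : 0 < m) (hc : a + m = c) (hd : b + m = d) {s t : ℕ} (hst : s + t ≠ 0) :
    α s t = 0 ∧ β s t = 0 := by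
  subst hc hd
  have hlow : ∀ s t, s ≤ a → t ≤ b → x * β s t + y * α s t = 0 := fun s t hs ht => by
    simpa using h.low s t hs ht
  obtain ⟨k, hk, hα⟩ := h.hw_left.exists_coeff
  obtain ⟨l, hl, hβ⟩ := h.hw_right.exists_coeff
  have key : k (s + t) = 0 ∧ l (s + t) = 0 := by
    generalize s + t = r at hst
    rcases Nat.lt_or_ge a r with har | har <;> rcases Nat.lt_or_ge b r with hbr | hbr
    · exact ⟨hk r (Or.inl har), hl r (Or.inr hbr)⟩
    · have h1 := hk r (Or.inl har)
      refine ⟨h1, ?_⟩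
      have h2 := hlow 0 r (Nat.zero_le _) hbr
      rw [hα, hβ, zero_add, h1, zero_mul, mul_zero, add_zero] at h2
      exact (mul_eq_zero.1 ((mul_eq_zero.1 h2).resolve_left hx)).resolve_right
        (hwv_ne_zero (zero_add r))
    · have h1 := hl r (Or.inr hbr)
      refine ⟨?_, h1⟩
      have h2 := hlow r 0 har (Nat.zero_le _)
      rw [hα, hβ, add_zero, h1, zero_mul, mul_zero, zero_add] at h2
      exact (mul_eq_zero.1 ((mul_eq_zero.1 h2).resolve_left hy)).resolve_right
        (hwv_ne_zero (add_zero r))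
    · obtain ⟨r, rfl⟩ : ∃ r', r = r' + 1 := ⟨r - 1, by omega⟩
      have h1 := hlow 0 (r + 1) (Nat.zero_le _) hbr
      have h2 := hlow 1 r (by omega) (by omega)
      rw [hα, hβ, zero_add, hwv_of_eq (zero_add _), hwv_of_eq (zero_add _)] at h1
      rw [hα, hβ, add_comm 1 r, hwv_of_eq (add_comm 1 r), hwv_of_eq (add_comm 1 r)] at h2
      have e1 := cast_factorial_sub (F := F) (by omega : 0 < a)
      have e2 := cast_factorial_sub (F := F) (by omega : 0 < a + m)
      have e3 := cast_factorial_sub (F := F) (by omega : r < b)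
      have e4 := cast_factorial_sub (F := F) (by omega : r < b + m)
      rw [zero_add] at e1 e2
      push_cast at h1 h2 e1 e2 e3 e4
      rw [e1, e2] at h1
      rw [e3, e4] at h2
      have f1 : ((a - 1).factorial : F) ≠ 0 := by exact_mod_cast Nat.factorial_ne_zero _
      have f2 : ((b + m - (r + 1)).factorial : F) ≠ 0 := by exact_mod_cast Nat.factorial_ne_zero _
      -- The determinant of the equations at (0, r + 1) and (1, r), up to sign; it is minus a
      -- positive integer.
      have f3 : ((b : F) - r) * a - (b + m - r) * (a + m) ≠ 0 := by
        obtain ⟨b', rfl⟩ : ∃ b', b = r + 1 + b' := ⟨b - (r + 1), by omega⟩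
        have : (((b' + 1) * a + (m * a + (b' + 1 + m) * m) : ℕ) : F) -
            (((b' + 1) * a : ℕ) : F) ≠ 0 := by
          push_cast
          rw [add_sub_cancel_left]
          have : m * a + (b' + 1 + m) * m ≠ 0 := by positivity
          exact_mod_cast this
        intro h0
        apply this
        push_cast at h0 ⊢
        linear_combination -h0
      have h3 : y * k (r + 1) * (((a - 1).factorial : F) * ((b + m - (r + 1)).factorial : F)) *
          (((b : F) - r) * a - (b + m - r) * (a + m)) = 0 := by
        simp only [pow_zero, pow_one] at h1 h2
        linear_combination ((b : F) - r) * h1 + ((a : F) + m) * h2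
      have hk0 : k (r + 1) = 0 := by
        have h4 := (mul_eq_zero.1 ((mul_eq_zero.1 h3).resolve_right f3)).resolve_right
          (mul_ne_zero f1 f2)
        exact (mul_eq_zero.1 h4).resolve_left hy
      refine ⟨hk0, ?_⟩
      have h2 := hlow 0 (r + 1) (Nat.zero_le _) hbr
      rw [hα, hβ, zero_add, hk0, zero_mul, mul_zero, add_zero] at h2
      exact (mul_eq_zero.1 ((mul_eq_zero.1 h2).resolve_left hx)).resolve_right
        (hwv_ne_zero (zero_add _))
  rw [hα, hβ, key.1, key.2, zero_mul, zero_mul]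
  exact ⟨rfl, rfl⟩

theorem exists_pair_zero_zero (hx : x ≠ 0) :
    ∃ β : ℕ → ℕ → F, IsPair a c b d 0 0 x y (hwv F a d 0) β := by
  refine ⟨fun s t => -(y * hwv F a d 0 0 0) / (x * hwv F c b 0 0 0) * hwv F c b 0 s t,
    isHW_hwv (Nat.zero_le _) (Nat.zero_le _),
    (isHW_hwv (Nat.zero_le _) (Nat.zero_le _)).smul _, fun s t _ _ => ?_⟩
  have h1 : hwv F c b 0 0 0 ≠ 0 := hwv_ne_zero rfl
  simp only [Nat.choose_zero_right, Nat.cast_one, mul_one, Nat.sub_zero]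
  by_cases h : s + t = 0
  · obtain ⟨rfl, rfl⟩ : s = 0 ∧ t = 0 := by omega
    field_simp
    ring
  · rw [hwv_of_ne h, hwv_of_ne h]; ring

/-! The first factor is lowered and the second one raised (`κ = 0`, `κ' = m`). -/

/-- C(t, m) = 0 for t < m, so β vanishes wherever s ≤ a and t < m. The only antidiagonal in range
avoiding these points is s + t = a + m. The points (0, r + m) then confine α to s + t = a, which
carries a highest weight vector of V(a) ⊗ V(d) only if a ≤ d. -/
theorem IsPair.support_zero_top (h : IsPair a c b d 0 m x y α β) (hx : x ≠ 0) (hy : y ≠ 0)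
    (hm : 0 < m) (hc : a + m = c) (hd : b = d + m) {s t : ℕ} :
    (α s t ≠ 0 → s + t = a ∧ a ≤ d) ∧ (β s t ≠ 0 → s + t = a + m) := by
  subst hc hd
  have hlow : ∀ s t, s ≤ a → t ≤ d + m → x * β s t + y * (t.choose m : F) * α s (t - m) = 0 :=
    fun s t hs ht => by simpa using h.low s t hs ht
  have hβ : ∀ s t, s + t ≠ a + m → β s t = 0 := by
    intro s t hst
    rcases Nat.lt_or_ge (a + m) (s + t) with h1 | h1
    · obtain ⟨l, hl, hβ⟩ := h.hw_right.exists_coeff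
      rw [hβ, hl _ (Or.inl h1), zero_mul]
    rcases Nat.lt_or_ge (s + t) m with h2 | h2
    · refine h.hw_right.eq_zero_of_antidiagonal (s' := 0) (t' := s + t) ?_ s t (by omega)
      have h3 := hlow 0 (s + t) (Nat.zero_le _) (by omega)
      rw [Nat.choose_eq_zero_of_lt h2, Nat.cast_zero, mul_zero, zero_mul, add_zero] at h3
      exact (mul_eq_zero.1 h3).resolve_left hx
    · refine h.hw_right.eq_zero_of_antidiagonal (s' := s + t - (m - 1)) (t' := m - 1) ?_ s t
        (by omega)
      have h3 := hlow (s + t - (m - 1)) (m - 1) (by omega) (by omega)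
      rw [Nat.choose_eq_zero_of_lt (by omega : m - 1 < m), Nat.cast_zero, mul_zero, zero_mul,
        add_zero] at h3
      exact (mul_eq_zero.1 h3).resolve_left hx
  have hα : ∀ s t, s + t ≠ a → α s t = 0 := by
    intro s t hst
    refine h.hw_left.eq_zero_of_row (r := s + t) (fun hr => ?_) s t rfl
    have h3 := hlow 0 (s + t + m) (Nat.zero_le _) (by omega)
    rw [hβ _ _ (by omega), mul_zero, zero_add, Nat.add_sub_cancel, mul_assoc] at h3
    exact (mul_eq_zero.1 ((mul_eq_zero.1 h3).resolve_left hy)).resolve_left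
      (choose_ne_zero' (by omega))
  refine ⟨fun h0 => ?_, fun h0 => by_contra fun h1 => h0 (hβ s t h1)⟩
  have h1 : s + t = a := by_contra fun h1 => h0 (hα s t h1)
  refine ⟨h1, ?_⟩
  by_contra h2
  obtain ⟨k, hk, hα'⟩ := h.hw_left.exists_coeff
  rw [hα', hk _ (Or.inr (by omega)), zero_mul] at h0
  exact h0 rfl

theorem exists_pair_zero_top (hx : x ≠ 0) (hc : a + m = c) (hd : b = d + m) (had : a ≤ d) :
    ∃ β : ℕ → ℕ → F, IsPair a c b d 0 m x y (hwv F a d a) β := by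
  subst hc hd
  have hf : (m.factorial : F) ≠ 0 := by exact_mod_cast Nat.factorial_ne_zero m
  -- The scalar comes from C(u + m, m) u! m! = (u + m)!, for t = u + m.
  refine ⟨fun s t => -y / (x * m.factorial) * hwv F (a + m) (d + m) (a + m) s t,
    isHW_hwv le_rfl had, (isHW_hwv le_rfl (by omega)).smul _, fun s t hs _ => ?_⟩
  rw [Nat.choose_zero_right, Nat.cast_one, mul_one, Nat.sub_zero]
  rcases Nat.lt_or_ge t m with h | h
  · rw [Nat.choose_eq_zero_of_lt h, hwv_of_ne (by omega)]; simp
  · obtain ⟨u, rfl⟩ : ∃ u, t = u + m := ⟨t - m, by omega⟩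
    rw [Nat.add_sub_cancel]
    by_cases h1 : s + u = a
    · rw [hwv_of_eq h1, hwv_of_eq (by omega : s + (u + m) = a + m),
        show a + m - s = u + m by omega, show d + m - (u + m) = d - u by omega,
        show a - s = u by omega]
      have e := congrArg (Nat.cast : ℕ → F) (Nat.add_choose_mul_factorial_mul_factorial u m)
      push_cast at e ⊢
      rw [← e]
      field_simp
      ring
    · rw [hwv_of_ne h1, hwv_of_ne (by omega)]; ring

/-! The first factor is raised and the second one lowered (`κ = m`, `κ' = 0`). -/

theorem IsPair.support_top_zero (h : IsPair a c b d m 0 x y α β) (hx : x ≠ 0) (hy : y ≠ 0)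
    (hm : 0 < m) (hc : a = c + m) (hd : b + m = d) {s t : ℕ} :
    (α s t ≠ 0 → s + t = b + m) ∧ (β s t ≠ 0 → s + t = b ∧ b ≤ c) := by
  have h1 := h.swap.support_zero_top hy hx hm hd hc (s := t) (t := s)
  rw [add_comm t s] at h1
  exact ⟨h1.2, h1.1⟩

theorem exists_pair_top_zero (hx : x ≠ 0) (hy : y ≠ 0) (hc : a = c + m) (hd : b + m = d)
    (hbc : b ≤ c) :
    ∃ α β : ℕ → ℕ → F, IsPair a c b d m 0 x y α β ∧ ∃ s t, α s t ≠ 0 := by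
  obtain ⟨β, hβ⟩ := exists_pair_zero_top (y := x) hy hd hc hbc
  refine ⟨_, _, hβ.swap, ?_⟩
  by_contra h
  push Not at h
  have := hβ.swap.right_eq_zero hx (by omega) h 0 b
  exact hwv_ne_zero (add_zero b) this

/-! Both factors are raised (`κ = κ' = m`). -/

/-- C(0, m) = 0 removes the β-term at s = 0, so the first row of α vanishes, and with it everything
else. -/
theorem IsPair.eq_zero_top_top (h : IsPair a c b d m m x y α β) (hx : x ≠ 0) (hy : y ≠ 0)
    (hm : 0 < m) (hc : a = c + m) (hd : b = d + m) :
    (∀ s t, α s t = 0) ∧ ∀ s t, β s t = 0 := by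
  have hα : ∀ s t, α s t = 0 := by
    intro s t
    refine h.hw_left.eq_zero_of_row (r := s + t) (fun hr => ?_) s t rfl
    have h3 := h.low 0 (s + t + m) (Nat.zero_le _) (by omega)
    rw [Nat.choose_eq_zero_of_lt hm, Nat.cast_zero, mul_zero, zero_mul, zero_add,
      Nat.add_sub_cancel, mul_assoc] at h3
    exact (mul_eq_zero.1 ((mul_eq_zero.1 h3).resolve_left hy)).resolve_left
      (choose_ne_zero' (by omega))
  exact ⟨hα, h.right_eq_zero hx (by omega) hα⟩

/-! The first factor is `V(1)`, linked to `V(m - 1)` (`κ = 1`). -/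

/-- C(0, 1) = 0 kills α at (0, t) for t ≤ b. Antidiagonals beyond 1 do not occur in V(1) ⊗ V(d), and
antidiagonal 1 escapes only if (0, 1) lies outside the range t ≤ b. -/
theorem IsPair.support_one_zero (h : IsPair 1 c b d 1 0 x y α β) (hy : y ≠ 0)
    {s t : ℕ} (h0 : α s t ≠ 0) : s + t = 1 ∧ b = 0 := by
  have hrow : ∀ t, t ≤ b → α 0 t = 0 := by
    intro t ht
    have h3 := h.low 0 t (Nat.zero_le _) ht
    simpa [hy] using h3
  have h1 : s + t ≠ 0 := fun h1 => h0 (h.hw_left.eq_zero_of_row (r := 0)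
    (fun _ => hrow 0 (Nat.zero_le _)) s t h1)
  have h2 : ¬ 1 < s + t := by
    intro h2
    obtain ⟨k, hk, hα⟩ := h.hw_left.exists_coeff
    rw [hα, hk _ (Or.inl h2), zero_mul] at h0
    exact h0 rfl
  have h3 : s + t = 1 := by omega
  refine ⟨h3, ?_⟩
  by_contra hb
  exact h0 (h.hw_left.eq_zero_of_row (r := 1) (fun _ => hrow 1 (by omega)) s t h3)

theorem exists_pair_one_zero (hx : x ≠ 0) (hd : 1 ≤ d) :
    ∃ β : ℕ → ℕ → F, IsPair 1 c 0 d 1 0 x y (hwv F 1 d 1) β := by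
  have h1 : hwv F c 0 0 0 0 ≠ 0 := hwv_ne_zero rfl
  refine ⟨fun s t => -(y * hwv F 1 d 1 1 0) / (x * hwv F c 0 0 0 0) * hwv F c 0 0 s t,
    isHW_hwv le_rfl hd, (isHW_hwv (Nat.zero_le _) le_rfl).smul _, fun s t hs ht => ?_⟩
  obtain rfl : t = 0 := by omega
  rcases Nat.eq_zero_or_pos s with h | h
  · subst h
    rw [hwv_of_ne (by omega : 0 + (0 - 0) ≠ 1)]; simp
  · obtain rfl : s = 1 := by omega
    simp only [Nat.choose_self, Nat.cast_one, mul_one, Nat.sub_self]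
    field_simp
    ring

theorem IsPair.eq_zero_one_top (h : IsPair 1 c b d 1 m x y α β) (hx : x ≠ 0) (hy : y ≠ 0)
    (hd : b = d + m) : (∀ s t, α s t = 0) ∧ ∀ s t, β s t = 0 := by
  have hα : ∀ s t, α s t = 0 := by
    intro s t
    refine h.hw_left.eq_zero_of_row (r := s + t) (fun hr => ?_) s t rfl
    have h3 := h.low 0 (s + t + m) (Nat.zero_le _) (by omega)
    rw [Nat.choose_eq_zero_of_lt one_pos, Nat.cast_zero, mul_zero, zero_mul, zero_add,
      Nat.add_sub_cancel, mul_assoc] at h3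
    exact (mul_eq_zero.1 ((mul_eq_zero.1 h3).resolve_left hy)).resolve_left
      (choose_ne_zero' (by omega))
  exact ⟨hα, h.right_eq_zero hx le_rfl hα⟩

end pairs

/-! ### Coordinates on the tensor product of two socle decompositions -/

section tensor

set_option linter.unusedSectionVars false

variable {F : Type*} [Field F] {n : ℕ}

theorem SocleDecomposition.cf_sF {V : Type*} [AddCommGroup V] [Module F V]
    [LieRingModule (Gal F n) V] [LieModule F (Gal F n) V] {k : ℕ} {a : Fin k → ℕ}
    (D : SocleDecomposition F n V a) {i s : ℕ} (hs : s ≤ extSeq a i) (v : V) :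
    D.cf i s ⁅ofSL2 F n sF, v⁆ = (s : F) * D.cf i (s - 1) v := by
  rcases Nat.lt_or_ge i k with hi | hi
  · rw [extSeq_of_lt a hi] at hs
    rw [D.cf_of_lt hi, D.cf_of_lt hi, D.pr_lie, coef_sF _ hs]
  · simp [D.cf_of_ge hi]

variable {V W : Type*} [AddCommGroup V] [Module F V] [LieRingModule (Gal F n) V]
  [LieModule F (Gal F n) V] [AddCommGroup W] [Module F W] [LieRingModule (Gal F n) W]
  [LieModule F (Gal F n) W] {k l : ℕ} {a : Fin k → ℕ} {b : Fin l → ℕ}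
  (D : SocleDecomposition F n V a) (E : SocleDecomposition F n W b)

/-- The coordinate of a tensor with respect to the `s`-th basis vector of the `i`-th summand of the
first factor and the `t`-th basis vector of the `j`-th summand of the second one, extended by
zero. -/
noncomputable def tcf (i s j t : ℕ) : V ⊗[F] W →ₗ[F] F :=
  (LinearMap.mul' F F).comp (TensorProduct.map (D.cf i s) (E.cf j t))

theorem tcf_tmul (i s j t : ℕ) (v : V) (w : W) :
    tcf D E i s j t (v ⊗ₜ w) = D.cf i s v * E.cf j t w := by
  simp [tcf]

theorem tcf_of_cf_left_eq_zero {i s : ℕ} (h : D.cf i s = 0) (j t : ℕ) : tcf D E i s j t = 0 :=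
  TensorProduct.ext' fun v w => by rw [tcf_tmul, h]; simp

theorem tcf_of_cf_right_eq_zero {j t : ℕ} (h : E.cf j t = 0) (i s : ℕ) : tcf D E i s j t = 0 :=
  TensorProduct.ext' fun v w => by rw [tcf_tmul, h]; simp

theorem tcf_left (i : ℕ) {s : ℕ} (h : extSeq a i < s) (j t : ℕ) : tcf D E i s j t = 0 :=
  tcf_of_cf_left_eq_zero D E (D.cf_of_extSeq_lt h) j t

theorem tcf_right (i s j : ℕ) {t : ℕ} (h : extSeq b j < t) : tcf D E i s j t = 0 :=
  tcf_of_cf_right_eq_zero D E (E.cf_of_extSeq_lt h) i s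

theorem tcf_of_ge_left {i : ℕ} (h : k ≤ i) (s j t : ℕ) : tcf D E i s j t = 0 :=
  tcf_of_cf_left_eq_zero D E (D.cf_of_ge h s) j t

theorem tcf_of_ge_right {j : ℕ} (h : l ≤ j) (i s t : ℕ) : tcf D E i s j t = 0 :=
  tcf_of_cf_right_eq_zero D E (E.cf_of_ge h t) i s

/-- By the Leibniz rule, pure tensors suffice. -/
theorem tcf_lie (i s j t : ℕ) (X : Gal F n) (f g : V ⊗[F] W →ₗ[F] F)
    (h : ∀ v w, D.cf i s ⁅X, v⁆ * E.cf j t w + D.cf i s v * E.cf j t ⁅X, w⁆ =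
      f (v ⊗ₜ w) + g (v ⊗ₜ w)) (q : V ⊗[F] W) :
    tcf D E i s j t ⁅X, q⁆ = f q + g q := by
  induction q using TensorProduct.induction_on with
  | zero => simp
  | tmul v w =>
    rw [TensorProduct.LieModule.lie_tmul_right, map_add, tcf_tmul, tcf_tmul, h]
  | add x y hx hy => rw [lie_add, map_add, hx, hy, map_add, map_add]; ring

theorem tcf_sE (i s j t : ℕ) (q : V ⊗[F] W) : tcf D E i s j t ⁅ofSL2 F n sE, q⁆ =
    ((extSeq a i : F) - s) * tcf D E i (s + 1) j t q
      + ((extSeq b j : F) - t) * tcf D E i s j (t + 1) q :=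
  tcf_lie D E i s j t _ (((extSeq a i : F) - s) • tcf D E i (s + 1) j t)
    (((extSeq b j : F) - t) • tcf D E i s j (t + 1)) (fun v w => by
      rw [D.cf_sE, E.cf_sE]
      simp only [LinearMap.smul_apply, tcf_tmul, smul_eq_mul]; ring) q

theorem tcf_sH (i s j t : ℕ) (q : V ⊗[F] W) : tcf D E i s j t ⁅ofSL2 F n sH, q⁆ =
    ((extSeq a i : F) + extSeq b j - 2 * (s + t)) * tcf D E i s j t q := by
  rw [tcf_lie D E i s j t _ (((extSeq a i : F) + extSeq b j - 2 * (s + t)) • tcf D E i s j t) 0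
    (fun v w => by
      rw [D.cf_sH, E.cf_sH]
      simp only [LinearMap.smul_apply, tcf_tmul, smul_eq_mul, LinearMap.zero_apply]; ring) q]
  simp

theorem tcf_sF {i s j t : ℕ} (hs : s ≤ extSeq a i) (ht : t ≤ extSeq b j) (q : V ⊗[F] W) :
    tcf D E i s j t ⁅ofSL2 F n sF, q⁆ =
      (s : F) * tcf D E i (s - 1) j t q + (t : F) * tcf D E i s j (t - 1) q :=
  tcf_lie D E i s j t _ ((s : F) • tcf D E i (s - 1) j t)
    ((t : F) • tcf D E i s j (t - 1)) (fun v w => by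
      rw [D.cf_sF hs, E.cf_sF ht]
      simp only [LinearMap.smul_apply, tcf_tmul, smul_eq_mul]; ring) q

variable {D E} in
theorem tcf_low {x y : ℕ → F} {κ κ' : ℕ → ℕ} (hD : D.ChainData x κ) (hE : E.ChainData y κ')
    {i s j t : ℕ} (hs : s ≤ extSeq a i) (ht : t ≤ extSeq b j) (q : V ⊗[F] W) :
    tcf D E i s j t ⁅galV n (bv F (2 * n - 1) (2 * n - 1)), q⁆ =
      x i * (s.choose (κ i) : F) * tcf D E (i + 1) (s - κ i) j t q
        + y j * (t.choose (κ' j) : F) * tcf D E i s (j + 1) (t - κ' j) q :=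
  tcf_lie D E i s j t _ ((x i * (s.choose (κ i) : F)) • tcf D E (i + 1) (s - κ i) j t)
    ((y j * (t.choose (κ' j) : F)) • tcf D E i s (j + 1) (t - κ' j)) (fun v w => by
      rw [hD.low i s v hs, hE.low j t w ht]
      simp only [LinearMap.smul_apply, tcf_tmul, smul_eq_mul]; ring) q

/-- The basis of weight vectors of the tensor product. -/
noncomputable def tbasis : Module.Basis ((Σ i : Fin k, Fin (a i + 1)) × (Σ j : Fin l, Fin (b j + 1)))
    F (V ⊗[F] W) := D.basis.tensorProduct E.basis

theorem tcf_eq_repr (p : (Σ i : Fin k, Fin (a i + 1)) × (Σ j : Fin l, Fin (b j + 1)))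
    (q : V ⊗[F] W) : tcf D E p.1.1.1 p.1.2.1 p.2.1.1 p.2.2.1 q = (tbasis D E).repr q p := by
  induction q using TensorProduct.induction_on with
  | zero => simp
  | tmul v w =>
    rw [tcf_tmul, tbasis, Module.Basis.tensorProduct_repr_tmul_apply, D.cf_basis, E.cf_basis,
      smul_eq_mul, mul_comm]
  | add x y hx hy => rw [map_add, hx, hy, map_add]; rfl

theorem ext_tcf {q q' : V ⊗[F] W}
    (h : ∀ i s j t, s ≤ extSeq a i → t ≤ extSeq b j → tcf D E i s j t q = tcf D E i s j t q') :
    q = q' := by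
  refine (tbasis D E).ext_elem fun p => ?_
  rw [← tcf_eq_repr, ← tcf_eq_repr]
  refine h _ _ _ _ ?_ ?_
  · rw [extSeq_coe]; omega
  · rw [extSeq_coe]; omega

theorem finiteDimensional_tensor (D : SocleDecomposition F n V a) (E : SocleDecomposition F n W b) :
    FiniteDimensional F (V ⊗[F] W) :=
  (tbasis D E).finiteDimensional_of_finite

/-- The tensor with given coordinates. -/
noncomputable def ofCoord (f : ℕ → ℕ → ℕ → ℕ → F) : V ⊗[F] W :=
  (tbasis D E).equivFun.symm fun p => f p.1.1.1 p.1.2.1 p.2.1.1 p.2.2.1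

theorem tcf_ofCoord (f : ℕ → ℕ → ℕ → ℕ → F) {i s j t : ℕ} (hi : i < k) (hs : s ≤ extSeq a i)
    (hj : j < l) (ht : t ≤ extSeq b j) : tcf D E i s j t (ofCoord D E f) = f i s j t := by
  rw [extSeq_of_lt a hi] at hs
  rw [extSeq_of_lt b hj] at ht
  rw [tcf_eq_repr D E (⟨⟨i, hi⟩, ⟨s, Nat.lt_succ_of_le hs⟩⟩, ⟨⟨j, hj⟩, ⟨t, Nat.lt_succ_of_le ht⟩⟩),
    ofCoord, ← Module.Basis.equivFun_apply, LinearEquiv.apply_symm_apply]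

/-- The component of degree `r`. -/
noncomputable def degProj (r : ℕ) (q : V ⊗[F] W) : V ⊗[F] W :=
  ofCoord D E fun i s j t => if i + j = r then tcf D E i s j t q else 0

theorem tcf_degProj (r i s j t : ℕ) (q : V ⊗[F] W) :
    tcf D E i s j t (degProj D E r q) = if i + j = r then tcf D E i s j t q else 0 := by
  have key : tcf D E i s j t = 0 → tcf D E i s j t (degProj D E r q) =
      if i + j = r then tcf D E i s j t q else 0 := fun h => by simp [h]
  rcases Nat.lt_or_ge i k with hi | hi
  · rcases Nat.lt_or_ge j l with hj | hj
    · rcases Nat.lt_or_ge (extSeq a i) s with hs | hs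
      · exact key (tcf_left D E i hs j t)
      · rcases Nat.lt_or_ge (extSeq b j) t with ht | ht
        · exact key (tcf_right D E i s j ht)
        · exact tcf_ofCoord D E _ hi hs hj ht
    · exact key (tcf_of_ge_right D E hj i s t)
  · exact key (tcf_of_ge_left D E hi s j t)

theorem sum_degProj (q : V ⊗[F] W) : ∑ r ∈ Finset.range (k + l), degProj D E r q = q := by
  refine ext_tcf D E fun i s j t _ _ => ?_
  simp only [map_sum, tcf_degProj]
  rw [Finset.sum_ite_eq (Finset.range (k + l)) (i + j)]
  split_ifs with h
  · rfl
  · rw [Finset.mem_range] at h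
    rcases Nat.lt_or_ge i k with hi | hi
    · rw [tcf_of_ge_right D E (by omega)]; rfl
    · rw [tcf_of_ge_left D E hi]; rfl

theorem mem_degree (r : ℕ) (q : V ⊗[F] W) :
    q ∈ (⨆ i : Fin k, ⨆ j : Fin l, ⨆ _ : i.1 + j.1 = r, tensorSub (D.part i) (E.part j)) ↔
      ∀ i s j t, i + j ≠ r → tcf D E i s j t q = 0 := by
  constructor
  · intro hq i s j t hij
    have : (⨆ i : Fin k, ⨆ j : Fin l, ⨆ _ : i.1 + j.1 = r, tensorSub (D.part i) (E.part j)) ≤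
        LinearMap.ker (tcf D E i s j t) := by
      refine iSup_le fun i' => iSup_le fun j' => iSup_le fun h => Submodule.map₂_le.2 ?_
      intro v hv w hw
      rw [LinearMap.mem_ker, TensorProduct.mk_apply, tcf_tmul]
      by_cases hi : i = i'.1
      · have hj : j ≠ j'.1 := by omega
        rcases Nat.lt_or_ge j l with hj' | hj'
        · rw [E.cf_of_lt hj', E.pr_eq_zero_of_mem (fun h => hj (congrArg Fin.val h)) hw, coef_zero,
            mul_zero]
        · rw [E.cf_of_ge hj', LinearMap.zero_apply, mul_zero]
      · rcases Nat.lt_or_ge i k with hi' | hi'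
        · rw [D.cf_of_lt hi', D.pr_eq_zero_of_mem (fun h => hi (congrArg Fin.val h)) hv, coef_zero,
            zero_mul]
        · rw [D.cf_of_ge hi', LinearMap.zero_apply, zero_mul]
    exact this hq
  · intro h
    rw [← (tbasis D E).sum_repr q]
    refine Submodule.sum_mem _ fun p _ => ?_
    rw [← tcf_eq_repr]
    by_cases hp : p.1.1.1 + p.2.1.1 = r
    · refine Submodule.smul_mem _ _ (Submodule.mem_iSup_of_mem p.1.1 (Submodule.mem_iSup_of_mem p.2.1
        (Submodule.mem_iSup_of_mem hp ?_)))
      rw [tbasis, Module.Basis.tensorProduct_apply, D.basis_apply, E.basis_apply]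
      exact Submodule.apply_mem_map₂ _ (D.emb_mem _ _) (E.emb_mem _ _)
    · rw [h _ _ _ _ hp, zero_smul]
      exact Submodule.zero_mem _

theorem mem_socPart {r : ℕ} {q : V ⊗[F] W} : q ∈ socPart n D E r ↔
    (∀ i s j t, i + j ≠ r → tcf D E i s j t q = 0) ∧ q ∈ heisInvariants (F := F) n (V ⊗[F] W) := by
  rw [socPart, Submodule.mem_inf, mem_degree]

theorem socPart_le : ∀ r, socPart n D E r ≤ heisInvariants (F := F) n (V ⊗[F] W) := fun _ => inf_le_right

/-- `sl(2)` preserves each V(a_i) ⊗ V(b_j), and `h_n` acts by zero on the invariants. -/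
theorem lie_mem_socPart {r : ℕ} (X : Gal F n) {q : V ⊗[F] W} (hq : q ∈ socPart n D E r) :
    ⁅X, q⁆ ∈ socPart n D E r := by
  refine Submodule.mem_inf.2 ⟨?_, heisInvariants_lie hq.2 X⟩
  rw [gal_eq X, add_lie, hq.2 X.left, zero_add]
  refine lie_ofSL2_mem (fun u hu => ?_) (fun u hu => ?_) _ hq.1
  · rw [mem_degree] at hu ⊢
    intro i s j t h
    rw [tcf_sE, hu i _ j _ h, hu i _ j _ h, mul_zero, mul_zero, add_zero]
  · rw [mem_degree] at hu ⊢
    intro i s j t h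
    rcases Nat.lt_or_ge (extSeq a i) s with hs | hs
    · rw [tcf_left D E i hs]; rfl
    rcases Nat.lt_or_ge (extSeq b j) t with ht | ht
    · rw [tcf_right D E i s j ht]; rfl
    rw [tcf_sF D E hs ht, hu i _ j _ h, hu i _ j _ h, mul_zero, mul_zero, add_zero]

theorem disjoint_socPart {r r' : ℕ} (h : r ≠ r') :
    Disjoint (socPart n D E r) (socPart n D E r') := by
  rw [Submodule.disjoint_def]
  intro q hq hq'
  refine ext_tcf D E fun i s j t _ _ => ?_
  rw [map_zero]
  by_cases hij : i + j = r
  · exact ((mem_socPart D E).1 hq').1 i s j t (by omega)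
  · exact ((mem_socPart D E).1 hq).1 i s j t hij

/-- `e` acts nilpotently. -/
theorem exists_iterate_sE_eq_zero (D : SocleDecomposition F n V a)
    (E : SocleDecomposition F n W b) (q : V ⊗[F] W) :
    ∃ N, (fun v : V ⊗[F] W => ⁅ofSL2 F n sE, v⁆)^[N] q = 0 := by
  set B := ∑ i, a i + ∑ j, b j with hB
  have hbound : ∀ i s j t, B < s + t → tcf D E i s j t = 0 := by
    intro i s j t h
    rcases Nat.lt_or_ge i k with hi | hi
    · rcases Nat.lt_or_ge j l with hj | hj
      · have h1 : a ⟨i, hi⟩ ≤ ∑ i, a i := Finset.single_le_sum (fun _ _ => Nat.zero_le _)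
          (Finset.mem_univ _)
        have h2 : b ⟨j, hj⟩ ≤ ∑ j, b j := Finset.single_le_sum (fun _ _ => Nat.zero_le _)
          (Finset.mem_univ _)
        rcases Nat.lt_or_ge (extSeq a i) s with hs | hs
        · exact tcf_left D E i hs j t
        · rw [extSeq_of_lt a hi] at hs
          refine tcf_right D E i s j ?_
          rw [extSeq_of_lt b hj]; omega
      · exact tcf_of_ge_right D E hj i s t
    · exact tcf_of_ge_left D E hi s j t
  have key : ∀ N i s j t, B < s + t + N →
      tcf D E i s j t ((fun v : V ⊗[F] W => ⁅ofSL2 F n sE, v⁆)^[N] q) = 0 := by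
    intro N
    induction N with
    | zero => intro i s j t h; rw [hbound i s j t h]; rfl
    | succ N ih =>
      intro i s j t h
      rw [Function.iterate_succ_apply', tcf_sE, ih _ _ _ _ (by omega), ih _ _ _ _ (by omega),
        mul_zero, mul_zero, add_zero]
  refine ⟨B + 1, ext_tcf D E fun i s j t _ _ => ?_⟩
  rw [key _ _ _ _ _ (by omega), map_zero]

/-- By nilpotency of e, a non-zero e-stable space contains a non-zero vector killed by e. This
reduces the vanishing of S_r to highest weight vectors. -/
theorem eq_bot_of_killed (D : SocleDecomposition F n V a) (E : SocleDecomposition F n W b)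
    {S : Submodule F (V ⊗[F] W)} (hS : ∀ u ∈ S, ⁅ofSL2 F n sE, u⁆ ∈ S)
    (h : ∀ u ∈ S, ⁅ofSL2 F n sE, u⁆ = 0 → u = 0) : S = ⊥ := by
  rw [Submodule.eq_bot_iff]
  intro q hq
  by_contra h0
  obtain ⟨N, hN⟩ := exists_iterate_sE_eq_zero D E q
  obtain ⟨k, h1, h2⟩ := exists_iterate_killed _ h0 hN
  refine h1 (h _ ?_ h2)
  clear h1 h2
  induction k with
  | zero => exact hq
  | succ k ih => rw [Function.iterate_succ_apply']; exact hS _ ih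

theorem isHW_tcf {q : V ⊗[F] W} (hq : ⁅ofSL2 F n sE, q⁆ = 0) (i j : ℕ) :
    IsHW (extSeq a i) (extSeq b j) fun s t => tcf D E i s j t q where
  left s t h := by rw [tcf_left D E i h]; rfl
  right s t h := by rw [tcf_right D E i s j h]; rfl
  lie s t := by rw [← tcf_sE, hq, map_zero]

variable {D E}
variable {x y : ℕ → F} {κ κ' : ℕ → ℕ}

/-- The component (i, j) of v_m q receives contributions from (i + 1, j) and (i, j + 1) only, so
invariance splits into one relation between two arrays for each (i, j). -/
theorem isPair_tcf (hD : D.ChainData x κ) (hE : E.ChainData y κ') {q : V ⊗[F] W}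
    (hq : ⁅ofSL2 F n sE, q⁆ = 0) (hq' : q ∈ heisInvariants (F := F) n (V ⊗[F] W)) (i j : ℕ) :
    IsPair (extSeq a i) (extSeq a (i + 1)) (extSeq b j) (extSeq b (j + 1)) (κ i) (κ' j) (x i) (y j)
      (fun s t => tcf D E i s (j + 1) t q) (fun s t => tcf D E (i + 1) s j t q) where
  hw_left := isHW_tcf D E hq i (j + 1)
  hw_right := isHW_tcf D E hq (i + 1) j
  low s t hs ht := by rw [← tcf_low hD hE hs ht, lie_galV_eq_zero hq', map_zero]

variable [CharZero F]

theorem low_eq_zero_of_tcf (hD : D.ChainData x κ) (hE : E.ChainData y κ') {q : V ⊗[F] W}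
    (h : ∀ i s j t, s ≤ extSeq a i → t ≤ extSeq b j →
      x i * (s.choose (κ i) : F) * tcf D E (i + 1) (s - κ i) j t q
        + y j * (t.choose (κ' j) : F) * tcf D E i s (j + 1) (t - κ' j) q = 0) :
    ⁅galV n (bv F (2 * n - 1) (2 * n - 1)), q⁆ = 0 :=
  ext_tcf D E fun i s j t hs ht => by rw [tcf_low hD hE hs ht, h i s j t hs ht, map_zero]

/-- v_m lowers the degree by exactly one, so no cancellation between homogeneous components is
possible. -/
theorem degProj_mem_socPart (hn : 1 ≤ n) (hD : D.ChainData x κ) (hE : E.ChainData y κ')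
    {q : V ⊗[F] W} (hq : q ∈ heisInvariants (F := F) n (V ⊗[F] W)) (r : ℕ) :
    degProj D E r q ∈ socPart n D E r := by
  refine (mem_socPart D E).2 ⟨fun i s j t h => by rw [tcf_degProj, if_neg h], ?_⟩
  refine mem_heisInvariants_of_low hn
    {u | ∃ q ∈ heisInvariants (F := F) n (V ⊗[F] W), u = degProj D E r q} ?_ ?_ ⟨q, hq, rfl⟩
  · rintro _ ⟨q, hq, rfl⟩
    refine ⟨⁅ofSL2 F n sE, q⁆, heisInvariants_lie hq _, ext_tcf D E fun i s j t _ _ => ?_⟩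
    simp only [tcf_sE, tcf_degProj]
    split_ifs <;> simp
  · rintro _ ⟨q, hq, rfl⟩
    refine low_eq_zero_of_tcf hD hE fun i s j t hs ht => ?_
    rw [tcf_degProj, tcf_degProj]
    by_cases h : i + j + 1 = r
    · rw [if_pos (by omega), if_pos (by omega), ← tcf_low hD hE hs ht, lie_galV_eq_zero hq, map_zero]
    · rw [if_neg (by omega), if_neg (by omega), mul_zero, mul_zero, add_zero]

/-- Every non-zero submodule contains non-zero `h_n`-invariants. -/
theorem exists_invariant_mem (hn : 1 ≤ n) (hD : D.ChainData x κ) (hE : E.ChainData y κ')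
    {N : LieSubmodule F (Gal F n) (V ⊗[F] W)} (hN : N ≠ ⊥) :
    ∃ q ∈ N, q ≠ 0 ∧ q ∈ heisInvariants (F := F) n (V ⊗[F] W) := by
  classical
  -- Choose the least degree bound r admitting a non-zero vector of `N`. Since v_m lowers the bound,
  -- it kills every vector of `N` within this bound.
  have hex : ∃ r, ∃ q ∈ N, q ≠ 0 ∧ ∀ i s j t, r ≤ i + j → tcf D E i s j t q = 0 := by
    obtain ⟨q, hq, hq0⟩ := (Submodule.ne_bot_iff _).1
      (fun h => hN ((LieSubmodule.toSubmodule_eq_bot N).1 h))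
    refine ⟨k + l, q, hq, hq0, fun i s j t h => ?_⟩
    rcases Nat.lt_or_ge i k with hi | hi
    · rw [tcf_of_ge_right D E (by omega)]; rfl
    · rw [tcf_of_ge_left D E hi]; rfl
  obtain ⟨q, hq, hq0, hqr⟩ := Nat.find_spec hex
  set r := Nat.find hex
  refine ⟨q, hq, hq0, mem_heisInvariants_of_low hn
    {u | u ∈ N ∧ ∀ i s j t, r ≤ i + j → tcf D E i s j t u = 0} ?_ ?_ ⟨hq, hqr⟩⟩
  · rintro u ⟨hu, hur⟩
    refine ⟨N.lie_mem hu, fun i s j t h => ?_⟩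
    rw [tcf_sE, hur _ _ _ _ h, hur _ _ _ _ h, mul_zero, mul_zero, add_zero]
  · rintro u ⟨hu, hur⟩
    by_contra h0
    rcases Nat.eq_zero_or_pos r with hr | hr
    · refine h0 ?_
      rw [show u = 0 from ext_tcf D E fun i s j t _ _ => by
        rw [hur _ _ _ _ (by omega), map_zero], lie_zero]
    · refine Nat.find_min hex (m := r - 1) (by omega) ⟨_, N.lie_mem hu, h0, fun i s j t h => ?_⟩
      rcases Nat.lt_or_ge (extSeq a i) s with hs | hs
      · rw [tcf_left D E i hs]; rfl
      rcases Nat.lt_or_ge (extSeq b j) t with ht | ht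
      · rw [tcf_right D E i s j ht]; rfl
      rw [tcf_low hD hE hs ht, hur _ _ _ _ (by omega), hur _ _ _ _ (by omega), mul_zero, mul_zero,
        add_zero]

/-- The invariants form a submodule meeting every irreducible submodule, hence containing it. -/
theorem socle_le_heisInvariants (hn : 1 ≤ n) (hD : D.ChainData x κ) (hE : E.ChainData y κ') :
    (socle F (Gal F n) (V ⊗[F] W)).toSubmodule ≤ heisInvariants (F := F) n (V ⊗[F] W) := by
  have : socle F (Gal F n) (V ⊗[F] W) ≤ heisInvariantsLie F n (V ⊗[F] W) := by
    refine sSup_le fun N hN => ?_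
    have hN' : LieModule.IsIrreducible F (Gal F n) N := hN
    have hnt : Nontrivial N := LieModule.nontrivial_of_isIrreducible F (Gal F n) N
    obtain ⟨q, hq, hq0, hqi⟩ := exists_invariant_mem hn hD hE
      ((LieSubmodule.nontrivial_iff_ne_bot F (Gal F n) _).1 hnt)
    have h1 := (hN'.eq_bot_or_eq_top ((heisInvariantsLie F n (V ⊗[F] W)).comap N.incl)).resolve_left
      (fun h => by
        have : (⟨q, hq⟩ : N) ∈ (heisInvariantsLie F n (V ⊗[F] W)).comap N.incl := hqi
        rw [h, LieSubmodule.mem_bot] at this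
        exact hq0 (congrArg Subtype.val this))
    intro u hu
    have : (⟨u, hu⟩ : N) ∈ (heisInvariantsLie F n (V ⊗[F] W)).comap N.incl := by rw [h1]; trivial
    exact this
  exact this

end tensor

/-! ### The `sl(2)`-structure of S_0 and S_1. -/

section parts

set_option linter.unusedSectionVars false

variable {F : Type*} [Field F] {n : ℕ} {V W : Type*} [AddCommGroup V] [Module F V]
  [LieRingModule (Gal F n) V] [LieModule F (Gal F n) V] [AddCommGroup W] [Module F W]
  [LieRingModule (Gal F n) W] [LieModule F (Gal F n) W] {k l : ℕ} {a : Fin k → ℕ} {b : Fin l → ℕ}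
  {D : SocleDecomposition F n V a} {E : SocleDecomposition F n W b}

theorem tcf_ofCoord_of_support {f : ℕ → ℕ → ℕ → ℕ → F}
    (hf : ∀ i s j t, k ≤ i ∨ extSeq a i < s ∨ l ≤ j ∨ extSeq b j < t → f i s j t = 0)
    (i s j t : ℕ) : tcf D E i s j t (ofCoord D E f) = f i s j t := by
  by_cases h : k ≤ i ∨ extSeq a i < s ∨ l ≤ j ∨ extSeq b j < t
  · rw [hf i s j t h]
    rcases h with h | h | h | h
    · rw [tcf_of_ge_left D E h]; rfl
    · rw [tcf_left D E i h]; rfl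
    · rw [tcf_of_ge_right D E h]; rfl
    · rw [tcf_right D E i s j h]; rfl
  · push Not at h
    exact tcf_ofCoord D E f h.1 h.2.1 h.2.2.1 h.2.2.2

variable [CharZero F]

/-- A non-zero vector killed by `e`, determined up to a scalar, spans a copy of `V(μ)`. -/
theorem sl2Iso_socPart {r : ℕ} {p : V ⊗[F] W} {μ : ℕ} (hp0 : p ≠ 0) (hp : p ∈ socPart n D E r)
    (hE : ⁅ofSL2 F n sE, p⁆ = 0) (hH : ⁅ofSL2 F n sH, p⁆ = (μ : F) • p)
    (hker : ∀ u ∈ socPart n D E r, ⁅ofSL2 F n sE, u⁆ = 0 → ∃ t : F, u = t • p) :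
    Sl2Iso n (socPart n D E r) (Irr F μ) :=
  have := finiteDimensional_tensor D E
  sl2Iso_of_primitive ⟨hp0, hH, hE⟩ (fun X _ hu => lie_mem_socPart D E X hu) (socPart_le D E r)
    (fun u _ => exists_iterate_sE_eq_zero D E u) hp hker

theorem le_socle_of_sl2Iso {M : Type*} [AddCommGroup M] [Module F M] [LieRingModule (Gal F n) M]
    [LieModule F (Gal F n) M] {S : Submodule F M} (hS : S ≤ heisInvariants (F := F) n M) {μ : ℕ}
    (h : Sl2Iso n S (Irr F μ)) : S ≤ (socle F (Gal F n) M).toSubmodule := by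
  obtain ⟨φ, hinj, rfl, hφ⟩ := h
  exact range_le_socle φ hφ (fun c => hS ⟨c, rfl⟩) hinj

theorem le_socle_of_sl2Iso_directSum {M : Type*} [AddCommGroup M] [Module F M]
    [LieRingModule (Gal F n) M] [LieModule F (Gal F n) M] {S : Submodule F M}
    (hS : S ≤ heisInvariants (F := F) n M) {ι : Type*} [DecidableEq ι] {μ : ι → ℕ}
    (h : Sl2Iso n S (⨁ i, Irr F (μ i))) : S ≤ (socle F (Gal F n) M).toSubmodule := by
  obtain ⟨φ, hinj, rfl, hφ⟩ := h
  rintro _ ⟨w, rfl⟩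
  induction w using DirectSum.induction_on with
  | zero => rw [map_zero]; exact Submodule.zero_mem _
  | add x y hx hy => rw [map_add]; exact Submodule.add_mem _ hx hy
  | of i x =>
    refine range_le_socle (φ.comp (DirectSum.lof F ι (fun i => Irr F (μ i)) i)) (fun A c => ?_)
      (fun c => hS ⟨_, rfl⟩) ?_ ⟨x, rfl⟩
    · rw [LinearMap.comp_apply, LinearMap.comp_apply, ← hφ]
      congr 1
      exact (DirectSum.lieModuleOf F ι (SL2 F) (fun i => Irr F (μ i)) i).map_lie A c
    · rw [LinearMap.coe_comp]
      exact hinj.comp (DirectSum.of_injective (β := fun i => Irr F (μ i)) i)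

/-! ### The part of degree zero -/

section zero

variable {x y : ℕ → F} {κ κ' : ℕ → ℕ} {A B : ℕ}

/-- There is nothing below degree zero, so invariance is automatic. -/
theorem mem_socPart_zero (hn : 1 ≤ n) (hD : D.ChainData x κ) (hE : E.ChainData y κ')
    {q : V ⊗[F] W} :
    q ∈ socPart n D E 0 ↔ ∀ i s j t, i + j ≠ 0 → tcf D E i s j t q = 0 := by
  rw [mem_socPart]
  refine ⟨fun h => h.1, fun h => ⟨h, ?_⟩⟩
  refine mem_heisInvariants_of_low hn {u | ∀ i s j t, i + j ≠ 0 → tcf D E i s j t u = 0}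
    (fun u hu i s j t hij => ?_) (fun u hu => low_eq_zero_of_tcf hD hE fun i s j t _ _ => ?_) h
  · rw [tcf_sE, hu _ _ _ _ hij, hu _ _ _ _ hij, mul_zero, mul_zero, add_zero]
  · rw [hu _ _ _ _ (by omega), hu _ _ _ _ (by omega), mul_zero, mul_zero, add_zero]

theorem socPart_zero_eq (hn : 1 ≤ n) (hD : D.ChainData x κ) (hE : E.ChainData y κ') (hk : 0 < k)
    (hl : 0 < l) : socPart n D E 0 = tensorSub (D.part ⟨0, hk⟩) (E.part ⟨0, hl⟩) := by
  apply le_antisymm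
  · refine inf_le_left.trans (iSup_le fun i => iSup_le fun j => iSup_le fun h => ?_)
    obtain rfl : i = ⟨0, hk⟩ := Fin.ext (by change i.1 = 0; omega)
    obtain rfl : j = ⟨0, hl⟩ := Fin.ext (by change j.1 = 0; omega)
    exact le_rfl
  · intro q hq
    refine (mem_socPart_zero hn hD hE).2 ((mem_degree D E 0 q).1 ?_)
    exact Submodule.mem_iSup_of_mem ⟨0, hk⟩ (Submodule.mem_iSup_of_mem ⟨0, hl⟩
      (Submodule.mem_iSup_of_mem rfl hq))

theorem sum_clebschGordan (A B : ℕ) :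
    ∑ r : Fin (min A B + 1), (A + B - 2 * r.1 + 1) = (A + 1) * (B + 1) := by
  -- The first c + 1 terms fall short of the product by (A - c)(B - c), which vanishes at c = min A
  -- B.
  have key : ∀ c A B : ℕ, c ≤ A → c ≤ B →
      ∑ r ∈ Finset.range (c + 1), (A + B - 2 * r + 1) + (A - c) * (B - c) = (A + 1) * (B + 1) := by
    intro c
    induction c with
    | zero => intro A B _ _; simp; ring
    | succ c ih =>
      intro A B hA hB
      rw [Finset.sum_range_succ, ← ih A B (by omega) (by omega)]
      obtain ⟨u, rfl⟩ : ∃ u, A = c + 1 + u := ⟨A - (c + 1), by omega⟩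
      obtain ⟨v, rfl⟩ : ∃ v, B = c + 1 + v := ⟨B - (c + 1), by omega⟩
      rw [show c + 1 + u - (c + 1) = u by omega, show c + 1 + v - (c + 1) = v by omega,
        show c + 1 + u - c = u + 1 by omega, show c + 1 + v - c = v + 1 by omega,
        show c + 1 + u + (c + 1 + v) - 2 * (c + 1) = u + v by omega]
      ring
  rw [Fin.sum_univ_eq_sum_range (fun r => A + B - 2 * r + 1)]
  have := key (min A B) A B (min_le_left _ _) (min_le_right _ _)
  rcases le_total A B with h | h
  · rw [min_eq_left h] at this ⊢; simpa using this
  · rw [min_eq_right h] at this ⊢; simpa using this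

/-- The highest weight vectors of `S_0`. -/
noncomputable def hwv₀ (D : SocleDecomposition F n V a) (E : SocleDecomposition F n W b)
    (r : ℕ) : V ⊗[F] W :=
  ofCoord D E fun i s j t => if i = 0 ∧ j = 0 then hwv F (extSeq a 0) (extSeq b 0) r s t else 0

theorem tcf_hwv₀ (hk : 0 < k) (hl : 0 < l) {r : ℕ} (ha : r ≤ extSeq a 0) (hb : r ≤ extSeq b 0)
    (i s j t : ℕ) : tcf D E i s j t (hwv₀ D E r) =
      if i = 0 ∧ j = 0 then hwv F (extSeq a 0) (extSeq b 0) r s t else 0 := by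
  refine tcf_ofCoord_of_support (fun i s j t h => ?_) i s j t
  split_ifs with h0
  · obtain ⟨rfl, rfl⟩ := h0
    exact hwv_of_ne (by omega)
  · rfl

theorem hasPrimitiveVectorWith_hwv₀ (hk : 0 < k) (hl : 0 < l) {r : ℕ} (ha : r ≤ extSeq a 0)
    (hb : r ≤ extSeq b 0) : (isSl2Triple F n).HasPrimitiveVectorWith (hwv₀ D E r)
      ((extSeq a 0 + extSeq b 0 - 2 * r : ℕ) : F) where
  ne_zero h := by
    have h1 := tcf_hwv₀ (D := D) (E := E) hk hl ha hb 0 0 0 r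
    rw [h, map_zero, if_pos ⟨rfl, rfl⟩] at h1
    exact hwv_ne_zero (zero_add r) h1.symm
  lie_h := by
    refine ext_tcf D E fun i s j t _ _ => ?_
    rw [tcf_sH, map_smul, tcf_hwv₀ hk hl ha hb, smul_eq_mul]
    split_ifs with h0
    · obtain ⟨rfl, rfl⟩ := h0
      by_cases hr : s + t = r
      · subst hr
        rw [Nat.cast_sub (by omega)]
        push_cast; ring
      · rw [hwv_of_ne hr, mul_zero, mul_zero]
    · rw [mul_zero, mul_zero]
  lie_e := by
    refine ext_tcf D E fun i s j t _ _ => ?_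
    rw [tcf_sE, tcf_hwv₀ hk hl ha hb, tcf_hwv₀ hk hl ha hb, map_zero]
    split_ifs with h0
    · obtain ⟨rfl, rfl⟩ := h0
      exact (isHW_hwv ha hb).lie s t
    · rw [mul_zero, mul_zero, add_zero]

theorem finrank_irr (F : Type*) [Field F] (a : ℕ) : Module.finrank F (Irr F a) = a + 1 :=
  (Module.finrank_eq_card_basis (irrBasis F a)).trans (Fintype.card_fin _)

instance (a : ℕ) : FiniteDimensional F (Irr F a) := (irrBasis F a).finiteDimensional_of_finite

theorem finrank_tensorSub_le (D : SocleDecomposition F n V a) (E : SocleDecomposition F n W b)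
    (i : Fin k) (j : Fin l) :
    Module.finrank F (tensorSub (D.part i) (E.part j)) ≤ (a i + 1) * (b j + 1) := by
  have h : tensorSub (D.part i) (E.part j) ≤
      LinearMap.range (TensorProduct.map (D.emb i) (E.emb j)) := by
    refine Submodule.map₂_le.2 fun v hv w hw => ?_
    rw [← D.range_emb] at hv
    rw [← E.range_emb] at hw
    obtain ⟨v, rfl⟩ := hv
    obtain ⟨w, rfl⟩ := hw
    exact ⟨v ⊗ₜ w, TensorProduct.map_tmul _ _ _ _⟩
  refine (Submodule.finrank_mono h).trans ((LinearMap.finrank_range_le _).trans ?_)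
  rw [Module.finrank_tensorProduct, finrank_irr, finrank_irr]

/-- The Clebsch-Gordan decomposition of `S_0`. -/
theorem sl2Iso_socPart_zero (hn : 1 ≤ n) (hD : D.ChainData x κ) (hE : E.ChainData y κ')
    (hk : 0 < k) (hl : 0 < l) (hA : extSeq a 0 = A) (hB : extSeq b 0 = B) :
    Sl2Iso n (socPart n D E 0) (⨁ r : Fin (min A B + 1), Irr F (A + B - 2 * r.1)) := by
  have := finiteDimensional_tensor D E
  subst hA hB
  set A := extSeq a 0
  set B := extSeq b 0
  have hrA : ∀ r : Fin (min A B + 1), r.1 ≤ A := fun r => by have := r.2; omega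
  have hrB : ∀ r : Fin (min A B + 1), r.1 ≤ B := fun r => by have := r.2; omega
  have hprim := fun r : Fin (min A B + 1) =>
    hasPrimitiveVectorWith_hwv₀ (D := D) (E := E) hk hl (hrA r) (hrB r)
  have hmem : ∀ r : Fin (min A B + 1), hwv₀ D E r.1 ∈ socPart n D E 0 := fun r =>
    (mem_socPart_zero hn hD hE).2 fun i s j t h => by
      rw [tcf_hwv₀ hk hl (hrA r) (hrB r), if_neg (by omega)]
  let φ : ∀ r : Fin (min A B + 1), Irr F (A + B - 2 * r.1) →ₗ[F] V ⊗[F] W := fun r =>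
    stringMap F n (hwv₀ D E r.1) (A + B - 2 * r.1)
  let Φ : (⨁ r : Fin (min A B + 1), Irr F (A + B - 2 * r.1)) →ₗ[F] V ⊗[F] W :=
    DirectSum.toModule F _ _ φ
  have hΦof : ∀ r w, Φ (DirectSum.lof F _ (fun r : Fin (min A B + 1) => Irr F (A + B - 2 * r.1)) r w)
      = φ r w := fun r w =>
    DirectSum.toModule_lof (M := fun r : Fin (min A B + 1) => Irr F (A + B - 2 * r.1)) (φ := φ) F r w
  have hΦsum : ∀ w, Φ w = ∑ r, φ r (w r) := by
    intro w
    induction w using DirectSum.induction_on with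
    | zero => simp
    | add x y hx hy => rw [map_add, hx, hy, ← Finset.sum_add_distrib]; simp
    | of i x =>
      rw [Finset.sum_eq_single i]
      · rw [DirectSum.of_eq_same]; exact hΦof i x
      · intro j _ hj; rw [DirectSum.of_eq_of_ne _ _ _ hj, map_zero]
      · intro h; exact absurd (Finset.mem_univ _) h
  have hΦlie : ∀ (X : SL2 F) w, Φ ⁅X, w⁆ = ⁅ofSL2 F n X, Φ w⁆ := by
    intro X w
    rw [hΦsum, hΦsum, lie_sum]
    refine Finset.sum_congr rfl fun r _ => ?_
    rw [← stringMap_lie (hprim r)]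
    rfl
  -- A non-zero kernel would contain a non-zero combination of the highest weight vectors; these are
  -- supported on different antidiagonals, and the coordinate (0, r) isolates the r-th one.
  have hinj : Function.Injective Φ := by
    rw [← LinearMap.ker_eq_bot, Submodule.eq_bot_iff]
    intro w hw
    by_contra h0
    have hiter : ∀ (N : ℕ) (w : ⨁ r : Fin (min A B + 1), Irr F (A + B - 2 * r.1)) r,
        ((fun v => ⁅(sE : SL2 F), v⁆)^[N] w) r = (fun v => ⁅(sE : SL2 F), v⁆)^[N] (w r) := by
      intro N
      induction N with
      | zero => intro w r; rfl
      | succ N ih =>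
        intro w r
        rw [Function.iterate_succ_apply, Function.iterate_succ_apply, ih]
        rfl
    obtain ⟨N, h1, h2⟩ := exists_iterate_killed (fun v => ⁅(sE : SL2 F), v⁆) h0
      (N := A + B + 1) (by
        refine DFinsupp.ext fun r => ?_
        exact (hiter _ w r).trans (iterate_sE_eq_zero _ fun j hj => coef_of_lt (by omega)))
    have hker : ∀ N, Φ ((fun v => ⁅(sE : SL2 F), v⁆)^[N] w) = 0 := by
      intro N
      induction N with
      | zero => exact hw
      | succ N ih => rw [Function.iterate_succ_apply', hΦlie, ih, lie_zero]
    have hker := hker N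
    generalize (fun v => ⁅(sE : SL2 F), v⁆)^[N] w = w' at h1 h2 hker
    have hw' : ∀ r, w' r = coef (w' r) 0 • bv F (A + B - 2 * r.1) 0 := fun r =>
      eq_smul_bv_zero (congrArg (fun v : ⨁ r : Fin (min A B + 1), Irr F (A + B - 2 * r.1) => v r) h2)
    have hΦw' : ∀ r, φ r (w' r) = coef (w' r) 0 • hwv₀ D E r.1 := fun r => by
      conv_lhs => rw [hw' r, map_smul]
      rw [show φ r (bv F (A + B - 2 * r.1) 0) = hwv₀ D E r.1 from stringMap_bv_zero]
    refine h1 (DFinsupp.ext fun r => ?_)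
    change w' r = 0
    have h3 := congrArg (tcf D E 0 0 0 r.1) hker
    rw [hΦsum, map_sum, map_zero, Finset.sum_eq_single r] at h3
    · rw [hΦw', map_smul, tcf_hwv₀ hk hl (hrA r) (hrB r), if_pos ⟨rfl, rfl⟩, smul_eq_mul] at h3
      rw [hw' r, (mul_eq_zero.1 h3).resolve_right (hwv_ne_zero (zero_add _)), zero_smul]
    · intro s _ hs
      rw [hΦw', map_smul, tcf_hwv₀ hk hl (hrA s) (hrB s), if_pos ⟨rfl, rfl⟩, hwv_of_ne, smul_zero]
      exact fun h => hs (Fin.ext (by omega))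
    · intro h; exact absurd (Finset.mem_univ _) h
  refine ⟨Φ, hinj, ?_, hΦlie⟩
  -- Surjectivity onto S_0 follows by comparing dimensions.
  refine Submodule.eq_of_le_of_finrank_le ?_ ?_
  · rintro _ ⟨w, rfl⟩
    rw [hΦsum]
    exact Submodule.sum_mem _ fun r _ =>
      stringMap_mem (fun u hu => lie_mem_socPart D E _ hu) (hmem r) _
  · rw [LinearMap.finrank_range_of_inj hinj, Module.finrank_directSum, socPart_zero_eq hn hD hE hk hl]
    simp only [finrank_irr]
    rw [sum_clebschGordan]
    refine (finrank_tensorSub_le D E _ _).trans (le_of_eq ?_)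
    rw [← extSeq_of_lt a hk, ← extSeq_of_lt b hl]

end zero

/-! ### The part of degree one -/

section one

variable {x y : ℕ → F} {κ κ' : ℕ → ℕ}

/-- In a highest weight vector of S_1 the component in V(a_0) ⊗ V(b_1) determines the one in V(a_1)
⊗ V(b_0), because the link V(a_1) → V(a_0) is non-zero. -/
theorem eq_zero_of_socPart_one (hD : D.ChainData x κ) (hE : E.ChainData y κ') (hk : 1 < k)
    {q : V ⊗[F] W} (hq : q ∈ socPart n D E 1) (hEq : ⁅ofSL2 F n sE, q⁆ = 0)
    (h : ∀ s t, tcf D E 0 s 1 t q = 0) : q = 0 := by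
  have h1 := (isPair_tcf hD hE hEq hq.2 0 0).right_eq_zero (hD.ne_zero 0 hk) (hD.le_left 0 hk) h
  refine ext_tcf D E fun i s j t _ _ => ?_
  rw [map_zero]
  by_cases hij : i + j = 1
  · rcases Nat.eq_zero_or_pos i with hi | hi
    · obtain ⟨rfl, rfl⟩ : i = 0 ∧ j = 1 := by omega
      exact h s t
    · obtain ⟨rfl, rfl⟩ : i = 1 ∧ j = 0 := by omega
      exact h1 s t
  · exact ((mem_socPart D E).1 hq).1 i s j t hij

theorem socPart_one_eq_bot (hD : D.ChainData x κ) (hE : E.ChainData y κ') (hk : 1 < k)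
    (h : ∀ α β, IsPair (extSeq a 0) (extSeq a 1) (extSeq b 0) (extSeq b 1) (κ 0) (κ' 0) (x 0) (y 0)
      α β → ∀ s t, α s t = 0) : socPart n D E 1 = ⊥ :=
  eq_bot_of_killed D E (fun _ hu => lie_mem_socPart D E _ hu) fun _ hu hEu =>
    eq_zero_of_socPart_one hD hE hk hu hEu (h _ _ (isPair_tcf hD hE hEu hu.2 0 0))

theorem socPart_one_eq_bot_of_length (hD : D.ChainData x κ) (hE : E.ChainData y κ') (hk : 1 < k)
    (hl : l ≤ 1) : socPart n D E 1 = ⊥ :=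
  eq_bot_of_killed D E (fun _ hu => lie_mem_socPart D E _ hu) fun u hu hEu =>
    eq_zero_of_socPart_one hD hE hk hu hEu fun s t => by rw [tcf_of_ge_right D E hl]; rfl

/-- Highest weight vectors of V(a_0) ⊗ V(b_1) on a fixed antidiagonal form at most a line, so a
non-zero solution confined to antidiagonal r yields exactly one copy of V(a_0 + b_1 - 2r). -/
theorem sl2Iso_socPart_one (hn : 1 ≤ n) (hD : D.ChainData x κ) (hE : E.ChainData y κ') (hk : 1 < k)
    (hl : 1 < l) {r μ : ℕ} (hμ : μ + 2 * r = extSeq a 0 + extSeq b 1)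
    (hsupp : ∀ α β, IsPair (extSeq a 0) (extSeq a 1) (extSeq b 0) (extSeq b 1) (κ 0) (κ' 0)
      (x 0) (y 0) α β → ∀ s t, α s t ≠ 0 → s + t = r)
    (hex : ∃ α β, IsPair (extSeq a 0) (extSeq a 1) (extSeq b 0) (extSeq b 1) (κ 0) (κ' 0)
      (x 0) (y 0) α β ∧ ∃ s t, α s t ≠ 0) :
    Sl2Iso n (socPart n D E 1) (Irr F μ) := by
  obtain ⟨α, β, hαβ, s₀, t₀, h0⟩ := hex
  have hr := hsupp α β hαβ s₀ t₀ h0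
  set f : ℕ → ℕ → ℕ → ℕ → F := fun i s j t =>
    if i = 0 ∧ j = 1 then α s t else if i = 1 ∧ j = 0 then β s t else 0 with hf
  set p := ofCoord D E f with hpdef
  have hp : ∀ i s j t, tcf D E i s j t p = f i s j t := by
    refine tcf_ofCoord_of_support fun i s j t h => ?_
    simp only [hf]
    split_ifs with h1 h1
    · obtain ⟨rfl, rfl⟩ := h1
      rcases h with h | h | h | h
      · omega
      · exact hαβ.hw_left.left _ _ h
      · omega
      · exact hαβ.hw_left.right _ _ h
    · obtain ⟨rfl, rfl⟩ := h1
      rcases h with h | h | h | h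
      · omega
      · exact hαβ.hw_right.left _ _ h
      · omega
      · exact hαβ.hw_right.right _ _ h
    · rfl
  have hp01 : ∀ s t, tcf D E 0 s 1 t p = α s t := fun s t => by simp [hp, hf]
  have hp10 : ∀ s t, tcf D E 1 s 0 t p = β s t := fun s t => by simp [hp, hf]
  have hpz : ∀ i s j t, i + j ≠ 1 → tcf D E i s j t p = 0 := fun i s j t h => by
    rw [hp]; simp only [hf]; rw [if_neg (by omega), if_neg (by omega)]
  have hEp : ⁅ofSL2 F n sE, p⁆ = 0 := by
    refine ext_tcf D E fun i s j t _ _ => ?_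
    rw [tcf_sE, map_zero]
    by_cases hij : i + j = 1
    · rcases Nat.eq_zero_or_pos i with hi | hi
      · obtain ⟨rfl, rfl⟩ : i = 0 ∧ j = 1 := by omega
        rw [hp01, hp01]; exact hαβ.hw_left.lie s t
      · obtain ⟨rfl, rfl⟩ : i = 1 ∧ j = 0 := by omega
        rw [hp10, hp10]; exact hαβ.hw_right.lie s t
    · rw [hpz _ _ _ _ hij, hpz _ _ _ _ hij, mul_zero, mul_zero, add_zero]
  have hlow : ⁅galV n (bv F (2 * n - 1) (2 * n - 1)), p⁆ = 0 := by
    refine low_eq_zero_of_tcf hD hE fun i s j t hs ht => ?_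
    by_cases hij : i + j = 0
    · obtain ⟨rfl, rfl⟩ : i = 0 ∧ j = 0 := by omega
      rw [zero_add, hp01, hp10]; exact hαβ.low s t hs ht
    · rw [hpz _ _ _ _ (by omega), hpz _ _ _ _ (by omega), mul_zero, mul_zero, add_zero]
  have hpS : p ∈ socPart n D E 1 := by
    -- As e p = 0, the set {p, 0} is e-stable and only v_m has to be tested.
    refine (mem_socPart D E).2 ⟨hpz, mem_heisInvariants_of_low hn {p, 0} ?_ ?_ (Or.inl rfl)⟩
    · rintro u (rfl | rfl)
      · exact Or.inr hEp
      · exact Or.inr (lie_zero _)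
    · rintro u (rfl | rfl)
      · exact hlow
      · exact lie_zero _
  have hp0 : p ≠ 0 := fun h => h0 (by rw [← hp01, h, map_zero])
  refine sl2Iso_socPart hp0 hpS hEp ?_ ?_
  -- h p - μ p is killed by e, lies in S_1 and has zero component in V(a_0) ⊗ V(b_1), since α lives
  -- on s + t = r.
  · rw [← sub_eq_zero]
    refine eq_zero_of_socPart_one hD hE hk
      (Submodule.sub_mem _ (lie_mem_socPart D E _ hpS) (Submodule.smul_mem _ _ hpS)) ?_ ?_
    · have := leibniz_lie (ofSL2 F n sH) (ofSL2 F n sE) p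
      rw [(isSl2Triple F n).lie_h_e_smul (R := F), smul_lie, hEp, smul_zero, zero_add, lie_zero] at this
      rw [lie_sub, lie_smul, hEp, smul_zero, sub_zero, ← this]
    · intro s t
      rw [map_sub, map_smul, tcf_sH, hp01, smul_eq_mul]
      by_cases hst : α s t = 0
      · rw [hst, mul_zero, mul_zero, sub_zero]
      · have h1 := congrArg (Nat.cast : ℕ → F) hμ
        rw [← hsupp α β hαβ s t hst] at h1
        push_cast at h1
        linear_combination -(α s t) * h1
  · intro u hu hEu
    obtain ⟨c, -, hc⟩ := hαβ.hw_left.exists_coeff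
    obtain ⟨d, -, hd⟩ := (isHW_tcf D E hEu 0 1).exists_coeff
    refine ⟨d r / c r, sub_eq_zero.1 (eq_zero_of_socPart_one hD hE hk
      (Submodule.sub_mem _ hu (Submodule.smul_mem _ _ hpS)) ?_ fun s t => ?_)⟩
    · rw [lie_sub, lie_smul, hEu, hEp, smul_zero, sub_zero]
    · have hcr : c r ≠ 0 := fun h => h0 (by rw [hc, hr, h, zero_mul])
      rw [map_sub, map_smul, hp01, smul_eq_mul, hc]
      have h1 := hd s t
      rw [h1]
      by_cases hst : s + t = r
      · rw [hst]; field_simp; ring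
      · have h2 : tcf D E 0 s 1 t u = 0 :=
          by_contra fun h => hst (hsupp _ _ (isPair_tcf hD hE hEu hu.2 0 0) s t h)
        have h3 : α s t = 0 := by_contra fun h => hst (hsupp _ _ hαβ s t h)
        rw [← h1, h2, ← hc, h3, mul_zero, sub_zero]

end one

end parts

/-! ### Vanishing in degree at least two, and S_1 case by case. -/

section main

set_option linter.unusedSectionVars false

variable {F : Type*} [Field F] [CharZero F] {n : ℕ} {V W : Type*} [AddCommGroup V] [Module F V]
  [LieRingModule (Gal F n) V] [LieModule F (Gal F n) V] [AddCommGroup W] [Module F W]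
  [LieRingModule (Gal F n) W] [LieModule F (Gal F n) W] {l : ℕ} {a : Fin 3 → ℕ} {b : Fin l → ℕ}
  {D : SocleDecomposition F n V a} {E : SocleDecomposition F n W b}
  {x y : ℕ → F} {κ κ' : ℕ → ℕ}

/-! ### Invariants have degree at most one -/

/-- V(a_1) ⊗ V(b_{j+1}) carries the second array of the pair (0, j + 1) and the first array of the
pair (1, j). If a_1 = a_0 ± m, then a_2 = a_0 makes one link of V₁ rise and the other fall. When the
weights of V₂ fall, one of the two pairs is zero; when they rise, one pair allows only antidiagonal
0 and the other only a positive one. For a_0 = 1, a_1 = m - 1 the first pair suffices, as b_{j+1} ≥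
m > 0 if the weights rise. -/
theorem tcf_middle_eq_zero (hn : 1 ≤ n) (hD : D.ChainData x κ) (hE : E.ChainData y κ')
    (ha2 : extSeq a 2 = extSeq a 0)
    (ha : extSeq a 1 = extSeq a 0 + (2 * n - 1) ∨ (n = 1 ∧ extSeq a 0 = extSeq a 1 + 1) ∨
      (extSeq a 0 = 1 ∧ extSeq a 1 + 1 = 2 * n - 1))
    (hb : (∀ j, j + 1 < l → extSeq b j + (2 * n - 1) = extSeq b (j + 1)) ∨
      ∀ j, j + 1 < l → extSeq b j = extSeq b (j + 1) + (2 * n - 1))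
    {q : V ⊗[F] W} (hq : ⁅ofSL2 F n sE, q⁆ = 0) (hq' : q ∈ heisInvariants (F := F) n (V ⊗[F] W))
    {j : ℕ} (hj : j + 2 < l) (s t : ℕ) : tcf D E 1 s (j + 1) t q = 0 := by
  have hP := isPair_tcf hD hE hq hq' 0 (j + 1)
  have hQ := isPair_tcf hD hE hq hq' 1 j
  have hx0 := hD.ne_zero 0 (by omega)
  have hx1 := hD.ne_zero 1 (by omega)
  have hy0 := hE.ne_zero j (by omega)
  have hy1 := hE.ne_zero (j + 1) (by omega)
  have wx0 := hD.weight 0 (by omega)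
  have wx1 := hD.weight 1 (by omega)
  have wy0 := hE.weight j (by omega)
  have wy1 := hE.weight (j + 1) (by omega)
  simp only [zero_add, one_add_one_eq_two] at hP hQ wx0 wx1
  have hm : 0 < 2 * n - 1 := by omega
  -- Recorded before `2 * n - 1` becomes an opaque variable.
  have hmn : n = 1 → 2 * n - 1 = 1 := by omega
  generalize 2 * n - 1 = m at *
  rcases ha with ha | ⟨h1, ha⟩ | ⟨ha, ha'⟩
  · have h0 : κ 0 = 0 := by omega
    have h1 : κ 1 = m := by omega
    rw [h0] at hP
    rw [h1] at hQ
    rcases hb with hb | hb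
    · have b0 := hb j (by omega)
      have b1 := hb (j + 1) (by omega)
      have h2 : κ' j = 0 := by omega
      have h3 : κ' (j + 1) = 0 := by omega
      rw [h3] at hP
      rw [h2] at hQ
      by_contra hne
      have h4 := (hQ.support_top_zero hx1 hy0 hm (by omega) b0 (s := s) (t := t)).1 hne
      exact hne (hP.support_zero_zero hx0 hy1 hm ha.symm b1 (by omega)).2
    · have b0 := hb j (by omega)
      have h2 : κ' j = m := by omega
      rw [h2] at hQ
      exact (hQ.eq_zero_top_top hx1 hy0 hm (by omega) b0).1 s t
  · have hm1 := hmn h1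
    have h0 : κ 0 = m := by omega
    have h1' : κ 1 = 0 := by omega
    rw [h0] at hP
    rw [h1'] at hQ
    rcases hb with hb | hb
    · have b0 := hb j (by omega)
      have b1 := hb (j + 1) (by omega)
      have h2 : κ' j = 0 := by omega
      have h3 : κ' (j + 1) = 0 := by omega
      rw [h3] at hP
      rw [h2] at hQ
      by_contra hne
      have h4 := (hP.support_top_zero hx0 hy1 hm (by omega) b1 (s := s) (t := t)).2 hne
      exact hne (hQ.support_zero_zero hx1 hy0 hm (by omega) b0 (by omega)).1
    · have b1 := hb (j + 1) (by omega)
      have h2 : κ' (j + 1) = m := by omega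
      rw [h2] at hP
      exact (hP.eq_zero_top_top hx0 hy1 hm (by omega) b1).2 s t
  · have h0 : κ 0 = 1 := by omega
    rw [h0, ha] at hP
    rcases hb with hb | hb
    · have b0 := hb j (by omega)
      have b1 := hb (j + 1) (by omega)
      have h3 : κ' (j + 1) = 0 := by omega
      rw [h3] at hP
      refine hP.right_eq_zero hx0 le_rfl (fun s t => ?_) s t
      by_contra hne
      have := (hP.support_one_zero hy1 hne).2
      omega
    · have b1 := hb (j + 1) (by omega)
      have h2 : κ' (j + 1) = m := by omega
      rw [h2] at hP
      exact (hP.eq_zero_one_top hx0 hy1 b1).2 s t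

/-- The component V(a_1) ⊗ V(b_{j+1}) controls its two neighbours. It vanishes by
`tcf_middle_eq_zero` or, if there is no V(b_{j+2}), because the first array of its pair is zero. -/
theorem socPart_eq_bot_of_two_le (hn : 1 ≤ n) (hD : D.ChainData x κ) (hE : E.ChainData y κ')
    (ha2 : extSeq a 2 = extSeq a 0)
    (ha : extSeq a 1 = extSeq a 0 + (2 * n - 1) ∨ (n = 1 ∧ extSeq a 0 = extSeq a 1 + 1) ∨
      (extSeq a 0 = 1 ∧ extSeq a 1 + 1 = 2 * n - 1))
    (hb : (∀ j, j + 1 < l → extSeq b j + (2 * n - 1) = extSeq b (j + 1)) ∨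
      ∀ j, j + 1 < l → extSeq b j = extSeq b (j + 1) + (2 * n - 1))
    {r : ℕ} (hr : 2 ≤ r) : socPart n D E r = ⊥ := by
  refine eq_bot_of_killed D E (fun _ hu => lie_mem_socPart D E _ hu) fun u hu hEu => ?_
  obtain ⟨j, rfl⟩ : ∃ j, r = j + 2 := ⟨r - 2, by omega⟩
  have hP := isPair_tcf hD hE hEu hu.2 0 (j + 1)
  have hQ := isPair_tcf hD hE hEu hu.2 1 j
  have hmid : ∀ s t, tcf D E 1 s (j + 1) t u = 0 := by
    rcases Nat.lt_or_ge (j + 2) l with h | h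
    · exact tcf_middle_eq_zero hn hD hE ha2 ha hb hEu hu.2 h
    · exact hP.right_eq_zero (hD.ne_zero 0 (by omega)) (hD.le_left 0 (by omega)) fun s t => by
        rw [tcf_of_ge_right D E h]; rfl
  have htop : ∀ s t, tcf D E 0 s (j + 2) t u = 0 := by
    rcases Nat.lt_or_ge (j + 2) l with h | h
    · exact hP.left_eq_zero (hE.ne_zero (j + 1) h) (hE.le_left (j + 1) h) hmid
    · intro s t; rw [tcf_of_ge_right D E h]; rfl
  have hbot := hQ.right_eq_zero (hD.ne_zero 1 (by omega)) (hD.le_left 1 (by omega)) hmid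
  refine ext_tcf D E fun i s j' t _ _ => ?_
  rw [map_zero]
  by_cases hij : i + j' = j + 2
  · rcases Nat.lt_or_ge i 3 with hi | hi
    · interval_cases i
      · obtain rfl : j' = j + 2 := by omega
        exact htop s t
      · obtain rfl : j' = j + 1 := by omega
        exact hmid s t
      · obtain rfl : j' = j := by omega
        exact hbot s t
    · rw [tcf_of_ge_left D E hi]; rfl
  · exact ((mem_socPart D E).1 hu).1 i s j' t hij

theorem heisInvariants_le (hn : 1 ≤ n) (hD : D.ChainData x κ) (hE : E.ChainData y κ')
    (h : ∀ r, 2 ≤ r → socPart n D E r = ⊥) :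
    heisInvariants (F := F) n (V ⊗[F] W) ≤ socPart n D E 0 ⊔ socPart n D E 1 := by
  intro q hq
  rw [← sum_degProj D E q]
  refine Submodule.sum_mem _ fun r _ => ?_
  have h1 := degProj_mem_socPart hn hD hE hq r
  match r, h1 with
  | 0, h1 => exact Submodule.mem_sup_left h1
  | 1, h1 => exact Submodule.mem_sup_right h1
  | r + 2, h1 =>
    rw [h _ (by omega), Submodule.mem_bot] at h1
    rw [h1]; exact Submodule.zero_mem _

/-! ### The part of degree one, case by case -/

/-- κ = κ' = 0 leaves antidiagonal 0, of weight a_0 + b_1. -/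
theorem socPart_one_raise_raise (hn : 1 ≤ n) (hl : 1 < l) (hD : D.ChainData x κ)
    (hE : E.ChainData y κ') (ha : extSeq a 1 = extSeq a 0 + (2 * n - 1))
    (hb : extSeq b 1 = extSeq b 0 + (2 * n - 1)) :
    Sl2Iso n (socPart n D E 1) (Irr F (extSeq a 0 + extSeq b 0 + (2 * n - 1))) := by
  have hx := hD.ne_zero 0 (by omega)
  have hy := hE.ne_zero 0 (by omega)
  have wx := hD.weight 0 (by omega)
  have wy := hE.weight 0 (by omega)
  rw [zero_add] at wx wy
  have h0 : κ 0 = 0 := by omega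
  have h1 : κ' 0 = 0 := by omega
  refine sl2Iso_socPart_one hn hD hE (by omega) hl (r := 0) (by omega) ?_ ?_
  · rw [h0, h1]
    intro α β h s t hne
    by_contra hst
    exact hne (h.support_zero_zero hx hy (m := 2 * n - 1) (by omega) ha.symm hb.symm hst).1
  · rw [h0, h1]
    obtain ⟨β, hβ⟩ := exists_pair_zero_zero (a := extSeq a 0) (c := extSeq a 1)
      (b := extSeq b 0) (d := extSeq b 1) (y := y 0) hx
    exact ⟨_, β, hβ, 0, 0, hwv_ne_zero rfl⟩

/-- κ = 0 and κ' = m leave antidiagonal a_0, of weight a_0 + b_1 - 2a_0. -/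
theorem socPart_one_raise_lower (hn : 1 ≤ n) (hl : 1 < l) (hD : D.ChainData x κ)
    (hE : E.ChainData y κ') (ha : extSeq a 1 = extSeq a 0 + (2 * n - 1))
    (hb : extSeq b 1 + (2 * n - 1) = extSeq b 0) :
    (extSeq a 0 ≤ extSeq b 1 → Sl2Iso n (socPart n D E 1) (Irr F (extSeq b 1 - extSeq a 0))) ∧
      (extSeq b 1 < extSeq a 0 → socPart n D E 1 = ⊥) := by
  have hx := hD.ne_zero 0 (by omega)
  have hy := hE.ne_zero 0 (by omega)
  have wx := hD.weight 0 (by omega)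
  have wy := hE.weight 0 (by omega)
  rw [zero_add] at wx wy
  have h0 : κ 0 = 0 := by omega
  have h1 : κ' 0 = 2 * n - 1 := by omega
  have hsupp : ∀ α β, IsPair (extSeq a 0) (extSeq a 1) (extSeq b 0) (extSeq b 1) (κ 0) (κ' 0)
      (x 0) (y 0) α β → ∀ s t, α s t ≠ 0 → s + t = extSeq a 0 ∧ extSeq a 0 ≤ extSeq b 1 := by
    rw [h0, h1]
    intro α β h s t hne
    exact (h.support_zero_top hx hy (by omega) ha.symm hb.symm).1 hne
  refine ⟨fun hab => ?_, fun hab => ?_⟩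
  · refine sl2Iso_socPart_one hn hD hE (by omega) hl (r := extSeq a 0) (by omega)
      (fun α β h s t hne => (hsupp α β h s t hne).1) ?_
    rw [h0, h1]
    obtain ⟨β, hβ⟩ := exists_pair_zero_top (y := y 0) hx ha.symm hb.symm hab
    exact ⟨_, β, hβ, 0, _, hwv_ne_zero (zero_add _)⟩
  · refine socPart_one_eq_bot hD hE (by omega) fun α β h s t => ?_
    by_contra hne
    have := (hsupp α β h s t hne).2
    omega

/-- κ = m and κ' = 0 leave antidiagonal b_1, of weight a_0 + b_1 - 2b_1. -/
theorem socPart_one_lower_raise (hn : 1 ≤ n) (hl : 1 < l) (hD : D.ChainData x κ)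
    (hE : E.ChainData y κ') (ha : extSeq a 0 = extSeq a 1 + (2 * n - 1))
    (hb : extSeq b 1 = extSeq b 0 + (2 * n - 1)) :
    (extSeq b 1 ≤ extSeq a 0 → Sl2Iso n (socPart n D E 1) (Irr F (extSeq a 0 - extSeq b 1))) ∧
      (extSeq a 0 < extSeq b 1 → socPart n D E 1 = ⊥) := by
  have hx := hD.ne_zero 0 (by omega)
  have hy := hE.ne_zero 0 (by omega)
  have wx := hD.weight 0 (by omega)
  have wy := hE.weight 0 (by omega)
  rw [zero_add] at wx wy
  have h0 : κ 0 = 2 * n - 1 := by omega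
  have h1 : κ' 0 = 0 := by omega
  refine ⟨fun hab => ?_, fun hab => ?_⟩
  · refine sl2Iso_socPart_one hn hD hE (by omega) hl (r := extSeq b 1) (by omega) ?_ ?_
    · rw [h0, h1]
      intro α β h s t hne
      rw [hb]
      exact (h.support_top_zero hx hy (by omega) ha hb.symm).1 hne
    · rw [h0, h1]
      exact exists_pair_top_zero hx hy ha hb.symm (by omega)
  · refine socPart_one_eq_bot hD hE (by omega) ?_
    rw [h0, h1]
    intro α β h s t
    -- A non-zero β would require b_0 ≤ a_1, that is b_1 ≤ a_0.
    refine h.left_eq_zero hy (Nat.zero_le _) (fun s t => ?_) s t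
    by_contra hne
    have := ((h.support_top_zero hx hy (by omega) ha hb.symm).2 hne).2
    omega

theorem socPart_one_lower_lower (hn : 1 ≤ n) (hl : 1 < l) (hD : D.ChainData x κ)
    (hE : E.ChainData y κ') (ha : extSeq a 0 = extSeq a 1 + (2 * n - 1))
    (hb : extSeq b 1 + (2 * n - 1) = extSeq b 0) : socPart n D E 1 = ⊥ := by
  have wx := hD.weight 0 (by omega)
  have wy := hE.weight 0 (by omega)
  rw [zero_add] at wx wy
  have h0 : κ 0 = 2 * n - 1 := by omega
  have h1 : κ' 0 = 2 * n - 1 := by omega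
  refine socPart_one_eq_bot hD hE (by omega) ?_
  rw [h0, h1]
  intro α β h
  exact (h.eq_zero_top_top (hD.ne_zero 0 (by omega)) (hE.ne_zero 0 (by omega)) (by omega) ha
    hb.symm).1

/-- κ = 1 and κ' = 0 leave antidiagonal 1 with b_0 = 0; then b_1 = m and the weight is 1 + m - 2 =
2n - 2. -/
theorem socPart_one_one_raise (hn : 1 ≤ n) (hl : 1 < l) (hD : D.ChainData x κ)
    (hE : E.ChainData y κ') (ha : extSeq a 0 = 1) (ha' : extSeq a 1 + 1 = 2 * n - 1)
    (hb : extSeq b 1 = extSeq b 0 + (2 * n - 1)) :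
    (extSeq b 0 = 0 → Sl2Iso n (socPart n D E 1) (Irr F (2 * n - 2))) ∧
      (extSeq b 0 ≠ 0 → socPart n D E 1 = ⊥) := by
  have hx := hD.ne_zero 0 (by omega)
  have hy := hE.ne_zero 0 (by omega)
  have wx := hD.weight 0 (by omega)
  have wy := hE.weight 0 (by omega)
  rw [zero_add] at wx wy
  have h0 : κ 0 = 1 := by omega
  have h1 : κ' 0 = 0 := by omega
  have hsupp : ∀ α β, IsPair (extSeq a 0) (extSeq a 1) (extSeq b 0) (extSeq b 1) (κ 0) (κ' 0)
      (x 0) (y 0) α β → ∀ s t, α s t ≠ 0 → s + t = 1 ∧ extSeq b 0 = 0 := by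
    rw [h0, h1, ha]
    intro α β h s t hne
    exact h.support_one_zero hy hne
  refine ⟨fun hb0 => ?_, fun hb0 => ?_⟩
  · refine sl2Iso_socPart_one hn hD hE (by omega) hl (r := 1) (by omega)
      (fun α β h s t hne => (hsupp α β h s t hne).1) ?_
    rw [h0, h1, ha, hb0]
    obtain ⟨β, hβ⟩ := exists_pair_one_zero (c := extSeq a 1) (d := extSeq b 1) (y := y 0) hx
      (by omega)
    exact ⟨_, β, hβ, 0, 1, hwv_ne_zero (zero_add _)⟩
  · refine socPart_one_eq_bot hD hE (by omega) fun α β h s t => ?_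
    by_contra hne
    exact hb0 (hsupp α β h s t hne).2

theorem socPart_one_one_lower (hl : 1 < l) (hD : D.ChainData x κ)
    (hE : E.ChainData y κ') (ha : extSeq a 0 = 1) (ha' : extSeq a 1 + 1 = 2 * n - 1)
    (hb : extSeq b 1 + (2 * n - 1) = extSeq b 0) : socPart n D E 1 = ⊥ := by
  have wx := hD.weight 0 (by omega)
  have wy := hE.weight 0 (by omega)
  rw [zero_add] at wx wy
  have h0 : κ 0 = 1 := by omega
  have h1 : κ' 0 = 2 * n - 1 := by omega
  refine socPart_one_eq_bot hD hE (by omega) ?_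
  rw [h0, h1, ha]
  intro α β h
  exact (h.eq_zero_one_top (hD.ne_zero 0 (by omega)) (hE.ne_zero 0 (by omega)) hb.symm).1

/-- Serves to place S_1 in the socle, whatever its weight. -/
theorem socPart_one_dichotomy (hn : 1 ≤ n) (hD : D.ChainData x κ) (hE : E.ChainData y κ')
    (ha : extSeq a 1 = extSeq a 0 + (2 * n - 1) ∨ (n = 1 ∧ extSeq a 0 = extSeq a 1 + 1) ∨
      (extSeq a 0 = 1 ∧ extSeq a 1 + 1 = 2 * n - 1))
    (hb : (∀ j, j + 1 < l → extSeq b j + (2 * n - 1) = extSeq b (j + 1)) ∨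
      ∀ j, j + 1 < l → extSeq b j = extSeq b (j + 1) + (2 * n - 1)) :
    socPart n D E 1 = ⊥ ∨ ∃ μ, Sl2Iso n (socPart n D E 1) (Irr F μ) := by
  rcases Nat.lt_or_ge 1 l with hl | hl
  · rcases ha with ha | ⟨h1, ha⟩ | ⟨ha, ha'⟩ <;> rcases hb with hb | hb
    · exact Or.inr ⟨_, socPart_one_raise_raise hn hl hD hE ha (hb 0 hl).symm⟩
    · have h := socPart_one_raise_lower hn hl hD hE ha (hb 0 hl).symm
      rcases Nat.lt_or_ge (extSeq b 1) (extSeq a 0) with hab | hab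
      · exact Or.inl (h.2 hab)
      · exact Or.inr ⟨_, h.1 hab⟩
    · have h := socPart_one_lower_raise hn hl hD hE (by omega) (hb 0 hl).symm
      rcases Nat.lt_or_ge (extSeq a 0) (extSeq b 1) with hab | hab
      · exact Or.inl (h.2 hab)
      · exact Or.inr ⟨_, h.1 hab⟩
    · exact Or.inl (socPart_one_lower_lower hn hl hD hE (by omega) (hb 0 hl).symm)
    · have h := socPart_one_one_raise hn hl hD hE ha ha' (hb 0 hl).symm
      by_cases hb0 : extSeq b 0 = 0
      · exact Or.inr ⟨_, h.1 hb0⟩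
      · exact Or.inl (h.2 hb0)
    · exact Or.inl (socPart_one_one_lower hl hD hE ha ha' (hb 0 hl).symm)
  · exact Or.inl (socPart_one_eq_bot_of_length hD hE (by omega) hl)

end main

end Galilean

open Galilean in
theorem theorem4p7 {F : Type*} [Field F] [CharZero F] (n : ℕ) (hn : 1 ≤ n) (ℓ : ℕ)
    {V₁ V₂ : Type*}
    [AddCommGroup V₁] [Module F V₁] [LieRingModule (Gal F n) V₁] [LieModule F (Gal F n) V₁]
    [AddCommGroup V₂] [Module F V₂] [LieRingModule (Gal F n) V₂] [LieModule F (Gal F n) V₂]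
    (hV₁ : IsStandardFaithful F n V₁) (hV₂ : IsTypeZ F n V₂)
    (a : Fin 3 → ℕ) (D₁ : SocleDecomposition F n V₁ a)
    (b : Fin (ℓ + 1) → ℕ) (D₂ : SocleDecomposition F n V₂ b) :
    -- `soc(V₁ ⊗ V₂) = S₀ ⊕ S₁`
    (socle F (Gal F n) (V₁ ⊗[F] V₂)).toSubmodule = socPart n D₁ D₂ 0 ⊔ socPart n D₁ D₂ 1 ∧
    Disjoint (socPart n D₁ D₂ 0) (socPart n D₁ D₂ 1) ∧
    -- `S₀`
    socPart n D₁ D₂ 0 =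
      tensorSub (socle F (Gal F n) V₁).toSubmodule (socle F (Gal F n) V₂).toSubmodule ∧
    Sl2Iso n (socPart n D₁ D₂ 0)
      (⨁ k : Fin (min (a 0) (b 0) + 1), Irr F (a 0 + b 0 - 2 * k.1)) ∧
    -- `S₁` for `ℓ = 0`
    (ℓ = 0 → socPart n D₁ D₂ 1 = ⊥) ∧
    -- `S₁` for `n = 1`, `ℓ ≥ 1` and `V₂ = Z(b_0, ℓ)`; rows `FU⁺_(a_0)` and `FU⁻_(a_0)`
    (n = 1 → 1 ≤ ℓ → IsZ F n V₂ (b 0) ℓ →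
      (a 1 = a 0 + 1 → Sl2Iso n (socPart n D₁ D₂ 1) (Irr F (a 0 + b 0 + 1))) ∧
      (a 0 = a 1 + 1 →
        (b 1 ≤ a 0 → Sl2Iso n (socPart n D₁ D₂ 1) (Irr F (a 0 - b 1))) ∧
        (a 0 < b 1 → socPart n D₁ D₂ 1 = ⊥))) ∧
    -- `S₁` for `n = 1`, `ℓ ≥ 1` and `V₂ = Z(b_ℓ, ℓ)^*`; the same rows
    (n = 1 → 1 ≤ ℓ → IsZDual F n V₂ (b (Fin.last ℓ)) ℓ →
      (a 1 = a 0 + 1 →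
        (a 0 ≤ b 1 → Sl2Iso n (socPart n D₁ D₂ 1) (Irr F (b 1 - a 0))) ∧
        (b 1 < a 0 → socPart n D₁ D₂ 1 = ⊥)) ∧
      (a 0 = a 1 + 1 → socPart n D₁ D₂ 1 = ⊥)) ∧
    -- `S₁` for `n > 1`, `ℓ ≥ 1` and `V₂ = Z(b_0, ℓ)`; rows `FU_(a_0, a_0 + m, a_0)`, `a_0 = 0, 1`,
    -- and `FU_(1, m - 1, 1)`, where `m = 2n - 1`
    (1 < n → 1 ≤ ℓ → IsZ F n V₂ (b 0) ℓ →
      (a 0 ≤ 1 → a 1 = a 0 + (2 * n - 1) →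
        Sl2Iso n (socPart n D₁ D₂ 1) (Irr F (a 0 + b 0 + (2 * n - 1)))) ∧
      (a 0 = 1 → a 1 = 2 * n - 2 →
        (b 0 = 0 → Sl2Iso n (socPart n D₁ D₂ 1) (Irr F (2 * n - 2))) ∧
        (b 0 ≠ 0 → socPart n D₁ D₂ 1 = ⊥))) ∧
    -- `S₁` for `n > 1`, `ℓ ≥ 1` and `V₂ = Z(b_ℓ, ℓ)^*`; the same rows
    (1 < n → 1 ≤ ℓ → IsZDual F n V₂ (b (Fin.last ℓ)) ℓ →
      (a 0 ≤ 1 → a 1 = a 0 + (2 * n - 1) →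
        (a 0 ≤ b 1 → Sl2Iso n (socPart n D₁ D₂ 1) (Irr F (b 1 - a 0))) ∧
        (b 1 < a 0 → socPart n D₁ D₂ 1 = ⊥)) ∧
      (a 0 = 1 → a 1 = 2 * n - 2 → socPart n D₁ D₂ 1 = ⊥)) := by

  obtain ⟨hc₁, ha2, ha⟩ := standardFaithful_shape hn hV₁ D₁
  obtain ⟨hc₂, hb⟩ := typeZ_shape hn hV₂ D₂
  obtain ⟨x, κ, hD⟩ := hc₁.exists_data hn
  obtain ⟨y, κ', hE⟩ := hc₂.exists_data hn
  have ea0 : extSeq a 0 = a 0 := extSeq_coe a 0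
  have ea1 : extSeq a 1 = a 1 := extSeq_coe a 1
  have ea2 : extSeq a 2 = a 2 := extSeq_coe a 2
  have eb0 : extSeq b 0 = b 0 := extSeq_coe b 0
  -- For ℓ = 0 the literal `1 : Fin (ℓ + 1)` denotes 0, hence the condition.
  have eb1 : 1 ≤ ℓ → extSeq b 1 = b 1 := fun h => by
    rw [extSeq_of_lt b (by omega : 1 < ℓ + 1)]
    congr 1
    refine Fin.ext ?_
    rw [Fin.val_one']
    exact (Nat.mod_eq_of_lt (by omega)).symm
  have ha' : extSeq a 1 = extSeq a 0 + (2 * n - 1) ∨ (n = 1 ∧ extSeq a 0 = extSeq a 1 + 1) ∨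
      (extSeq a 0 = 1 ∧ extSeq a 1 + 1 = 2 * n - 1) := by
    rw [ea0, ea1]
    exact ha.imp_right (Or.imp_right And.right)
  have hb' : (∀ j, j + 1 < ℓ + 1 → extSeq b j + (2 * n - 1) = extSeq b (j + 1)) ∨
      ∀ j, j + 1 < ℓ + 1 → extSeq b j = extSeq b (j + 1) + (2 * n - 1) := by
    refine hb.imp (fun h j hj => ?_) (fun h j hj => ?_)
    · rw [h j (by omega), h (j + 1) hj]; ring
    · have h1 := h j (by omega)
      have h2 := h (j + 1) hj
      rw [add_mul, one_mul] at h2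
      omega
  have hS0 := socPart_zero_eq hn hD hE (by omega) (by omega)
  have hiso := sl2Iso_socPart_zero hn hD hE (by omega) (by omega) ea0 eb0
  have hle1 : socPart n D₁ D₂ 1 ≤ (socle F (Gal F n) (V₁ ⊗[F] V₂)).toSubmodule := by
    rcases socPart_one_dichotomy hn hD hE ha' hb' with h | ⟨μ, h⟩
    · rw [h]; exact bot_le
    · exact le_socle_of_sl2Iso (socPart_le D₁ D₂ 1) h
  refine ⟨le_antisymm ?_ (sup_le ?_ hle1), disjoint_socPart D₁ D₂ zero_ne_one, ?_, hiso, ?_, ?_, ?_,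
    ?_, ?_⟩
  · exact (socle_le_heisInvariants hn hD hE).trans (heisInvariants_le hn hD hE fun r hr =>
      socPart_eq_bot_of_two_le hn hD hE (by omega) ha' hb' hr)
  · exact le_socle_of_sl2Iso_directSum (socPart_le D₁ D₂ 0) hiso
  · rw [hS0, D₁.socle_eq hn (by omega), D₂.socle_eq hn (by omega)]
  · rintro rfl
    exact socPart_one_eq_bot_of_length hD hE (by omega) le_rfl
  · intro hn1 hℓ hZ
    have hw := isZ_weight hn D₂ hZ hℓ
    have eb1 := eb1 hℓ
    subst hn1
    refine ⟨fun h => ?_, fun h => ?_⟩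
    · have := socPart_one_raise_raise hn (by omega) hD hE (by omega) hw
      rwa [ea0, eb0] at this
    · have := socPart_one_lower_raise hn (by omega) hD hE (by omega) hw
      rwa [ea0, eb1] at this
  · intro hn1 hℓ hZ
    have hw := isZDual_weight hn D₂ hZ hℓ
    have eb1 := eb1 hℓ
    subst hn1
    refine ⟨fun h => ?_, fun h => ?_⟩
    · have := socPart_one_raise_lower hn (by omega) hD hE (by omega) hw
      rwa [ea0, eb1] at this
    · exact socPart_one_lower_lower hn (by omega) hD hE (by omega) hw
  · intro hn1 hℓ hZ
    have hw := isZ_weight hn D₂ hZ hℓ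
    refine ⟨fun _ h => ?_, fun h0 h1 => ?_⟩
    · have := socPart_one_raise_raise hn (by omega) hD hE (by omega) hw
      rwa [ea0, eb0] at this
    · have := socPart_one_one_raise hn (by omega) hD hE (by omega) (by omega) hw
      rwa [eb0] at this
  · intro hn1 hℓ hZ
    have hw := isZDual_weight hn D₂ hZ hℓ
    have eb1 := eb1 hℓ
    refine ⟨fun _ h => ?_, fun h0 h1 => ?_⟩
    · have := socPart_one_raise_lower hn (by omega) hD hE (by omega) hw
      rwa [ea0, eb1] at this
    · exact socPart_one_one_lower (by omega) hD hE (by omega) (by omega) hw
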